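/- Let $M$ be a connected smooth $n$-dimensional manifold. A Kundt$^\infty$ triple on $M$ is a triple $(H,\mathbf W,\mathbf h)$ of a smooth function $H$, a smooth one-form $\mathbf W$ and a smooth Riemannian metric $\mathbf h$ on $M$. It is locally homogeneous if the Lorentzian metric $$\mathbf g = 2\,du\,(dv+v^2H\,du+v\mathbf W)+\mathbf h \quad\text{on } \mathbb R_u\times\mathbb R_v\times M$$ is locally homogeneous, i.e. at every point the values of the local Killing vector fields of $\mathbf g$ span the tangent space. The one-form $\mathbf W$ is left-invariant if near every point of $M$ there are $n$ linearly independent local Killing vector fields $\xi_1,\dots,\xi_n$ of $\mathbf h$ with $\mathcal L_{\xi_i}\mathbf W=0$. For $p\in M$ let $I^1=\{\mathcal L_\xi\mathbf W : \xi \text{ a Killing vector field of } \mathbf h \text{ near } p\}$, let $I^{k+1}=\{\mathcal L_\xi \mathbf v : \xi \text{ a Killing vector field of } \mathbf h \text{ near } p,\ \mathbf v\in I^k\}$ for $k\ge 1$, let $I^k|_p\subset T^*_pM$ be the set of values at $p$ of the elements of $I^k$, and let $\mathcal I_p=\operatorname{span}\bigcup_{k\ge1} I^k|_p$. Let $(H,\mathbf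 W,\mathbf h)$ be a locally homogeneous Kundt$^\infty$ triple on $M$ such that $\mathbf h$ is locally maximally symmetric, i.e. has constant curvature $\kappa$: $R(X,Y)Z=\kappa(\mathbf h(Y,Z)X-\mathbf h(X,Z)Y)$. If $n\ge 2$ and $\kappa=0$, assume moreover that $H=\tfrac18\|\mathbf W\|^2$ (that is, $\sigma=0$ in $H=\tfrac\sigma2+\tfrac18\|\mathbf W\|^2$). If $\mathbf W$ is not left-invariant, then for every $p\in M$ $$\dim I^1|_p=\dim\mathcal I_p=n .$$ -/

import Mathlib

open Bundle Filter Topology Module VectorField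
open scoped Manifold ContDiff

noncomputable section

namespace Kundt

section General

variable {E : Type*} [NormedAddCommGroup E] [NormedSpace ℝ E]
  {H : Type*} [TopologicalSpace H] (I : ModelWithCorners ℝ E H)
  {M : Type*} [TopologicalSpace M] [ChartedSpace H M]

/-- The vector field `X` (a section of the tangent bundle) is smooth at `x`. -/
def SmoothVFAt [IsManifold I 1 M] (X : Π x : M, TangentSpace I x) (x : M) : Prop :=
  ContMDiffAt I I.tangent ∞ (fun y => (⟨y, X y⟩ : TangentBundle I M)) x

/-- The vector field `ξ` is, near `p`, a smooth Killing vector field of the symmetric covariant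
2-tensor field `g`: `(£_ξ g)(X, Y) = ξ(g(X, Y)) - g([ξ, X], Y) - g(X, [ξ, Y]) = 0`. -/
def IsKillingNear [IsManifold I 1 M] (g : Π x : M, TangentSpace I x → TangentSpace I x → ℝ)
    (ξ : Π x : M, TangentSpace I x) (p : M) : Prop :=
  ∀ᶠ x in 𝓝 p, SmoothVFAt I ξ x ∧
    ∀ X Y : Π x : M, TangentSpace I x, SmoothVFAt I X x → SmoothVFAt I Y x →
      mvfderiv I (fun y => g y (X y) (Y y)) x (ξ x)
        - g x (mlieBracket I ξ X x) (Y x) - g x (X x) (mlieBracket I ξ Y x) = 0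

/-- Local homogeneity: near every point, the local Killing vector fields span the tangent space. -/
def IsLocallyHomogeneous [IsManifold I 1 M]
    (g : Π x : M, TangentSpace I x → TangentSpace I x → ℝ) : Prop :=
  ∀ (p : M) (a : TangentSpace I p),
    ∃ ξ : Π x : M, TangentSpace I x, IsKillingNear I g ξ p ∧ ξ p = a

/-- Near `p`, the one-form `β` is the Lie derivative of the one-form `α` along `ξ`:
`(£_ξ α)(X) = ξ(α(X)) - α([ξ, X])`. -/
def IsLieDerivNear [IsManifold I 1 M] (ξ : Π x : M, TangentSpace I x)
    (α β : Π x : M, TangentSpace I x →L[ℝ] ℝ) (p : M) : Prop :=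
  ∀ᶠ x in 𝓝 p, ∀ X : Π x : M, TangentSpace I x, SmoothVFAt I X x →
    β x (X x) = mvfderiv I (fun y => α y (X y)) x (ξ x) - α x (mlieBracket I ξ X x)

end General

variable {n : ℕ} {M : Type*} [TopologicalSpace M] [ChartedSpace (EuclideanSpace ℝ (Fin n)) M]
  [IsManifold (𝓡 n) ∞ M]

/-- `∇` is the Levi-Civita connection of the Riemannian metric `h`: torsion free and metric. -/
def IsLeviCivita
    (h : ContMDiffRiemannianMetric (𝓡 n) ∞ (EuclideanSpace ℝ (Fin n))
      (fun x : M => TangentSpace (𝓡 n) x))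
    (cov : CovariantDerivative (𝓡 n) (EuclideanSpace ℝ (Fin n))
      (fun x : M => TangentSpace (𝓡 n) x)) : Prop :=
  ∀ (x : M) (X Y Z : Π x : M, TangentSpace (𝓡 n) x),
    SmoothVFAt (𝓡 n) X x → SmoothVFAt (𝓡 n) Y x → SmoothVFAt (𝓡 n) Z x →
      cov Y x (X x) - cov X x (Y x) = mlieBracket (𝓡 n) X Y x ∧
      mvfderiv (𝓡 n) (fun y => h.inner y (Y y) (Z y)) x (X x)
        = h.inner x (cov Y x (X x)) (Z x) + h.inner x (Y x) (cov Z x (X x))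

/-- The Riemann tensor of `h` is `R(X, Y)Z = κ (h(Y, Z) X - h(X, Z) Y)`, where
`R(X, Y)Z = ∇_X ∇_Y Z - ∇_Y ∇_X Z - ∇_[X, Y] Z` for the Levi-Civita connection; in Mathlib's
notation `cov Z x (X x)` is `(∇_X Z)(x)`. -/
def HasConstantCurvature
    (h : ContMDiffRiemannianMetric (𝓡 n) ∞ (EuclideanSpace ℝ (Fin n))
      (fun x : M => TangentSpace (𝓡 n) x)) (κ : ℝ) : Prop :=
  ∃ cov : CovariantDerivative (𝓡 n) (EuclideanSpace ℝ (Fin n))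
      (fun x : M => TangentSpace (𝓡 n) x), IsLeviCivita h cov ∧
    ∀ (x : M) (X Y Z : Π x : M, TangentSpace (𝓡 n) x),
      SmoothVFAt (𝓡 n) X x → SmoothVFAt (𝓡 n) Y x → SmoothVFAt (𝓡 n) Z x →
        cov (fun y => cov Z y (Y y)) x (X x) - cov (fun y => cov Z y (X y)) x (Y x)
            - cov Z x (mlieBracket (𝓡 n) X Y x)
          = κ • (h.inner x (Y x) (Z x) • X x - h.inner x (X x) (Z x) • Y x)

variable (n M) in
/-- A Kundt^∞ triple `(H, W, h)` on `M`: a smooth function, a smooth one-form and a smooth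
Riemannian metric. -/
structure Triple where
  /-- the function `H` -/
  H : M → ℝ
  /-- the one-form `W` -/
  W : Π x : M, TangentSpace (𝓡 n) x →L[ℝ] ℝ
  /-- the Riemannian metric `h` -/
  h : ContMDiffRiemannianMetric (𝓡 n) ∞ (EuclideanSpace ℝ (Fin n))
    (fun x : M => TangentSpace (𝓡 n) x)
  smooth_H : ContMDiff (𝓡 n) 𝓘(ℝ, ℝ) ∞ H
  smooth_W : ContMDiff (𝓡 n) ((𝓡 n).prod 𝓘(ℝ, EuclideanSpace ℝ (Fin n) →L[ℝ] ℝ)) ∞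
    (fun x => TotalSpace.mk' (EuclideanSpace ℝ (Fin n) →L[ℝ] ℝ)
      (E := fun x : M => TangentSpace (𝓡 n) x →L[ℝ] Trivial M ℝ x) x (W x))

variable (n) in
/-- The model of the `(n+2)`-dimensional manifold `ℝ × ℝ × M`, with points `(u, v, x)`. -/
abbrev model : ModelWithCorners ℝ (ℝ × ℝ × EuclideanSpace ℝ (Fin n))
    (ModelProd ℝ (ModelProd ℝ (EuclideanSpace ℝ (Fin n)))) :=
  𝓘(ℝ, ℝ).prod (𝓘(ℝ, ℝ).prod (𝓡 n))

namespace Triple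

/-- The Kundt^∞ metric `2 du (dv + v² H du + v W) + h` on `ℝ × ℝ × M`, with points `(u, v, x)`;
a product of one-forms is the symmetric product, so that `2 du dv` pairs `∂_u` and `∂_v` to `1`. -/
def metric (T : Triple n M) (z : ℝ × ℝ × M) (a b : TangentSpace (model n) z) : ℝ :=
  let x : M := z.2.2
  let v : ℝ := z.2.1
  let a' : ℝ × ℝ × TangentSpace (𝓡 n) x := a
  let b' : ℝ × ℝ × TangentSpace (𝓡 n) x := b
  a'.1 * (b'.2.1 + v ^ 2 * T.H x * b'.1 + v * T.W x b'.2.2)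
    + b'.1 * (a'.2.1 + v ^ 2 * T.H x * a'.1 + v * T.W x a'.2.2)
    + T.h.inner x a'.2.2 b'.2.2

/-- The triple is locally homogeneous if its Kundt^∞ metric is. -/
def LocallyHomogeneous (T : Triple n M) : Prop :=
  IsLocallyHomogeneous (model n) T.metric

/-- `ξ` is, near `p`, a Killing vector field of the transverse metric `h`. -/
def KillingNear (T : Triple n M) (ξ : Π x : M, TangentSpace (𝓡 n) x) (p : M) : Prop :=
  IsKillingNear (𝓡 n) (fun x a b => T.h.inner x a b) ξ p

/-- `W` is left-invariant: near every point there are `n = dim M` linearly independent local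
Killing vector fields `ξ_i` of `h` with `£_{ξ_i} W = 0`. -/
def LeftInvariant (T : Triple n M) : Prop :=
  ∀ p : M, ∃ ξ : Fin n → Π x : M, TangentSpace (𝓡 n) x,
    (∀ i, T.KillingNear (ξ i) p ∧ IsLieDerivNear (𝓡 n) (ξ i) T.W (fun _ => 0) p) ∧
    LinearIndependent ℝ (fun i => ξ i p)

/-- `W^♯ = w` at `x`, that is `h(w, ·) = W`; then `‖W‖² = W(w)` at `x`. -/
def IsSharp (T : Triple n M) (x : M) (w : TangentSpace (𝓡 n) x) : Prop :=
  ∀ a : TangentSpace (𝓡 n) x, T.h.inner x w a = T.W x a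

/-- The one-forms near `p` obtained from `W` by `k` successive Lie derivatives along local
Killing vector fields of `h`; for `k ≥ 1` this is the set `I^k` near `p`. -/
def lieIter (T : Triple n M) (p : M) : ℕ → Set (Π x : M, TangentSpace (𝓡 n) x →L[ℝ] ℝ)
  | 0 => {T.W}
  | k + 1 => {β | ∃ α ∈ T.lieIter p k, ∃ ξ : Π x : M, TangentSpace (𝓡 n) x,
      T.KillingNear ξ p ∧ IsLieDerivNear (𝓡 n) ξ α β p}

/-- `I^k|_p`, as a subspace of the cotangent space at `p`. -/
def fibre (T : Triple n M) (p : M) (k : ℕ) : Submodule ℝ (TangentSpace (𝓡 n) p →L[ℝ] ℝ) :=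
  Submodule.span ℝ ((fun α => α p) '' T.lieIter p k)

/-- `𝓘_p`, the span of `I^1|_p, I^2|_p, …`. -/
def calI (T : Triple n M) (p : M) : Submodule ℝ (TangentSpace (𝓡 n) p →L[ℝ] ℝ) :=
  ⨆ k : ℕ, T.fibre p (k + 1)

end Triple

end Kundt

end

/-! A local Killing field of $\mathbf g$ leaves a trace on the slice $u=v=0$: its transverse part
$Y$, the function $\rho=\partial_u\xi^u$ and the gradient $v$ of $\rho$
(`KundtKilling.kundtSymmetry`). The Killing equations, expanded to second order in the coordinate
$v$, say that $Y$ is a Killing field of $\mathbf h$ with $\mathcal L_Y\mathbf W=2\,d\rho$, that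
$\operatorname{Hess}\rho=\frac12(\mathbf W\otimes d\rho+d\rho\otimes\mathbf W)$, and that two
relations with $H$ hold. Local homogeneity provides such a $Y$ with any prescribed value at any
point (`LocalParam.hasSymmetries`). If $d\rho$ vanishes at a point, it vanishes nearby, because it
solves a linear homogeneous first-order system; then $Y$ preserves $\mathbf W$. So if $d\rho=0$ at a
point for all symmetries, $\mathbf W$ is left-invariant there. If some symmetry has $d\rho\ne0$, the
Ricci identity for $d\rho$ together with the relation containing $H$ gives
$|d\rho|^2S=2(\sigma-\kappa)\,d\rho\otimes d\rho$ for $S=\nabla\mathbf W-\frac12\mathbf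
W\otimes\mathbf W-2\kappa\mathbf h$ (`KundtSymmetry.defect_eq`), where $\sigma=2H-\frac14\|\mathbf
W\|^2$ is locally constant. For $n\ge2$, $\sigma\ne\kappa$ would force $\mathbf W\wedge d\rho=0$ and
then $\kappa=0$; but for $\kappa=0$ the assumption on $H$ says $\sigma=0$. Hence $S=0$. For $n=1$
the curvature condition is empty, and $\kappa$ may be replaced by $\sigma$, which again gives $S=0$.
When $S=0$, the function $N=\|\mathbf W\|^2+4\kappa$ satisfies $dN=N\,\mathbf W$, so it vanishes
near a point or is nonzero near it. The Killing fields $\psi\nabla\chi-\chi\nabla\psi$, where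
$\psi,\chi$ solve $\operatorname{Hess}\psi=-\kappa\psi\,\mathbf h$, decide both cases. If $N=0$,
enough of them preserve $\mathbf W$ (`exists_killing_of_normSq_eq`). If $N\ne0$, their Lie
derivatives of $\mathbf W$ span the cotangent space (`eq_top_of_lieForm_mem`), and $\mathbf W$ is
not left-invariant at the point (`subsingleton_of_lieForm_eq_zero`). Thus the points where $\mathbf
W$ is left-invariant form an open and closed set (`Triple.not_leftInvariantAt`). By connectedness
and the hypothesis it is empty, so $N\ne0$ in a suitable form at every point, and $I^1|_p$ is
already all of $T_p^*M$. -/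

noncomputable section

namespace Kundt

/-! ### Linear total differential systems: uniqueness and the Frobenius theorem. -/

section LinearSystems

open Metric Set

variable {E F : Type*} [NormedAddCommGroup E] [NormedSpace ℝ E]
  [NormedAddCommGroup F] [NormedSpace ℝ F]

/-- Grönwall's inequality along the segment from the centre to `y`. -/
theorem eq_zero_on_ball_of_norm_fderiv_le {f : E → F} {y₀ : E} {r C : ℝ}
    (hf : ∀ y ∈ ball y₀ r, DifferentiableAt ℝ f y)
    (bound : ∀ y ∈ ball y₀ r, ‖fderiv ℝ f y‖ ≤ C * ‖f y‖) (h0 : f y₀ = 0) :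
    ∀ y ∈ ball y₀ r, f y = 0 := by
  intro y hy
  have hmem : ∀ t ∈ Icc (0 : ℝ) 1, y₀ + t • (y - y₀) ∈ ball y₀ r := by
    intro t ht
    rw [mem_ball, dist_eq_norm] at hy ⊢
    rw [add_sub_cancel_left, norm_smul, Real.norm_of_nonneg ht.1]
    exact (mul_le_of_le_one_left (norm_nonneg _) ht.2).trans_lt hy
  have hd : ∀ t ∈ Icc (0 : ℝ) 1, HasDerivAt (fun t : ℝ => f (y₀ + t • (y - y₀)))
      (fderiv ℝ f (y₀ + t • (y - y₀)) (y - y₀)) t := by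
    intro t ht
    have h1 : HasDerivAt (fun t : ℝ => y₀ + t • (y - y₀)) (y - y₀) t := by
      simpa using ((hasDerivAt_id t).smul_const (y - y₀)).const_add y₀
    exact (hf _ (hmem t ht)).hasFDerivAt.comp_hasDerivAt t h1
  have := eq_zero_of_abs_deriv_le_mul_abs_self_of_eq_zero_right
    (f := fun t : ℝ => f (y₀ + t • (y - y₀))) (K := C * ‖y - y₀‖) (a := 0) (b := 1)
    (fun t ht => (hd t ht).continuousAt.continuousWithinAt)
    (fun t ht => (hd t ⟨ht.1, ht.2.le⟩).hasDerivWithinAt) (by simpa using h0)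
    (fun t ht => by
      refine (ContinuousLinearMap.le_opNorm _ _).trans ?_
      have := mul_le_mul_of_nonneg_right (bound _ (hmem t ⟨ht.1, ht.2.le⟩)) (norm_nonneg (y - y₀))
      linarith) 1 (by simp)
  simpa using this

theorem eventually_eq_zero_of_norm_fderiv_le {f : E → F} {y₀ : E} {g : E → ℝ}
    (hg : ContinuousAt g y₀)
    (hf : ∀ᶠ y in 𝓝 y₀, DifferentiableAt ℝ f y ∧ ‖fderiv ℝ f y‖ ≤ g y * ‖f y‖)
    (h0 : f y₀ = 0) : ∀ᶠ y in 𝓝 y₀, f y = 0 := by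
  have h1 : ∀ᶠ y in 𝓝 y₀, g y < g y₀ + 1 := hg.eventually_lt_const (by linarith)
  obtain ⟨r, hr, H⟩ := Metric.eventually_nhds_iff_ball.1 (hf.and h1)
  filter_upwards [ball_mem_nhds y₀ hr] with y hy
  exact eq_zero_on_ball_of_norm_fderiv_le (fun y hy => (H y hy).1.1)
    (C := g y₀ + 1) (fun y hy => (H y hy).1.2.trans
      (mul_le_mul_of_nonneg_right (H y hy).2.le (norm_nonneg _))) h0 y hy

theorem eventually_eq_of_fderiv_eq_zero {f : E → F} {y₀ : E}
    (hf : ∀ᶠ y in 𝓝 y₀, DifferentiableAt ℝ f y ∧ fderiv ℝ f y = 0) :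
    ∀ᶠ y in 𝓝 y₀, f y = f y₀ := by
  have := eventually_eq_zero_of_norm_fderiv_le (f := fun y => f y - f y₀) (g := fun _ => 0)
    continuousAt_const (y₀ := y₀) (by
      filter_upwards [hf] with y hy
      refine ⟨hy.1.sub_const _, ?_⟩
      rw [fderiv_sub_const, hy.2]; simp) (by simp)
  filter_upwards [this] with y hy using sub_eq_zero.1 hy

/-- The linear equation along the ray through `x` has a solution on `[0, 1]`. -/
theorem exists_radial_solution [CompleteSpace F] {A : E → F →L[ℝ] E →L[ℝ] F} {M r : ℝ}
    (hAc : ContinuousOn A (ball 0 r)) (hA : ∀ y ∈ ball (0 : E) r, ‖A y‖ ≤ M)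
    (s₀ : F) {x : E} (hx : x ∈ ball (0 : E) r) (hxM : M * ‖x‖ ≤ 1 / 2) :
    ∃ σ : ℝ → F, σ 0 = s₀ ∧ ∀ t ∈ Icc (0 : ℝ) 1, ‖σ t‖ ≤ 2 * ‖s₀‖ + 1 ∧
      HasDerivWithinAt σ (A (t • x) (σ t) x) (Icc 0 1) t := by
  have hmem : ∀ t ∈ Icc (0 : ℝ) 1, t • x ∈ ball (0 : E) r := by
    intro t ht
    rw [mem_ball_zero_iff] at hx ⊢
    rw [norm_smul, Real.norm_of_nonneg ht.1]
    exact (mul_le_of_le_one_left (norm_nonneg _) ht.2).trans_lt hx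
  have hop : ∀ t ∈ Icc (0 : ℝ) 1, ∀ s, ‖A (t • x) s x‖ ≤ 1 / 2 * ‖s‖ := fun t ht s => by
    refine (ContinuousLinearMap.le_opNorm₂ _ _ _).trans ?_
    calc _ ≤ M * ‖s‖ * ‖x‖ := by gcongr; exact hA _ (hmem t ht)
      _ = M * ‖x‖ * ‖s‖ := by ring
      _ ≤ _ := by gcongr
  set R : NNReal := ⟨‖s₀‖ + 1, by positivity⟩ with hR
  have hcoe : (R : ℝ) = ‖s₀‖ + 1 := rfl
  have hball : ∀ s ∈ closedBall s₀ (R : ℝ), ‖s‖ ≤ 2 * ‖s₀‖ + 1 := by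
    intro s hs
    have : ‖s - s₀‖ ≤ R := by simpa [dist_eq_norm] using hs
    have := norm_le_norm_add_norm_sub' s s₀
    linarith
  -- In the ball of radius `‖s₀‖ + 1` about `s₀` the speed is at most `(2 * ‖s₀‖ + 1) / 2`, so a
  -- solution cannot leave the ball before time `1`.
  have hPL : IsPicardLindelof (fun t s => A (t • x) s x) (tmin := 0) (tmax := 1)
      ⟨0, by simp⟩ s₀ R 0 R 1 := by
    refine ⟨fun t ht => ?_, fun s _ => ?_, fun t ht s hs => ?_, ?_⟩
    · refine LipschitzWith.lipschitzOnWith (LipschitzWith.of_dist_le_mul fun u v => ?_)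
      have := hop t ht (u - v)
      rw [map_sub, sub_apply] at this
      rw [dist_eq_norm, dist_eq_norm, NNReal.coe_one]
      linarith [norm_nonneg (u - v)]
    · have : ContinuousOn (fun t : ℝ => A (t • x)) (Icc 0 1) :=
        hAc.comp (by fun_prop) hmem
      exact (this.clm_apply continuousOn_const).clm_apply continuousOn_const
    · refine (hop t ht s).trans ?_
      have h1 := hball s hs
      rw [hcoe]; linarith [norm_nonneg s₀]
    · simp
  obtain ⟨σ, h0, hσ⟩ := hPL.exists_eq_forall_mem_Icc_hasDerivWithinAt₀
  have h0' : σ 0 = s₀ := h0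
  refine ⟨σ, h0', fun t ht => ⟨?_, hσ t ht⟩⟩
  have hb := norm_le_gronwallBound_of_norm_deriv_right_le (f := σ) (K := 1 / 2) (δ := ‖s₀‖)
    (ε := 0) (a := 0) (b := 1) (fun t ht => (hσ t ht).continuousWithinAt)
    (fun t ht => (hσ t ⟨ht.1, ht.2.le⟩).mono_of_mem_nhdsWithin
      (Icc_mem_nhdsGE_of_mem ht)) (by rw [h0'])
    (fun t ht => by
      have ht' : t ∈ Icc (0 : ℝ) 1 := ⟨ht.1, ht.2.le⟩
      exact (hop t ht' _).trans (by linarith)) t ht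
  rw [gronwallBound_ε0, sub_zero] at hb
  have he : Real.exp (1 / 2 * t) ≤ 2 := by
    have h1 : Real.exp (1 / 2 * t) ≤ Real.exp (1 / 2) := Real.exp_le_exp.2 (by linarith [ht.2])
    have h2 : Real.exp (1 / 2) ^ 2 ≤ 2 ^ 2 := by
      rw [← Real.exp_nat_mul]
      have := Real.exp_one_lt_d9
      norm_num
      linarith
    exact h1.trans (le_of_sq_le_sq h2 (by norm_num))
  nlinarith [norm_nonneg s₀]

theorem hasDerivWithinAt_comp_smul {A : E → F} {x : E} {t : ℝ} {s : Set ℝ}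
    (h : DifferentiableAt ℝ A (t • x)) :
    HasDerivWithinAt (fun t : ℝ => A (t • x)) (fderiv ℝ A (t • x) x) s t := by
  have h1 : HasDerivWithinAt (fun t : ℝ => t • x) x s t := by
    simpa using ((hasDerivAt_id t).smul_const x).hasDerivWithinAt
  exact h.hasFDerivAt.comp_hasDerivWithinAt t h1

theorem exists_taylor_bounds {G : Type*} [NormedAddCommGroup G] [NormedSpace ℝ G] {A : E → G}
    {x₀ : E} (hA : ContDiffAt ℝ 2 A x₀) :
    ∃ r > 0, ∃ K ≥ 0, ∀ y ∈ ball x₀ r, DifferentiableAt ℝ A y ∧ ‖A y‖ ≤ K ∧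
      ∀ z ∈ ball x₀ r, ‖A z - A y‖ ≤ K * ‖z - y‖ ∧
        ‖A z - A y - fderiv ℝ A y (z - y)‖ ≤ K * ‖z - y‖ ^ 2 := by
  have hA1 : ContDiffAt ℝ 1 A x₀ := hA.of_le (by norm_num)
  obtain ⟨K₁, t₁, ht₁, h₁⟩ := hA1.exists_lipschitzOnWith
  obtain ⟨K₂, t₂, ht₂, h₂⟩ :=
    (hA.fderiv_right (m := 1) (by norm_num)).exists_lipschitzOnWith
  have hb : ∀ᶠ y in 𝓝 x₀, ‖A y‖ < ‖A x₀‖ + 1 :=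
    hA.continuousAt.norm.eventually_lt_const (by linarith)
  have hd : ∀ᶠ y in 𝓝 x₀, DifferentiableAt ℝ A y :=
    (hA1.eventually (by simp)).mono fun y hy => hy.differentiableAt (by norm_num)
  obtain ⟨r, hr, H⟩ := Metric.eventually_nhds_iff_ball.1
    ((hb.and hd).and ((Filter.eventually_mem_set.2 ht₁).and (Filter.eventually_mem_set.2 ht₂)))
  refine ⟨r, hr, max (‖A x₀‖ + 1) (max K₁ K₂), by positivity, fun y hy => ?_⟩
  refine ⟨(H y hy).1.2, (H y hy).1.1.le.trans (le_max_left _ _), fun z hz => ⟨?_, ?_⟩⟩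
  · refine (h₁.norm_sub_le (H z hz).2.1 (H y hy).2.1).trans ?_
    exact mul_le_mul_of_nonneg_right ((le_max_left _ _).trans (le_max_right _ _)) (norm_nonneg _)
  -- Cutting down to points no farther from `y` than `z` bounds the variation of the derivative by
  -- `K₂ * ‖z - y‖`, which makes the remainder quadratic.
  · have hcv : Convex ℝ (ball x₀ r ∩ closedBall y ‖z - y‖) :=
      (convex_ball _ _).inter (convex_closedBall _ _)
    have := hcv.norm_image_sub_le_of_norm_fderiv_le' (𝕜 := ℝ) (f := A) (φ := fderiv ℝ A y)
      (C := K₂ * ‖z - y‖) (fun x hx => (H x hx.1).1.2)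
      (fun x hx => (h₂.norm_sub_le (H x hx.1).2.2 (H y hy).2.2).trans
        (mul_le_mul_of_nonneg_left (by simpa [dist_eq_norm] using hx.2) K₂.2))
      (x := y) (y := z) ⟨hy, by simp⟩ ⟨hz, by simp [dist_eq_norm]⟩
    refine this.trans ?_
    have h3 : (K₂ : ℝ) ≤ max (‖A x₀‖ + 1) (max K₁ K₂) :=
      (le_max_right _ _).trans (le_max_right _ _)
    calc _ = K₂ * ‖z - y‖ ^ 2 := by ring
      _ ≤ _ := mul_le_mul_of_nonneg_right h3 (by positivity)

-- The end value of the radial solution depends differentiably on the endpoint, with the derivative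
-- that the system demands. The quantity `e t = τ t - σ t - t • A (t • x) (σ t) δ` starts at zero.
-- Flatness cancels every term of first order in `δ` from its equation except those linear in `e`,
-- so Grönwall's inequality bounds `e 1` quadratically.
set_option synthInstance.maxHeartbeats 200000 in
set_option maxHeartbeats 800000 in
theorem radial_solution_sub_le {A : E → F →L[ℝ] E →L[ℝ] F} {r K S : ℝ} (hK : 0 ≤ K)
    (hS : 0 ≤ S) (hr : r ≤ 1)
    (hA : ∀ y ∈ ball (0 : E) r, DifferentiableAt ℝ A y ∧ ‖A y‖ ≤ K ∧
      ∀ z ∈ ball (0 : E) r, ‖A z - A y‖ ≤ K * ‖z - y‖ ∧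
        ‖A z - A y - fderiv ℝ A y (z - y)‖ ≤ K * ‖z - y‖ ^ 2)
    (flat : ∀ y ∈ ball (0 : E) r, ∀ a b s, fderiv ℝ A y a s b + A y (A y s a) b
      = fderiv ℝ A y b s a + A y (A y s b) a)
    {x δ : E} (hx : x ∈ ball (0 : E) r) (hxδ : x + δ ∈ ball (0 : E) r) {σ τ : ℝ → F}
    (h0 : σ 0 = τ 0)
    (hσ : ∀ t ∈ Icc (0 : ℝ) 1, ‖σ t‖ ≤ S ∧ HasDerivWithinAt σ (A (t • x) (σ t) x) (Icc 0 1) t)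
    (hτ : ∀ t ∈ Icc (0 : ℝ) 1,
      HasDerivWithinAt τ (A (t • (x + δ)) (τ t) (x + δ)) (Icc 0 1) t) :
    ‖τ 1 - σ 1 - A x (σ 1) δ‖ ≤
      gronwallBound 0 K ((2 * K + (K + K) * K) * S) 1 * ‖δ‖ ^ 2 := by
  have hmem : ∀ y ∈ ball (0 : E) r, ∀ t ∈ Icc (0 : ℝ) 1, t • y ∈ ball (0 : E) r := by
    intro y hy t ht
    rw [mem_ball_zero_iff] at hy ⊢
    rw [norm_smul, Real.norm_of_nonneg ht.1]
    exact (mul_le_of_le_one_left (norm_nonneg _) ht.2).trans_lt hy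
  have hx1 : ‖x‖ ≤ 1 := (mem_ball_zero_iff.1 hx).le.trans hr
  have hxδ1 : ‖x + δ‖ ≤ 1 := (mem_ball_zero_iff.1 hxδ).le.trans hr
  set e : ℝ → F := fun t => τ t - σ t - t • A (t • x) (σ t) δ with he
  set e' : ℝ → F := fun t => A (t • (x + δ)) (τ t) (x + δ) - A (t • x) (σ t) x
    - (t • (fderiv ℝ A (t • x) x (σ t) δ + A (t • x) (A (t • x) (σ t) x) δ)
      + (1 : ℝ) • A (t • x) (σ t) δ) with he'
  have hde : ∀ t ∈ Icc (0 : ℝ) 1, HasDerivWithinAt e (e' t) (Icc 0 1) t := by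
    intro t ht
    have h2 : HasDerivWithinAt (fun t : ℝ => A (t • x)) (fderiv ℝ A (t • x) x) (Icc 0 1) t :=
      hasDerivWithinAt_comp_smul (F := F →L[ℝ] E →L[ℝ] F) (hA _ (hmem x hx t ht)).1
    have h4 : HasDerivWithinAt (fun t : ℝ => A (t • x) (σ t) δ)
        (fderiv ℝ A (t • x) x (σ t) δ + A (t • x) (A (t • x) (σ t) x) δ) (Icc 0 1) t := by
      simpa using (h2.clm_apply (hσ t ht).2).clm_apply (hasDerivWithinAt_const t _ δ)
    exact ((hτ t ht).sub (hσ t ht).2).sub ((hasDerivWithinAt_id t _).smul h4)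
  have hKδ : 0 ≤ K * ‖δ‖ := by positivity
  have hbound : ∀ t ∈ Icc (0 : ℝ) 1,
      ‖e' t‖ ≤ K * ‖e t‖ + (2 * K + (K + K) * K) * S * ‖δ‖ ^ 2 := by
    intro t ht
    have hy := hA _ (hmem x hx t ht)
    have hz := hA _ (hmem _ hxδ t ht)
    obtain ⟨hL, hT⟩ := hy.2.2 _ (hmem _ hxδ t ht)
    have hzy : t • (x + δ) - t • x = t • δ := by rw [smul_add, add_sub_cancel_left]
    rw [hzy] at hL hT
    have htδ : ‖t • δ‖ ≤ ‖δ‖ := by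
      rw [norm_smul, Real.norm_of_nonneg ht.1]
      exact mul_le_of_le_one_left (norm_nonneg _) ht.2
    have hL' : ‖A (t • (x + δ)) - A (t • x)‖ ≤ K * ‖δ‖ :=
      hL.trans (mul_le_mul_of_nonneg_left htδ hK)
    have hT' : ‖A (t • (x + δ)) - A (t • x) - fderiv ℝ A (t • x) (t • δ)‖ ≤ K * ‖δ‖ ^ 2 :=
      hT.trans (mul_le_mul_of_nonneg_left (pow_le_pow_left₀ (norm_nonneg _) htδ 2) hK)
    -- This exchange of `x` and `δ` turns the derivative of `A` along the ray into the one in the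
    -- direction `δ`, which completes the Taylor remainder in `key`.
    have hfl := flat _ (hmem x hx t ht) x δ (σ t)
    have key : e' t = A (t • (x + δ)) (e t) (x + δ)
        + (A (t • (x + δ)) - A (t • x) - fderiv ℝ A (t • x) (t • δ)) (σ t) x
        + (A (t • (x + δ)) - A (t • x)) (σ t) δ
        + t • ((A (t • (x + δ)) - A (t • x)) (A (t • x) (σ t) δ) x
          + A (t • (x + δ)) (A (t • x) (σ t) δ) δ) := by
      simp only [he, he', hfl]
      simp only [map_sub, map_add, map_smul, sub_apply,
        smul_apply, smul_add, smul_sub,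
        one_smul]
      abel
    have hσS := (hσ t ht).1
    have b1 : ‖A (t • (x + δ)) (e t) (x + δ)‖ ≤ K * ‖e t‖ := by
      refine (ContinuousLinearMap.le_opNorm₂ _ _ _).trans ?_
      calc _ ≤ K * ‖e t‖ * 1 := by gcongr; exact hz.2.1
        _ = _ := mul_one _
    have b2 : ‖(A (t • (x + δ)) - A (t • x) - fderiv ℝ A (t • x) (t • δ)) (σ t) x‖
        ≤ K * ‖δ‖ ^ 2 * S * 1 :=
      ((ContinuousLinearMap.le_opNorm₂ _ _ _)).trans (by gcongr)
    have b3 : ‖(A (t • (x + δ)) - A (t • x)) (σ t) δ‖ ≤ K * ‖δ‖ * S * ‖δ‖ :=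
      ((ContinuousLinearMap.le_opNorm₂ _ _ _)).trans (by gcongr)
    have b0 : ‖A (t • x) (σ t) δ‖ ≤ K * S * ‖δ‖ :=
      ((ContinuousLinearMap.le_opNorm₂ _ _ _)).trans (by gcongr; exact hy.2.1)
    have b4 : ‖(A (t • (x + δ)) - A (t • x)) (A (t • x) (σ t) δ) x‖
        ≤ K * ‖δ‖ * (K * S * ‖δ‖) * 1 :=
      ((ContinuousLinearMap.le_opNorm₂ _ _ _)).trans (by gcongr)
    have b5 : ‖A (t • (x + δ)) (A (t • x) (σ t) δ) δ‖ ≤ K * (K * S * ‖δ‖) * ‖δ‖ :=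
      ((ContinuousLinearMap.le_opNorm₂ _ _ _)).trans (by gcongr; exact hz.2.1)
    have b6 : ‖t • ((A (t • (x + δ)) - A (t • x)) (A (t • x) (σ t) δ) x
          + A (t • (x + δ)) (A (t • x) (σ t) δ) δ)‖
        ≤ K * ‖δ‖ * (K * S * ‖δ‖) * 1 + K * (K * S * ‖δ‖) * ‖δ‖ := by
      rw [norm_smul, Real.norm_of_nonneg ht.1]
      exact (mul_le_of_le_one_left (norm_nonneg _) ht.2).trans
        ((norm_add_le _ _).trans (add_le_add b4 b5))
    rw [key]
    refine (norm_add_le _ _).trans ?_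
    have := norm_add₃_le (a := A (t • (x + δ)) (e t) (x + δ))
      (b := (A (t • (x + δ)) - A (t • x) - fderiv ℝ A (t • x) (t • δ)) (σ t) x)
      (c := (A (t • (x + δ)) - A (t • x)) (σ t) δ)
    nlinarith
  have hg := norm_le_gronwallBound_of_norm_deriv_right_le (f := e) (f' := e') (K := K) (δ := 0)
    (ε := (2 * K + (K + K) * K) * S * ‖δ‖ ^ 2) (a := 0) (b := 1)
    (fun t ht => (hde t ht).continuousWithinAt)
    (fun t ht => (hde t ⟨ht.1, ht.2.le⟩).mono_of_mem_nhdsWithin (Icc_mem_nhdsGE_of_mem ht))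
    (by simp [he, h0]) (fun t ht => hbound t ⟨ht.1, ht.2.le⟩) 1 (by simp)
  have h1 : e 1 = τ 1 - σ 1 - A x (σ 1) δ := by simp [he]
  rw [h1] at hg
  refine hg.trans (le_of_eq ?_)
  by_cases hK0 : K = 0
  · subst hK0; simp [gronwallBound_K0]
  · simp [gronwallBound_of_K_ne_0 hK0]; ring

/-- The value of the solution at `x` is the value at time `1` of the solution of the equation along
the ray through `x`. -/
theorem exists_parallel_at_zero [CompleteSpace F] {A : E → F →L[ℝ] E →L[ℝ] F}
    (hA : ContDiffAt ℝ 2 A 0)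
    (flat : ∀ᶠ y in 𝓝 0, ∀ a b s, fderiv ℝ A y a s b + A y (A y s a) b
      = fderiv ℝ A y b s a + A y (A y s b) a) (s₀ : F) :
    ∃ s : E → F, s 0 = s₀ ∧ ∀ᶠ y in 𝓝 0, HasFDerivAt s (A y (s y)) y := by
  obtain ⟨r₁, hr₁, K, hK, H⟩ := exists_taylor_bounds hA
  obtain ⟨r₂, hr₂, hflat⟩ := Metric.eventually_nhds_iff_ball.1 flat
  -- The bound `1` serves the Grönwall estimate; the last bound gives `K * ‖x‖ ≤ 1 / 2`, as the
  -- radial solutions need.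
  set r := min (min r₁ r₂) (min 1 (1 / (2 * (K + 1)))) with hr
  have hr0 : 0 < r := by positivity
  have hrr₁ : ball (0 : E) r ⊆ ball 0 r₁ :=
    ball_subset_ball ((min_le_left _ _).trans (min_le_left _ _))
  have hrr₂ : ball (0 : E) r ⊆ ball 0 r₂ :=
    ball_subset_ball ((min_le_left _ _).trans (min_le_right _ _))
  have hr1 : r ≤ 1 := (min_le_right _ _).trans (min_le_left _ _)
  have hrK : K * r ≤ 1 / 2 := by
    have : r ≤ 1 / (2 * (K + 1)) := (min_le_right _ _).trans (min_le_right _ _)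
    rw [le_div_iff₀ (by positivity)] at this
    nlinarith
  have hA' : ∀ y ∈ ball (0 : E) r, DifferentiableAt ℝ A y ∧ ‖A y‖ ≤ K ∧
      ∀ z ∈ ball (0 : E) r, ‖A z - A y‖ ≤ K * ‖z - y‖ ∧
        ‖A z - A y - fderiv ℝ A y (z - y)‖ ≤ K * ‖z - y‖ ^ 2 := fun y hy =>
    ⟨(H y (hrr₁ hy)).1, (H y (hrr₁ hy)).2.1, fun z hz => (H y (hrr₁ hy)).2.2 z (hrr₁ hz)⟩
  have hex : ∀ x : E, ∃ σ : ℝ → F, x ∈ ball (0 : E) r → σ 0 = s₀ ∧ ∀ t ∈ Icc (0 : ℝ) 1,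
      ‖σ t‖ ≤ 2 * ‖s₀‖ + 1 ∧ HasDerivWithinAt σ (A (t • x) (σ t) x) (Icc 0 1) t := by
    intro x
    by_cases hx : x ∈ ball (0 : E) r
    · obtain ⟨σ, h⟩ := exists_radial_solution (A := A) (M := K) (r := r)
        (fun y hy => (hA' y hy).1.continuousAt.continuousWithinAt)
        (fun y hy => (hA' y hy).2.1) s₀ hx
        ((mul_le_mul_of_nonneg_left (mem_ball_zero_iff.1 hx).le hK).trans hrK)
      exact ⟨σ, fun _ => h⟩
    · exact ⟨0, fun h => absurd h hx⟩
  choose σ hσ using hex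
  have hest := fun (x : E) (hx : x ∈ ball (0 : E) r) (δ : E) (hxδ : x + δ ∈ ball (0 : E) r) =>
    radial_solution_sub_le hK (S := 2 * ‖s₀‖ + 1) (by positivity) hr1 hA'
      (fun y hy => hflat y (hrr₂ hy)) hx hxδ (σ := σ x) (τ := σ (x + δ))
      (by rw [(hσ _ hx).1, (hσ _ hxδ).1]) (hσ x hx).2 (fun t ht => ((hσ _ hxδ).2 t ht).2)
  refine ⟨fun x => σ x 1, ?_, ?_⟩
  · have h00 := hσ 0 (mem_ball_self hr0)
    have hc := eq_zero_of_abs_deriv_le_mul_abs_self_of_eq_zero_right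
      (f := fun t => σ 0 t - s₀) (f' := fun _ => 0) (K := 0) (a := 0) (b := 1)
      (fun t ht => ((h00.2 t ht).2.continuousWithinAt.sub continuousWithinAt_const))
      (fun t ht => by
        have := ((h00.2 t ⟨ht.1, ht.2.le⟩).2.mono_of_mem_nhdsWithin
          (Icc_mem_nhdsGE_of_mem ht)).sub_const s₀
        simpa using this) (by simp [h00.1]) (by simp) 1 (by simp)
    simpa [sub_eq_zero] using hc
  · filter_upwards [ball_mem_nhds (0 : E) hr0] with x hx
    rw [hasFDerivAt_iff_isLittleO_nhds_zero]
    refine Asymptotics.IsBigO.trans_isLittleO ?_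
      (Asymptotics.isLittleO_norm_pow_id (E' := E) one_lt_two)
    refine Asymptotics.IsBigO.of_bound
      (gronwallBound 0 K ((2 * K + (K + K) * K) * (2 * ‖s₀‖ + 1)) 1) ?_
    have : ∀ᶠ δ in 𝓝 (0 : E), x + δ ∈ ball (0 : E) r := by
      have hc : ContinuousAt (fun δ : E => x + δ) 0 := by fun_prop
      exact hc.eventually_mem (by simpa using isOpen_ball.mem_nhds hx)
    filter_upwards [this] with δ hδ
    have := hest x hx δ hδ
    rw [Real.norm_of_nonneg (by positivity)]
    simpa using this

/-- The Frobenius theorem for a linear system `Ds = A(y) s` with vanishing curvature. -/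
theorem exists_parallel [CompleteSpace F] {A : E → F →L[ℝ] E →L[ℝ] F} {y₀ : E}
    (hA : ∀ᶠ y in 𝓝 y₀, ContDiffAt ℝ ∞ A y)
    (flat : ∀ᶠ y in 𝓝 y₀, ∀ a b s, fderiv ℝ A y a s b + A y (A y s a) b
      = fderiv ℝ A y b s a + A y (A y s b) a) (s₀ : F) :
    ∃ s : E → F, s y₀ = s₀ ∧ (∀ᶠ y in 𝓝 y₀, ContDiffAt ℝ ∞ s y) ∧
      ∀ᶠ y in 𝓝 y₀, HasFDerivAt s (A y (s y)) y := by
  have htr : Tendsto (fun y => y₀ + y) (𝓝 (0 : E)) (𝓝 y₀) := by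
    have : ContinuousAt (fun y => y₀ + y) (0 : E) := by fun_prop
    simpa [ContinuousAt] using this
  have hA0 : ContDiffAt ℝ ∞ (fun y => A (y₀ + y)) 0 := by
    have h : ContDiffAt ℝ ∞ A (y₀ + 0) := by simpa using hA.self_of_nhds
    exact h.comp (0 : E) (contDiffAt_const.add contDiffAt_id)
  obtain ⟨s, hs0, hs⟩ := exists_parallel_at_zero (A := fun y => A (y₀ + y))
    (contDiffAt_infty.1 hA0 2) (by
      filter_upwards [htr.eventually flat] with y hy a b v
      have hfd : fderiv ℝ (fun y => A (y₀ + y)) y = fderiv ℝ A (y₀ + y) :=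
        fderiv_comp_add_left (𝕜 := ℝ) (E := E) (F := F →L[ℝ] E →L[ℝ] F) (f := A) (x := y) y₀
      rw [hfd]
      exact hy a b v) s₀
  have htr' : Tendsto (fun y => y - y₀) (𝓝 y₀) (𝓝 (0 : E)) := by
    have : ContinuousAt (fun y => y - y₀) y₀ := by fun_prop
    simpa [ContinuousAt] using this
  have hs' : ∀ᶠ y in 𝓝 y₀, HasFDerivAt (fun y => s (y - y₀)) (A y (s (y - y₀))) y := by
    filter_upwards [htr'.eventually hs] with y hy
    have := hy.comp y ((hasFDerivAt_id y).sub_const y₀)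
    rw [ContinuousLinearMap.comp_id] at this
    simpa [Function.comp_def] using this
  refine ⟨fun y => s (y - y₀), by simpa using hs0, ?_, hs'⟩
  filter_upwards [hA, hs'.eventually_nhds] with z hAz hsz
  -- Bootstrapping: the derivative is `A y` applied to the solution, hence as regular as the
  -- solution itself.
  have hsm : ∀ k : ℕ, ContDiffAt ℝ k (fun y => s (y - y₀)) z := by
    intro k
    induction k with
    | zero =>
      have : ∀ᶠ y in 𝓝 z, ContinuousAt (fun y => s (y - y₀)) y :=
        hsz.mono fun y hy => hy.continuousAt
      obtain ⟨u, hu, huo, hy⟩ := _root_.eventually_nhds_iff.1 this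
      exact (contDiffOn_zero.2 fun y hy' => (hu y hy').continuousWithinAt).contDiffAt
        (huo.mem_nhds hy)
    | succ k ih =>
      have : ((k + 1 : ℕ) : WithTop ℕ∞) = (k : WithTop ℕ∞) + 1 := by push_cast; rfl
      rw [this, contDiffAt_succ_iff_hasFDerivAt]
      refine ⟨fun y => A y (s (y - y₀)), ⟨_, hsz, fun _ h => h⟩, ?_⟩
      have hAk : ContDiffAt ℝ k A z := hAz.of_le (by exact_mod_cast le_top)
      exact hAk.clm_apply ih
  exact contDiffAt_infty.2 hsm

end LinearSystems

end Kundt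

/-! ### Riemannian metrics in coordinates: Christoffel symbols, covariant derivatives and curvature.
-/

namespace Kundt

section Calculus

variable {E F : Type*} [NormedAddCommGroup E] [NormedSpace ℝ E]
  [NormedAddCommGroup F] [NormedSpace ℝ F]

theorem fderiv_eq_zero_of_eventually_eq_zero {f : E → F} {y : E} {f' : E →L[ℝ] F}
    (h : ∀ᶠ z in 𝓝 y, f z = 0) (hf : HasFDerivAt f f' y) : f' = 0 :=
  hf.unique ((hasFDerivAt_const (0 : F) y).congr_of_eventuallyEq h)

theorem hasFDerivAt_apply_const {α : E → E →L[ℝ] F} {y : E} (h : DifferentiableAt ℝ α y) (b : E) :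
    HasFDerivAt (fun z => α z b) ((fderiv ℝ α y).flip b) y := by
  have := h.hasFDerivAt.clm_apply (hasFDerivAt_const b y)
  simpa using this

theorem hasFDerivAt_apply_apply {α : E → E →L[ℝ] F} {u : E → E} {y : E}
    (h : DifferentiableAt ℝ α y) (hu : DifferentiableAt ℝ u y) :
    HasFDerivAt (fun z => α z (u z))
      ((fderiv ℝ α y).flip (u y) + (α y).comp (fderiv ℝ u y)) y := by
  have := h.hasFDerivAt.clm_apply hu.hasFDerivAt
  rwa [add_comm] at this

theorem differentiableAt_bilin_apply {B : E → E →L[ℝ] E →L[ℝ] F} {u : E → E} {y : E}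
    (h : DifferentiableAt ℝ B y) (hu : DifferentiableAt ℝ u y) :
    DifferentiableAt ℝ (fun z => B z (u z)) y :=
  h.clm_apply hu

theorem fderiv_bilin_apply {B : E → E →L[ℝ] E →L[ℝ] F} {u : E → E} {y : E}
    (h : DifferentiableAt ℝ B y) (hu : DifferentiableAt ℝ u y) (a : E) :
    fderiv ℝ (fun z => B z (u z)) y a = fderiv ℝ B y a (u y) + B y (fderiv ℝ u y a) := by
  rw [fderiv_clm_apply h hu]
  simp [add_comm]

theorem hasFDerivAt_bilin_const {B : E → E →L[ℝ] E →L[ℝ] F} {y : E}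
    (h : DifferentiableAt ℝ B y) (b c : E) :
    HasFDerivAt (fun z => B z b c) (((fderiv ℝ B y).flip b).flip c) y := by
  have h1 : DifferentiableAt ℝ (fun z => B z b) y := h.clm_apply (differentiableAt_const b)
  have h2 := hasFDerivAt_apply_const h1 c
  convert h2 using 1
  ext a
  have := fderiv_bilin_apply h (differentiableAt_const b) a
  simp [this]

theorem hasFDerivAt_bilin {B : E → E →L[ℝ] E →L[ℝ] F} {u v : E → E} {y : E}
    (h : DifferentiableAt ℝ B y) (hu : DifferentiableAt ℝ u y) (hv : DifferentiableAt ℝ v y) :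
    HasFDerivAt (fun z => B z (u z) (v z))
      ((((fderiv ℝ B y).flip (u y)).flip (v y) + ((B y).comp (fderiv ℝ u y)).flip (v y))
        + (B y (u y)).comp (fderiv ℝ v y)) y := by
  have h2 := hasFDerivAt_apply_apply (differentiableAt_bilin_apply h hu) hv
  convert h2 using 1
  ext a
  have := fderiv_bilin_apply h hu a
  simp [this]

theorem fderiv_fderiv_symm {f : E → F} {y : E} (h : ContDiffAt ℝ ∞ f y) (a b : E) :
    fderiv ℝ (fderiv ℝ f) y a b = fderiv ℝ (fderiv ℝ f) y b a :=
  ((contDiffAt_infty.1 h 2).isSymmSndFDerivAt (by simp)) a b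

theorem _root_.ContDiffAt.fderiv_infty {f : E → F} {y : E} (h : ContDiffAt ℝ ∞ f y) :
    ContDiffAt ℝ ∞ (fderiv ℝ f) y :=
  h.fderiv_right (m := ∞) (by simp)

theorem _root_.ContDiffAt.diff {f : E → F} {y : E} (h : ContDiffAt ℝ ∞ f y) :
    DifferentiableAt ℝ f y := h.differentiableAt (by simp)

end Calculus

/-- A Riemannian metric on an open subset of a vector space, with its Christoffel symbols and
musical isomorphism. -/
structure LocalMetric (E : Type*) [NormedAddCommGroup E] [NormedSpace ℝ E] where
  /-- the domain -/
  Ω : Set E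
  /-- the metric -/
  h : E → E →L[ℝ] E →L[ℝ] ℝ
  /-- the Christoffel symbols -/
  Γ : E → E →L[ℝ] E →L[ℝ] E
  /-- the inverse metric -/
  sharp : E → (E →L[ℝ] ℝ) →L[ℝ] E
  isOpen : IsOpen Ω
  smooth_h : ∀ y ∈ Ω, ContDiffAt ℝ ∞ h y
  smooth_Γ : ∀ y ∈ Ω, ContDiffAt ℝ ∞ Γ y
  smooth_sharp : ∀ y ∈ Ω, ContDiffAt ℝ ∞ sharp y
  symm : ∀ y ∈ Ω, ∀ a b, h y a b = h y b a
  pos : ∀ y ∈ Ω, ∀ a, a ≠ 0 → 0 < h y a a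
  Γ_symm : ∀ y ∈ Ω, ∀ a b, Γ y a b = Γ y b a
  compat : ∀ y ∈ Ω, ∀ a b c, fderiv ℝ h y a b c = h y (Γ y a b) c + h y b (Γ y a c)
  sharp_spec : ∀ y ∈ Ω, ∀ α b, h y (sharp y α) b = α b

/-- The covariant derivative of a one-form. -/
def LocalMetric.nabla {E : Type*} [NormedAddCommGroup E] [NormedSpace ℝ E] (G : LocalMetric E)
    (α : E → E →L[ℝ] ℝ) (y a b : E) : ℝ :=
  fderiv ℝ α y a b - α y (G.Γ y a b)

/-- Constant curvature `κ` in terms of Christoffel symbols. -/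
def LocalMetric.HasCurvature {E : Type*} [NormedAddCommGroup E] [NormedSpace ℝ E]
    (G : LocalMetric E) (κ : ℝ) : Prop :=
  ∀ y ∈ G.Ω, ∀ a b c, fderiv ℝ G.Γ y a b c - fderiv ℝ G.Γ y b a c
    + G.Γ y a (G.Γ y b c) - G.Γ y b (G.Γ y a c) = κ • (G.h y b c • a - G.h y a c • b)

namespace LocalMetric

variable {E : Type*} [NormedAddCommGroup E] [NormedSpace ℝ E] (G : LocalMetric E)
  {y : E} {κ : ℝ}

theorem eventually_mem (hy : y ∈ G.Ω) : ∀ᶠ z in 𝓝 y, z ∈ G.Ω := G.isOpen.mem_nhds hy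

theorem ext_h (hy : y ∈ G.Ω) {a b : E} (hab : ∀ c, G.h y a c = G.h y b c) : a = b := by
  by_contra hne
  have h1 := G.pos y hy (a - b) (sub_ne_zero.2 hne)
  have h2 := hab (a - b)
  rw [map_sub (G.h y), sub_apply, h2, sub_self] at h1
  exact lt_irrefl _ h1

theorem hasFDerivAt_nabla {α : E → E →L[ℝ] ℝ} (hy : y ∈ G.Ω) (hα : ContDiffAt ℝ ∞ α y) (b c : E) :
    ∃ N : E →L[ℝ] ℝ, HasFDerivAt (fun z => G.nabla α z b c) N y ∧
      ∀ a, N a = fderiv ℝ (fderiv ℝ α) y a b c - fderiv ℝ α y a (G.Γ y b c)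
        - α y (fderiv ℝ G.Γ y a b c) := by
  have hΓ := (G.smooth_Γ y hy).diff
  have h1 := hasFDerivAt_bilin_const hα.fderiv_infty.diff b c
  have h3 := hasFDerivAt_bilin_const hΓ b c
  have h2 := hasFDerivAt_apply_apply hα.diff h3.differentiableAt
  refine ⟨_, h1.sub h2, fun a => ?_⟩
  rw [h3.fderiv]
  simp [sub_sub]

/-- The Ricci identity for one-forms in constant curvature. -/
theorem ricci_identity (hκ : G.HasCurvature κ) {α : E → E →L[ℝ] ℝ} (hy : y ∈ G.Ω)
    (hα : ContDiffAt ℝ ∞ α y) (a b c : E) :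
    fderiv ℝ (fun z => G.nabla α z b c) y a - fderiv ℝ (fun z => G.nabla α z a c) y b
      - G.nabla α y b (G.Γ y a c) + G.nabla α y a (G.Γ y b c)
      = -κ * (G.h y b c * α y a - G.h y a c * α y b) := by
  obtain ⟨N, hN, hN'⟩ := G.hasFDerivAt_nabla hy hα b c
  obtain ⟨N₂, hN₂, hN₂'⟩ := G.hasFDerivAt_nabla hy hα a c
  rw [hN.fderiv, hN₂.fderiv, hN', hN₂']
  have hs : fderiv ℝ (fderiv ℝ α) y a b = fderiv ℝ (fderiv ℝ α) y b a :=
    fderiv_fderiv_symm hα a b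
  have h1 := congrArg (α y) (hκ y hy a b c)
  simp only [map_sub, map_add, map_smul, smul_eq_mul] at h1
  simp only [nabla, hs]
  linear_combination -h1

/-- The gradient-like vector field dual to a one-form. -/
theorem smooth_sharp_apply {α : E → E →L[ℝ] ℝ} (hy : y ∈ G.Ω) (hα : ContDiffAt ℝ ∞ α y) :
    ContDiffAt ℝ ∞ (fun z => G.sharp z (α z)) y :=
  (G.smooth_sharp y hy).clm_apply hα

/-- If `u` is dual to `α`, then `∇_c u` is dual to `∇_c α`. -/
theorem h_nabla_dual {α : E → E →L[ℝ] ℝ} {u : E → E} (hy : y ∈ G.Ω)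
    (hα : DifferentiableAt ℝ α y) (hu : DifferentiableAt ℝ u y)
    (hdual : ∀ᶠ z in 𝓝 y, ∀ b, G.h z (u z) b = α z b) (c b : E) :
    G.h y (fderiv ℝ u y c + G.Γ y c (u y)) b = G.nabla α y c b := by
  have h1 := hasFDerivAt_bilin (G.smooth_h y hy).diff hu (differentiableAt_const b)
  have h2 := hasFDerivAt_apply_const hα b
  have h3 := fderiv_eq_zero_of_eventually_eq_zero
    (hdual.mono fun z hz => sub_eq_zero.2 (hz b)) (h1.sub h2)
  have h4 := DFunLike.congr_fun h3 c
  simp only [Pi.zero_apply, ContinuousLinearMap.comp_zero, add_zero,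
    sub_apply, add_apply, ContinuousLinearMap.flip_apply,
    ContinuousLinearMap.comp_apply, zero_apply, fderiv_fun_const] at h4
  have h5 := G.compat y hy c (u y) b
  have h6 := hdual.self_of_nhds (G.Γ y c b)
  simp only [nabla, map_add, add_apply]
  linear_combination h4 - h5 - h6

/-- The squared norm of a one-form. -/
def normSq (α : E → E →L[ℝ] ℝ) (z : E) : ℝ := α z (G.sharp z (α z))

theorem eventually_sharp_spec (hy : y ∈ G.Ω) (α : E → E →L[ℝ] ℝ) :
    ∀ᶠ z in 𝓝 y, ∀ b, G.h z (G.sharp z (α z)) b = α z b :=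
  (G.eventually_mem hy).mono fun z hz b => G.sharp_spec z hz (α z) b

theorem hasFDerivAt_normSq {α : E → E →L[ℝ] ℝ} (hy : y ∈ G.Ω) (hα : ContDiffAt ℝ ∞ α y) :
    ∃ N : E →L[ℝ] ℝ, HasFDerivAt (G.normSq α) N y ∧
      ∀ a, N a = 2 * G.nabla α y a (G.sharp y (α y)) := by
  have hw := (G.smooth_sharp_apply hy hα).diff
  refine ⟨_, hasFDerivAt_apply_apply hα.diff hw, fun a => ?_⟩
  have h1 := G.h_nabla_dual hy hα.diff hw (G.eventually_sharp_spec hy α) a (G.sharp y (α y))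
  simp only [map_add, add_apply] at h1
  rw [G.symm y hy, G.sharp_spec y hy, G.symm y hy (G.Γ _ _ _), G.sharp_spec y hy] at h1
  simp only [add_apply, ContinuousLinearMap.flip_apply, ContinuousLinearMap.comp_apply]
  simp only [nabla] at h1 ⊢
  linear_combination h1

end LocalMetric

end Kundt

/-! ### The symmetry equations and their integrability conditions. -/

namespace Kundt

namespace LocalMetric

variable {E : Type*} [NormedAddCommGroup E] [NormedSpace ℝ E] (G : LocalMetric E)
  {y : E} {κ : ℝ} {W θ : E → E →L[ℝ] ℝ}

/-- The tensor `∇W - W ⊗ W / 2 - 2 κ h`. -/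
def defect (κ : ℝ) (W : E → E →L[ℝ] ℝ) (y a b : E) : ℝ :=
  G.nabla W y a b - 1 / 2 * (W y a * W y b) - 2 * κ * G.h y a b

/-- Insert the equation for `∇θ` into the Ricci identity of `θ`. Using the equation once more for
the derivatives of `θ` that appear leaves an expression without derivatives of `θ`, in which the
quadratic terms in `W` and the curvature terms complete `∇W` to `defect`. -/
theorem integrability (hκ : G.HasCurvature κ) (hy : y ∈ G.Ω) (hW : ContDiffAt ℝ ∞ W y)
    (hθ : ContDiffAt ℝ ∞ θ y)
    (hess : ∀ᶠ z in 𝓝 y, ∀ b c, G.nabla θ z b c = 1 / 2 * (W z b * θ z c + W z c * θ z b))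
    (a b c : E) :
    (G.defect κ W y a b - G.defect κ W y b a) * θ y c + G.defect κ W y a c * θ y b
      - G.defect κ W y b c * θ y a = 0 := by
  have key : ∀ a b c : E, fderiv ℝ (fun z => G.nabla θ z b c) y a
      = 1 / 2 * (fderiv ℝ W y a b * θ y c + W y b * fderiv ℝ θ y a c
        + (fderiv ℝ W y a c * θ y b + W y c * fderiv ℝ θ y a b)) := by
    intro a b c
    have hW' := fun b => hasFDerivAt_apply_const hW.diff b
    have hθ' := fun b => hasFDerivAt_apply_const hθ.diff b
    have h1 := (((hW' b).mul (hθ' c)).add ((hW' c).mul (hθ' b))).const_mul (1 / 2 : ℝ)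
    have h2 := h1.congr_of_eventuallyEq (hess.mono fun z hz => hz b c)
    rw [h2.fderiv]
    simp only [add_apply, smul_apply, ContinuousLinearMap.flip_apply, smul_eq_mul]
    ring
  have hr := G.ricci_identity hκ hy hθ a b c
  have hs := hess.self_of_nhds
  rw [key a b c, key b a c, hs, hs] at hr
  have e1 := hs a b
  have e2 := hs b a
  have e3 := hs a c
  have e4 := hs b c
  simp only [nabla] at e1 e2 e3 e4
  have g1 := G.Γ_symm y hy a b
  have g2 := G.symm y hy a b
  simp only [defect, nabla]
  rw [g1] at e1 ⊢
  rw [g2]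
  linear_combination 2 * hr - W y b * e3 + W y a * e4 - W y c * (e1 - e2)

end LocalMetric

/-- The equations satisfied by the symmetries `Y` of a triple, with the accompanying function `ρ`
and its gradient `v`. -/
structure KundtSymmetry {E : Type*} [NormedAddCommGroup E] [NormedSpace ℝ E] (G : LocalMetric E)
    (W : E → E →L[ℝ] ℝ) (H : E → ℝ) (Y v : E → E) (ρ : E → ℝ) (z : E) : Prop where
  smooth_Y : ContDiffAt ℝ ∞ Y z
  smooth_v : ContDiffAt ℝ ∞ v z
  smooth_ρ : ContDiffAt ℝ ∞ ρ z
  killing : ∀ a b, fderiv ℝ G.h z (Y z) a b + G.h z (fderiv ℝ Y z a) b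
    + G.h z a (fderiv ℝ Y z b) = 0
  lieW : ∀ c, fderiv ℝ W z (Y z) c + W z (fderiv ℝ Y z c) = 2 * fderiv ℝ ρ z c
  grad : ∀ c, G.h z (v z) c = fderiv ℝ ρ z c
  hess : ∀ b c, fderiv ℝ G.h z (v z) b c + G.h z (fderiv ℝ v z b) c
    + G.h z b (fderiv ℝ v z c) = W z b * fderiv ℝ ρ z c + W z c * fderiv ℝ ρ z b
  quad : ∀ c, W z (v z) * W z c - 2 * (fderiv ℝ W z (v z) c + W z (fderiv ℝ v z c))
    + (fderiv ℝ W z c (v z) + W z (fderiv ℝ v z c)) + 4 * H z * fderiv ℝ ρ z c = 0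
  lieH : fderiv ℝ H z (Y z) = 1 / 2 * W z (v z)

namespace KundtSymmetry

variable {E : Type*} [NormedAddCommGroup E] [NormedSpace ℝ E] {G : LocalMetric E}
  {W : E → E →L[ℝ] ℝ} {H : E → ℝ} {Y v : E → E} {ρ : E → ℝ} {y : E} {κ : ℝ}

/-- Since `v` is the gradient of `ρ`, the Lie derivative of the metric along `v` is twice the
Hessian of `ρ`. -/
theorem nabla_fderiv (hy : y ∈ G.Ω) (hs : ∀ᶠ z in 𝓝 y, KundtSymmetry G W H Y v ρ z) (b c : E) :
    G.nabla (fderiv ℝ ρ) y b c = 1 / 2 * (W y b * fderiv ℝ ρ y c + W y c * fderiv ℝ ρ y b) := by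
  have h0 := hs.self_of_nhds
  have hd := h0.smooth_ρ.fderiv_infty.diff
  have e1 := G.h_nabla_dual hy hd h0.smooth_v.diff (hs.mono fun z hz => hz.grad) b c
  have e2 := G.h_nabla_dual hy hd h0.smooth_v.diff (hs.mono fun z hz => hz.grad) c b
  have hsym := fderiv_fderiv_symm h0.smooth_ρ b c
  have e3 := h0.hess b c
  rw [G.compat y hy] at e3
  rw [G.symm y hy b, G.symm y hy b] at e3
  rw [G.Γ_symm y hy (v y) b, G.Γ_symm y hy (v y) c] at e3
  simp only [map_add, add_apply, LocalMetric.nabla, hsym, G.Γ_symm y hy c b] at e1 e2 ⊢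
  linear_combination (e3 - e1 - e2) / 2

theorem eventually_nabla_fderiv (hy : y ∈ G.Ω)
    (hs : ∀ᶠ z in 𝓝 y, KundtSymmetry G W H Y v ρ z) :
    ∀ᶠ z in 𝓝 y, ∀ b c, G.nabla (fderiv ℝ ρ) z b c
      = 1 / 2 * (W z b * fderiv ℝ ρ z c + W z c * fderiv ℝ ρ z b) := by
  filter_upwards [hs.eventually_nhds, G.eventually_mem hy] with z hz hzΩ
  exact nabla_fderiv hzΩ hz

/-- The Hessian equation with an index raised; it closes the system, since it expresses the
derivative of `v` by `v` and `dρ`. -/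
theorem fderiv_v (hy : y ∈ G.Ω) (hs : ∀ᶠ z in 𝓝 y, KundtSymmetry G W H Y v ρ z) (c : E) :
    fderiv ℝ v y c = (1 / 2 : ℝ) • (W y c • v y + fderiv ℝ ρ y c • G.sharp y (W y))
      - G.Γ y c (v y) := by
  have h0 := hs.self_of_nhds
  rw [eq_sub_iff_add_eq]
  refine G.ext_h hy fun b => ?_
  rw [G.h_nabla_dual hy h0.smooth_ρ.fderiv_infty.diff h0.smooth_v.diff
    (hs.mono fun z hz => hz.grad), nabla_fderiv hy hs]
  simp only [map_smul, map_add, add_apply, smul_apply, smul_eq_mul, h0.grad, G.sharp_spec y hy]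
  ring

theorem apply_sharp (hy : y ∈ G.Ω) (h0 : KundtSymmetry G W H Y v ρ y) :
    fderiv ℝ ρ y (G.sharp y (W y)) = W y (v y) := by
  rw [← h0.grad, G.symm y hy, G.sharp_spec y hy]

/-- `σ = 2 H - ‖W‖² / 4`. -/
def _root_.Kundt.sigma (G : LocalMetric E) (W : E → E →L[ℝ] ℝ) (H : E → ℝ) (z : E) : ℝ :=
  2 * H z - 1 / 4 * G.normSq W z

/-- The field `quad` reads $\mathbf W(v)\mathbf W-2\mathcal L_v\mathbf W+d(\mathbf
W(v))+4H\,d\rho=0$; eliminating the derivative of `v` leaves only `∇W`. The number `κ` is arbitrary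
here, since its contributions cancel. -/
theorem quad_defect (hy : y ∈ G.Ω)
    (hs : ∀ᶠ z in 𝓝 y, KundtSymmetry G W H Y v ρ z) (c : E) :
    -G.defect κ W y (v y) c + 1 / 2 * G.defect κ W y c (v y)
      + (sigma G W H y - κ) * fderiv ℝ ρ y c = 0 := by
  have h0 := hs.self_of_nhds
  have e1 := h0.quad c
  have e2 := fderiv_v hy hs c
  rw [e2] at e1
  simp only [map_smul, map_add, map_sub, smul_eq_mul] at e1
  have e3 := h0.grad c
  have e4 := G.symm y hy c (v y)
  have e5 := G.Γ_symm y hy c (v y)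
  simp only [LocalMetric.defect, sigma, LocalMetric.nabla, LocalMetric.normSq, e4, e3, e5] at e1 ⊢
  linear_combination e1 / 2

/-- As `Y` preserves the metric, the derivative is $2(\mathcal L_Y\mathbf W)(\mathbf
W^\sharp)=4\,d\rho(\mathbf W^\sharp)$. With `lieH` this makes `sigma` invariant under `Y`. -/
theorem fderiv_normSq (hy : y ∈ G.Ω) (hW : ContDiffAt ℝ ∞ W y)
    (h0 : KundtSymmetry G W H Y v ρ y) :
    fderiv ℝ (G.normSq W) y (Y y) = 4 * W y (v y) := by
  obtain ⟨N, hN, hN'⟩ := G.hasFDerivAt_normSq hy hW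
  rw [hN.fderiv, hN']
  have e1 := h0.killing (G.sharp y (W y)) (G.sharp y (W y))
  have e2 := h0.lieW (G.sharp y (W y))
  rw [h0.apply_sharp hy] at e2
  rw [G.compat y hy, G.symm y hy (G.Γ _ _ _), G.symm y hy (fderiv ℝ Y _ _),
    G.sharp_spec y hy, G.sharp_spec y hy] at e1
  simp only [LocalMetric.nabla]
  linear_combination 2 * e2 - e1

theorem fderiv_sigma (hy : y ∈ G.Ω) (hW : ContDiffAt ℝ ∞ W y) (hH : ContDiffAt ℝ ∞ H y)
    (h0 : KundtSymmetry G W H Y v ρ y) :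
    fderiv ℝ (sigma G W H) y (Y y) = 0 := by
  obtain ⟨N, hN, hN'⟩ := G.hasFDerivAt_normSq hy hW
  have h1 := (hH.diff.hasFDerivAt.const_mul (2 : ℝ)).sub (hN.const_mul (1 / 4 : ℝ))
  have e1 := h0.fderiv_normSq hy hW
  rw [hN.fderiv] at e1
  have h2 : fderiv ℝ (sigma G W H) y = _ := h1.fderiv
  rw [h2]
  simp only [sub_apply, smul_apply, smul_eq_mul, h0.lieH, e1]
  ring

/-- The two conditions `integrability` and `quad_defect` are linear in the defect and determine it:
putting `v` into slots first gives the contractions with `v`, then the whole tensor. -/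
theorem defect_eq (hκ : G.HasCurvature κ) (hy : y ∈ G.Ω) (hW : ContDiffAt ℝ ∞ W y)
    (hs : ∀ᶠ z in 𝓝 y, KundtSymmetry G W H Y v ρ z) (a c : E) :
    fderiv ℝ ρ y (v y) * G.defect κ W y a c
      = 2 * (sigma G W H y - κ) * (fderiv ℝ ρ y a * fderiv ℝ ρ y c) := by
  have h0 := hs.self_of_nhds
  have E1 := G.integrability hκ hy hW h0.smooth_ρ.fderiv_infty (eventually_nabla_fderiv hy hs)
  have E2 := quad_defect (κ := κ) hy hs
  by_cases hr : fderiv ℝ ρ y (v y) = 0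
  -- Here `fderiv ℝ ρ y (v y)` is the squared norm of `dρ`, so `dρ = 0` and both sides vanish.
  · have hv : v y = 0 := by
      by_contra hv
      have := G.pos y hy _ hv
      rw [h0.grad, hr] at this
      exact lt_irrefl _ this
    have hz : ∀ c, fderiv ℝ ρ y c = 0 := fun c => by rw [← h0.grad, hv]; simp
    simp [hz]
  · have s1 : ∀ a, G.defect κ W y a (v y) = 2 * (sigma G W H y - κ) * fderiv ℝ ρ y a := by
      intro a
      have f1 := E1 a (v y) (v y)
      have f2 := E2 (v y)
      have f3 := E2 a
      apply mul_left_cancel₀ hr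
      linear_combination (2 / 3) * (f1 - fderiv ℝ ρ y (v y) * f3 - 2 * fderiv ℝ ρ y a * f2)
    have s2 : G.defect κ W y (v y) a = 2 * (sigma G W H y - κ) * fderiv ℝ ρ y a := by
      linear_combination s1 a / 2 - E2 a
    have s3 : G.defect κ W y (v y) c = 2 * (sigma G W H y - κ) * fderiv ℝ ρ y c := by
      linear_combination s1 c / 2 - E2 c
    have f4 := E1 a (v y) c
    rw [s1 a, s2, s3] at f4
    linear_combination f4

theorem fderiv_grad_self (hy : y ∈ G.Ω)
    (hs : ∀ᶠ z in 𝓝 y, KundtSymmetry G W H Y v ρ z) :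
    ∃ N : E →L[ℝ] ℝ, HasFDerivAt (fun z => fderiv ℝ ρ z (v z)) N y ∧
      ∀ a, N a = W y a * fderiv ℝ ρ y (v y) + W y (v y) * fderiv ℝ ρ y a := by
  have h0 := hs.self_of_nhds
  refine ⟨_, hasFDerivAt_apply_apply h0.smooth_ρ.fderiv_infty.diff h0.smooth_v.diff, fun a => ?_⟩
  have e1 := nabla_fderiv hy hs a (v y)
  have e2 := fderiv_v hy hs a
  have e3 := h0.apply_sharp hy
  simp only [add_apply, ContinuousLinearMap.flip_apply, ContinuousLinearMap.comp_apply, e2]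
  simp only [map_smul, map_add, map_sub, smul_eq_mul, e3]
  simp only [LocalMetric.nabla] at e1
  linear_combination e1

/-- Differentiate `defect_eq` with `σ` constant, antisymmetrize in the first two slots, put `v` into
the third, and remove the second derivatives of `W` by the Ricci identity. What survives is a
nonzero multiple of $c_0|d\rho|^2\,\mathbf W\wedge d\rho$. -/
theorem wedge_eq (hκ : G.HasCurvature κ) (hy : y ∈ G.Ω) (hW : ∀ᶠ z in 𝓝 y, ContDiffAt ℝ ∞ W z)
    (hs : ∀ᶠ z in 𝓝 y, KundtSymmetry G W H Y v ρ z) {c₀ : ℝ} (hc₀ : c₀ ≠ 0)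
    (hσ : ∀ᶠ z in 𝓝 y, 2 * (sigma G W H z - κ) = c₀) (hr : fderiv ℝ ρ y (v y) ≠ 0) (a b : E) :
    W y a * fderiv ℝ ρ y b = W y b * fderiv ℝ ρ y a := by
  have h0 := hs.self_of_nhds
  have hW0 := hW.self_of_nhds
  have hD : ∀ᶠ z in 𝓝 y, ∀ b c, fderiv ℝ ρ z (v z) * G.defect κ W z b c
      - c₀ * (fderiv ℝ ρ z b * fderiv ℝ ρ z c) = 0 := by
    filter_upwards [hs.eventually_nhds, G.eventually_mem hy, hW, hσ] with z h1 h2 h3 h4 b c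
    rw [defect_eq hκ h2 h3 h1, h4, sub_self]
  obtain ⟨R, hR, hR'⟩ := fderiv_grad_self hy hs
  have hρ := h0.smooth_ρ.fderiv_infty
  have key : ∀ a b c : E, (W y a * fderiv ℝ ρ y (v y) + W y (v y) * fderiv ℝ ρ y a)
        * G.defect κ W y b c
      + fderiv ℝ ρ y (v y) * (fderiv ℝ (fun z => G.nabla W z b c) y a
        - 1 / 2 * (fderiv ℝ W y a b * W y c + W y b * fderiv ℝ W y a c)
        - 2 * κ * (G.h y (G.Γ y a b) c + G.h y b (G.Γ y a c)))
      - c₀ * (fderiv ℝ (fderiv ℝ ρ) y a b * fderiv ℝ ρ y c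
        + fderiv ℝ ρ y b * fderiv ℝ (fderiv ℝ ρ) y a c) = 0 := by
    intro a b c
    obtain ⟨N, hN, -⟩ := G.hasFDerivAt_nabla hy hW0 b c
    have hW' := fun b => hasFDerivAt_apply_const hW0.diff b
    have hρ' := fun b => hasFDerivAt_apply_const hρ.diff b
    have hh := hasFDerivAt_bilin_const (G.smooth_h y hy).diff b c
    have hS := (hN.sub (((hW' b).mul (hW' c)).const_mul (1 / 2 : ℝ))).sub
      (hh.const_mul (2 * κ))
    have h1 := (hR.mul hS).sub (((hρ' b).mul (hρ' c)).const_mul c₀)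
    have h2 := DFunLike.congr_fun
      (fderiv_eq_zero_of_eventually_eq_zero (hD.mono fun z hz => hz b c) h1) a
    rw [hN.fderiv, ← G.compat y hy]
    simp only [sub_apply, add_apply, smul_apply, ContinuousLinearMap.flip_apply, smul_eq_mul,
      zero_apply, hR', Pi.sub_apply, Pi.mul_apply] at h2
    simp only [LocalMetric.defect]
    linear_combination h2
  have hR1 := G.ricci_identity hκ hy hW0 a b (v y)
  have k1 := key a b (v y)
  have k2 := key b a (v y)
  have d : ∀ b c, fderiv ℝ ρ y (v y) * G.defect κ W y b c
      = c₀ * (fderiv ℝ ρ y b * fderiv ℝ ρ y c) := fun b c => by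
    linear_combination hD.self_of_nhds b c
  have hn : ∀ b c, G.nabla (fderiv ℝ ρ) y b c
      = 1 / 2 * (W y b * fderiv ℝ ρ y c + W y c * fderiv ℝ ρ y b) := nabla_fderiv hy hs
  have n1 : ∀ b c, fderiv ℝ (fderiv ℝ ρ) y b c = 1 / 2 * (W y b * fderiv ℝ ρ y c
      + W y c * fderiv ℝ ρ y b) + fderiv ℝ ρ y (G.Γ y b c) := fun b c => by
    rw [← hn]; simp [LocalMetric.nabla]
  have n2 : ∀ b c, fderiv ℝ W y b c = G.nabla W y b c + W y (G.Γ y b c) := fun b c => by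
    simp [LocalMetric.nabla]
  have n3 : ∀ b c, G.nabla W y b c = G.defect κ W y b c + 1 / 2 * (W y b * W y c)
      + 2 * κ * G.h y b c := fun b c => by simp only [LocalMetric.defect]; ring
  have d1 : fderiv ℝ ρ y a * G.defect κ W y b (v y)
      = fderiv ℝ ρ y b * G.defect κ W y a (v y) := by
    apply mul_left_cancel₀ hr
    linear_combination fderiv ℝ ρ y a * d b (v y) - fderiv ℝ ρ y b * d a (v y)
  have dab : G.defect κ W y a b = G.defect κ W y b a := by
    apply mul_left_cancel₀ hr
    linear_combination d a b - d b a
  rw [G.Γ_symm y hy b a] at k2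
  simp only [n1, n2, n3, G.Γ_symm y hy b a, dab, G.symm y hy b a] at hR1 k1 k2
  have t1 := d a (v y)
  have t2 := d b (v y)
  have t3 := d b (G.Γ y a (v y))
  have t4 := d a (G.Γ y b (v y))
  apply mul_left_cancel₀ (mul_ne_zero hc₀ hr)
  linear_combination k1 - k2 - fderiv ℝ ρ y (v y) * hR1 - 3 / 2 * W y a * t2
    + 3 / 2 * W y b * t1 - W y (v y) * d1 - t3 + t4

/-- By `wedge_eq`, $\mathbf W=f\,d\rho$ nearby with $f=\mathbf W(v)/|d\rho|^2$. For $X$ in the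
kernel of $d\rho$ this gives $(\nabla\mathbf W)(X,X)=f\operatorname{Hess}\rho(X,X)=0$, whereas
`defect_eq` gives $(\nabla\mathbf W)(X,X)=2\kappa\,\mathbf h(X,X)$. -/
theorem kappa_eq_zero_of_sigma_ne (hκ : G.HasCurvature κ) (hy : y ∈ G.Ω)
    (hW : ∀ᶠ z in 𝓝 y, ContDiffAt ℝ ∞ W z)
    (hs : ∀ᶠ z in 𝓝 y, KundtSymmetry G W H Y v ρ z) {c₀ : ℝ} (hc₀ : c₀ ≠ 0)
    (hσ : ∀ᶠ z in 𝓝 y, 2 * (sigma G W H z - κ) = c₀) (hr : fderiv ℝ ρ y (v y) ≠ 0)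
    {X : E} (hX : X ≠ 0) (hρX : fderiv ℝ ρ y X = 0) : κ = 0 := by
  have h0 := hs.self_of_nhds
  have hW0 := hW.self_of_nhds
  obtain ⟨R, hR, hR'⟩ := fderiv_grad_self hy hs
  have hρ := h0.smooth_ρ.fderiv_infty
  have hw : ∀ᶠ z in 𝓝 y, W z X * fderiv ℝ ρ z (v z) - W z (v z) * fderiv ℝ ρ z X = 0 := by
    have hr' : ∀ᶠ z in 𝓝 y, fderiv ℝ ρ z (v z) ≠ 0 := hR.continuousAt.eventually_ne hr
    filter_upwards [hs.eventually_nhds, G.eventually_mem hy, hW.eventually_nhds,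
      hσ.eventually_nhds, hr'] with z h1 h2 h3 h4 h5
    rw [wedge_eq hκ h2 h3 h1 hc₀ h4 h5 X (v z), sub_self]
  have hWX := hasFDerivAt_apply_const hW0.diff X
  have hρX' := hasFDerivAt_apply_const hρ.diff X
  have hWv := hasFDerivAt_apply_apply hW0.diff h0.smooth_v.diff
  have h2 := DFunLike.congr_fun
    (fderiv_eq_zero_of_eventually_eq_zero hw ((hWX.mul hR).sub (hWv.mul hρX'))) X
  simp only [sub_apply, add_apply, smul_apply, ContinuousLinearMap.flip_apply, smul_eq_mul,
    zero_apply, hρX, zero_mul, add_zero] at h2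
  have hWX0 : W y X = 0 := by
    have := hw.self_of_nhds
    rw [hρX, mul_zero, sub_zero] at this
    exact (mul_eq_zero.1 this).resolve_right hr
  have hΓ : W y (G.Γ y X X) * fderiv ℝ ρ y (v y) = W y (v y) * fderiv ℝ ρ y (G.Γ y X X) :=
    wedge_eq hκ hy hW hs hc₀ hσ hr _ _
  have hn := nabla_fderiv hy hs X X
  simp only [LocalMetric.nabla, hρX, mul_zero, add_zero] at hn
  have hS := defect_eq hκ hy hW0 hs X X
  rw [hρX, mul_zero, mul_zero] at hS
  have hS' := (mul_eq_zero.1 hS).resolve_left hr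
  simp only [LocalMetric.defect, LocalMetric.nabla, hWX0] at hS'
  have hh := (G.pos y hy X hX).ne'
  apply mul_right_cancel₀ (mul_ne_zero hr hh)
  rw [hWX0] at h2
  linear_combination (h2 + W y (v y) * hn - hΓ - fderiv ℝ ρ y (v y) * hS') / 2

end KundtSymmetry

/-- Every point and every direction is reached by a symmetry. -/
def HasSymmetries {E : Type*} [NormedAddCommGroup E] [NormedSpace ℝ E] (G : LocalMetric E)
    (W : E → E →L[ℝ] ℝ) (H : E → ℝ) : Prop :=
  ∀ y ∈ G.Ω, ∀ a : E, ∃ Y v ρ, Y y = a ∧ ∀ᶠ z in 𝓝 y, KundtSymmetry G W H Y v ρ z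

section

variable {E : Type*} [NormedAddCommGroup E] [NormedSpace ℝ E] {G : LocalMetric E}
  {W : E → E →L[ℝ] ℝ} {H : E → ℝ} {y : E} {κ : ℝ}

theorem HasSymmetries.eventually_sigma_eq (hsym : HasSymmetries G W H)
    (hW : ∀ z ∈ G.Ω, ContDiffAt ℝ ∞ W z) (hH : ∀ z ∈ G.Ω, ContDiffAt ℝ ∞ H z) (hy : y ∈ G.Ω) :
    ∀ᶠ z in 𝓝 y, sigma G W H z = sigma G W H y := by
  apply eventually_eq_of_fderiv_eq_zero
  filter_upwards [G.eventually_mem hy] with z hz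
  refine ⟨?_, ?_⟩
  · obtain ⟨N, hN, -⟩ := G.hasFDerivAt_normSq hz (hW z hz)
    exact ((hH z hz).diff.const_mul 2).sub (hN.differentiableAt.const_mul (1 / 4))
  · ext a
    obtain ⟨Y, v, ρ, rfl, hs⟩ := hsym z hz a
    exact hs.self_of_nhds.fderiv_sigma hz (hW z hz) (hH z hz)

set_option synthInstance.maxHeartbeats 200000 in
/-- If some symmetry has `dρ ≠ 0`, then `∇W = W ⊗ W / 2 + 2 κ h` nearby, where in dimension one
the curvature has to be chosen suitably. -/
theorem exists_eventually_defect_eq_zero [FiniteDimensional ℝ E] (hκ : G.HasCurvature κ)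
    (hW : ∀ z ∈ G.Ω, ContDiffAt ℝ ∞ W z) (hH : ∀ z ∈ G.Ω, ContDiffAt ℝ ∞ H z)
    (hsym : HasSymmetries G W H)
    (hflat : 2 ≤ finrank ℝ E → κ = 0 → ∀ z ∈ G.Ω, H z = G.normSq W z / 8)
    (hy : y ∈ G.Ω) {Y v : E → E} {ρ : E → ℝ}
    (hs : ∀ᶠ z in 𝓝 y, KundtSymmetry G W H Y v ρ z) (hρ : fderiv ℝ ρ y ≠ 0) :
    ∃ κ' : ℝ, G.HasCurvature κ' ∧ ∀ᶠ z in 𝓝 y, ∀ a b, G.defect κ' W z a b = 0 := by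
  have h0 := hs.self_of_nhds
  have hv : v y ≠ 0 := by
    intro hv
    apply hρ
    ext c
    rw [← h0.grad, hv]
    simp
  have hr : fderiv ℝ ρ y (v y) ≠ 0 := by
    rw [← h0.grad]
    exact (G.pos y hy _ hv).ne'
  obtain ⟨R, hR, -⟩ := KundtSymmetry.fderiv_grad_self hy hs
  have hr' : ∀ᶠ z in 𝓝 y, fderiv ℝ ρ z (v z) ≠ 0 := hR.continuousAt.eventually_ne hr
  have hσ := hsym.eventually_sigma_eq hW hH hy
  have hWe : ∀ᶠ z in 𝓝 y, ContDiffAt ℝ ∞ W z := (G.eventually_mem hy).mono hW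
  have hpos : 0 < finrank ℝ E := finrank_pos_iff_exists_ne_zero.2 ⟨_, hv⟩
  by_cases hdim : 2 ≤ finrank ℝ E
  -- Otherwise the kernel of `dρ`, nonzero in dimension at least two, forces `κ = 0`; then `hflat`
  -- says `sigma = 0 = κ`.
  · have hσκ : sigma G W H y = κ := by
      by_contra hne
      have hX : ∃ X : E, X ≠ 0 ∧ fderiv ℝ ρ y X = 0 := by
        have hker : 0 < finrank ℝ (LinearMap.ker (fderiv ℝ ρ y).toLinearMap) := by
          have h1 := LinearMap.finrank_range_add_finrank_ker (fderiv ℝ ρ y).toLinearMap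
          have h2 := (LinearMap.range (fderiv ℝ ρ y).toLinearMap).finrank_le
          rw [finrank_self] at h2
          omega
        obtain ⟨⟨X, hX⟩, hX0⟩ := finrank_pos_iff_exists_ne_zero.1 hker
        exact ⟨X, fun h => hX0 (by simpa using h), hX⟩
      obtain ⟨X, hX0, hX⟩ := hX
      have hκ0 : κ = 0 := KundtSymmetry.kappa_eq_zero_of_sigma_ne hκ hy hWe hs
        (c₀ := 2 * (sigma G W H y - κ)) (mul_ne_zero two_ne_zero (sub_ne_zero.2 hne))
        (hσ.mono fun z hz => by rw [hz]) hr hX0 hX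
      apply hne
      rw [sigma, hflat hdim hκ0 y hy, hκ0]
      ring
    refine ⟨κ, hκ, ?_⟩
    filter_upwards [hs.eventually_nhds, G.eventually_mem hy, hWe, hσ, hr'] with z h1 h2 h3 h4 h5 a b
    have := KundtSymmetry.defect_eq hκ h2 h3 h1 a b
    rw [h4, hσκ, sub_self, mul_zero, zero_mul] at this
    exact (mul_eq_zero.1 this).resolve_left h5
  · have hone : finrank ℝ E = 1 := by omega
    -- On a line the curvature identity holds for every constant, and $d\rho\otimes
    -- d\rho=|d\rho|^2\mathbf h$. So `defect_eq` says that the defect for `κ` is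
    -- $2(\sigma-\kappa)\mathbf h$, that is, the defect for `σ` vanishes.
    refine ⟨sigma G W H y, fun z hz a b c => ?_, ?_⟩
    · obtain ⟨s, rfl⟩ := exists_smul_eq_of_finrank_eq_one hone hv a
      obtain ⟨t, rfl⟩ := exists_smul_eq_of_finrank_eq_one hone hv b
      obtain ⟨r, rfl⟩ := exists_smul_eq_of_finrank_eq_one hone hv c
      simp only [map_smul, smul_apply, smul_smul, smul_eq_mul, ← sub_smul]
      ring_nf
      simp
    · filter_upwards [hs.eventually_nhds, G.eventually_mem hy, hWe, hσ, hr'] with z h1 h2 h3 h4 h5 a b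
      have hvz : v z ≠ 0 := by
        intro h
        rw [h, map_zero] at h5
        exact h5 rfl
      have h6 := KundtSymmetry.defect_eq hκ h2 h3 h1 a b
      obtain ⟨s, rfl⟩ := exists_smul_eq_of_finrank_eq_one hone hvz a
      obtain ⟨t, rfl⟩ := exists_smul_eq_of_finrank_eq_one hone hvz b
      have h7 := h1.self_of_nhds.grad (v z)
      rw [h4] at h6
      simp only [LocalMetric.defect, LocalMetric.nabla, map_smul, smul_apply, smul_eq_mul, h7]
        at h6 ⊢
      apply mul_left_cancel₀ h5
      linear_combination h6

end

end Kundt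

/-! ### Solutions of Hess ψ = −κψh with prescribed value and differential at a point. -/

namespace Kundt

section

variable {E F F' : Type*} [NormedAddCommGroup E] [NormedSpace ℝ E]
  [NormedAddCommGroup F] [NormedSpace ℝ F] [NormedAddCommGroup F'] [NormedSpace ℝ F']

theorem fderiv_apply_apply_const {A : E → F →L[ℝ] E →L[ℝ] F'} {y : E}
    (h : DifferentiableAt ℝ A y) (s : F) (b a : E) :
    fderiv ℝ (fun z => A z s b) y a = fderiv ℝ A y a s b := by
  have h1 : HasFDerivAt (fun z => A z s) _ y := h.hasFDerivAt.clm_apply (hasFDerivAt_const s y)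
  have h2 := h1.clm_apply (hasFDerivAt_const b y)
  rw [h2.fderiv]
  simp

/-- A linear map on a finite-dimensional normed space, as a continuous linear map. -/
def finiteDimensionalCLM [FiniteDimensional ℝ F] (L : F →ₗ[ℝ] F') : F →L[ℝ] F' :=
  LinearMap.toContinuousLinearMap L

end

namespace LocalMetric

variable {E : Type*} [NormedAddCommGroup E] [NormedSpace ℝ E] [FiniteDimensional ℝ E]
  (G : LocalMetric E) {y : E} {κ : ℝ} {W : E → E →L[ℝ] ℝ} {ψ χ : E → ℝ}

section Connection

variable {F : Type*} [NormedAddCommGroup F] [NormedSpace ℝ F] [FiniteDimensional ℝ F]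
  (p : F →L[ℝ] ℝ) (q : F →L[ℝ] E →L[ℝ] ℝ) (i : ℝ →L[ℝ] F) (j : (E →L[ℝ] ℝ) →L[ℝ] F)

/-- The one-form valued part of `hessConnection`. -/
def hessConnectionForm (κ : ℝ) (z : E) (s : F) (a : E) : E →L[ℝ] ℝ :=
  (q s).comp (G.Γ z a) - (κ * p s) • G.h z a

/-- The connection on `F = ℝ × E*` whose parallel sections are the pairs `(ψ, dψ)` with
`Hess ψ = -κ ψ h`. -/
def hessConnection (κ : ℝ) (z : E) : F →L[ℝ] E →L[ℝ] F :=
  finiteDimensionalCLM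
    { toFun := fun s => finiteDimensionalCLM
        { toFun := fun a => i (q s a) + j (G.hessConnectionForm p q κ z s a)
          map_add' := fun a b => by
            simp only [hessConnectionForm, map_add, ContinuousLinearMap.comp_add, smul_add,
              map_sub, map_smul]
            abel
          map_smul' := fun r a => by
            simp only [hessConnectionForm, map_smul, ContinuousLinearMap.comp_smul, map_sub,
              RingHom.id_apply, smul_add, smul_sub, smul_comm r] }
      map_add' := fun s t => by
        ext a
        change i (q (s + t) a) + j (G.hessConnectionForm p q κ z (s + t) a)
          = (i (q s a) + j (G.hessConnectionForm p q κ z s a))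
            + (i (q t a) + j (G.hessConnectionForm p q κ z t a))
        simp only [hessConnectionForm, map_add, ContinuousLinearMap.add_comp, add_apply, mul_add,
          add_smul, map_sub]
        abel
      map_smul' := fun r s => by
        ext a
        change i (q (r • s) a) + j (G.hessConnectionForm p q κ z (r • s) a)
          = r • (i (q s a) + j (G.hessConnectionForm p q κ z s a))
        simp only [hessConnectionForm, map_smul, ContinuousLinearMap.smul_comp, smul_apply,
          smul_add, map_sub, smul_sub, smul_eq_mul, smul_smul]
        rw [← smul_eq_mul, i.map_smul, mul_left_comm] }

theorem hessConnection_apply (κ : ℝ) (z : E) (s : F) (a : E) :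
    G.hessConnection p q i j κ z s a = i (q s a) + j (G.hessConnectionForm p q κ z s a) :=
  rfl

theorem smooth_hessConnection (hy : y ∈ G.Ω) :
    ContDiffAt ℝ ∞ (G.hessConnection p q i j κ) y := by
  refine ContDiffOn.contDiffAt (s := G.Ω) ?_ (G.isOpen.mem_nhds hy)
  rw [contDiffOn_clm_apply]
  intro s
  rw [contDiffOn_clm_apply]
  intro a x hx
  refine ContDiffAt.contDiffWithinAt ?_
  simp only [hessConnection_apply, hessConnectionForm]
  have h1 : ContDiffAt ℝ ∞ (fun z => G.Γ z a) x := (G.smooth_Γ x hx).clm_apply contDiffAt_const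
  have h2 : ContDiffAt ℝ ∞ (fun z => G.h z a) x := (G.smooth_h x hx).clm_apply contDiffAt_const
  exact contDiffAt_const.add
    (j.contDiff.contDiffAt.comp x ((contDiffAt_const.clm_comp h1).sub (h2.const_smul _)))

theorem fderiv_hessConnection (hy : y ∈ G.Ω) (a b : E) (s : F) :
    fderiv ℝ (G.hessConnection p q i j κ) y a s b
      = j ((q s).comp (fderiv ℝ G.Γ y a b) - (κ * p s) • fderiv ℝ G.h y a b) := by
  rw [← fderiv_apply_apply_const (G.smooth_hessConnection p q i j hy).diff]
  simp only [hessConnection_apply, hessConnectionForm]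
  have h1 : HasFDerivAt (fun z => G.Γ z b) ((fderiv ℝ G.Γ y).flip b) y :=
    hasFDerivAt_apply_const (G.smooth_Γ y hy).diff b
  have h2 : HasFDerivAt (fun z => G.h z b) ((fderiv ℝ G.h y).flip b) y :=
    hasFDerivAt_apply_const (G.smooth_h y hy).diff b
  have h3 := j.hasFDerivAt.comp y
    (((hasFDerivAt_const (q s) y).clm_comp h1).sub (h2.const_smul (κ * p s)))
  have h4 := h3.const_add (i (q s b))
  have h5 : fderiv ℝ (fun z => i (q s b) + j ((q s).comp (G.Γ z b) - (κ * p s) • G.h z b)) y = _ :=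
    h4.fderiv
  rw [h5]
  simp

/-- The function `ψ` satisfies `Hess ψ = -κ ψ h` at `z`. -/
structure HessEq (κ : ℝ) (ψ : E → ℝ) (z : E) : Prop where
  smooth : ContDiffAt ℝ ∞ ψ z
  hess : ∀ a b, G.nabla (fderiv ℝ ψ) z a b = -κ * ψ z * G.h z a b

/-- The connection is flat: the scalar part of its curvature vanishes because the Christoffel
symbols and the metric are symmetric, and the covector part is the Riemann tensor minus its constant
curvature value. `F` enters only through its projections `p`, `q` and injections `i`, `j`. -/
theorem exists_hessEq_of_splitting (hpi : ∀ t, p (i t) = t) (hpj : ∀ α, p (j α) = 0)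
    (hqi : ∀ t, q (i t) = 0) (hqj : ∀ α, q (j α) = α)
    (hκ : G.HasCurvature κ) (hy : y ∈ G.Ω) (c : ℝ) (β : E →L[ℝ] ℝ) :
    ∃ ψ : E → ℝ, ψ y = c ∧ fderiv ℝ ψ y = β ∧ ∀ᶠ z in 𝓝 y, G.HessEq κ ψ z := by
  have : CompleteSpace F := FiniteDimensional.complete ℝ F
  obtain ⟨s, hs0, hs1, hs⟩ := exists_parallel
    ((G.eventually_mem hy).mono fun z hz => G.smooth_hessConnection p q i j (κ := κ) hz)
    (by
      filter_upwards [G.eventually_mem hy] with z hz a b s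
      have h1 := hκ z hz a b
      rw [G.fderiv_hessConnection p q i j hz, G.fderiv_hessConnection p q i j hz]
      have hc : ∀ a b, G.hessConnection p q i j κ z (G.hessConnection p q i j κ z s a) b
          = i (G.hessConnectionForm p q κ z s a b)
            + j ((G.hessConnectionForm p q κ z s a).comp (G.Γ z b) - (κ * q s a) • G.h z b) := by
        intro a b
        have hp : p (G.hessConnection p q i j κ z s a) = q s a := by
          rw [hessConnection_apply, map_add, hpi, hpj, add_zero]
        have hq : q (G.hessConnection p q i j κ z s a) = G.hessConnectionForm p q κ z s a := by
          rw [hessConnection_apply, map_add, hqi, hqj, zero_add]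
        have hf : G.hessConnectionForm p q κ z (G.hessConnection p q i j κ z s a) b
            = (G.hessConnectionForm p q κ z s a).comp (G.Γ z b) - (κ * q s a) • G.h z b := by
          rw [hessConnectionForm, hp, hq]
        rw [hessConnection_apply, hq, hf]
      have e1 : G.hessConnectionForm p q κ z s a b = G.hessConnectionForm p q κ z s b a := by
        simp [hessConnectionForm, G.Γ_symm z hz a b, G.symm z hz a b]
      rw [hc, hc, e1, add_left_comm, add_left_comm _ (i _), ← map_add, ← map_add]
      congr 2
      ext x
      have h2 := congrArg (q s) (h1 x)
      simp only [map_sub, map_add, map_smul, smul_eq_mul] at h2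
      have g1 := G.compat z hz a b x
      have g2 := G.compat z hz b a x
      simp only [hessConnectionForm, sub_apply, add_apply, smul_apply,
        ContinuousLinearMap.comp_apply, smul_eq_mul, g1, g2, G.Γ_symm z hz b a]
      linear_combination h2) (i c + j β)
  have hψ : ∀ᶠ z in 𝓝 y, HasFDerivAt (fun z => p (s z)) (q (s z)) z := by
    filter_upwards [hs] with z hz
    have h1 := p.hasFDerivAt.comp z hz
    have h2 : p.comp (G.hessConnection p q i j κ z (s z)) = q (s z) := by
      ext a
      simp [hessConnection_apply, hpi, hpj]
    rwa [h2] at h1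
  have hψ' : ∀ᶠ z in 𝓝 y, fderiv ℝ (fun z => p (s z)) z = q (s z) := hψ.mono fun z hz => hz.fderiv
  refine ⟨fun z => p (s z), by simp [hs0, hpi, hpj],
    by rw [hψ'.self_of_nhds, hs0]; simp [hqi, hqj], ?_⟩
  filter_upwards [hs, hψ'.eventually_nhds,
    hs1, G.eventually_mem hy] with z h1 h2 h3 h4
  refine ⟨p.contDiff.contDiffAt.comp z h3, fun a b => ?_⟩
  have h5 : fderiv ℝ (fderiv ℝ fun z => p (s z)) z = fderiv ℝ (fun z => q (s z)) z :=
    EventuallyEq.fderiv_eq h2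
  have h6 : fderiv ℝ (fun z => q (s z)) z = _ := (q.hasFDerivAt.comp z h1).fderiv
  rw [nabla, h5, h6, h2.self_of_nhds]
  simp [hessConnection_apply, hessConnectionForm, hqi, hqj]

end Connection

/-- In constant curvature `κ` the equation `Hess ψ = -κ ψ h` has local solutions with arbitrary
value and differential at a point. -/
theorem exists_hessEq (hκ : G.HasCurvature κ) (hy : y ∈ G.Ω) (c : ℝ) (β : E →L[ℝ] ℝ) :
    ∃ ψ : E → ℝ, ψ y = c ∧ fderiv ℝ ψ y = β ∧ ∀ᶠ z in 𝓝 y, G.HessEq κ ψ z :=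
  G.exists_hessEq_of_splitting (F := ℝ × (E →L[ℝ] ℝ)) (ContinuousLinearMap.fst ℝ _ _)
    (ContinuousLinearMap.snd ℝ _ _) (ContinuousLinearMap.inl ℝ _ _)
    (ContinuousLinearMap.inr ℝ _ _) (by simp) (by simp) (by simp) (by simp) hκ hy c β

end LocalMetric

end Kundt

/-! ### Killing fields and Lie derivatives of W when ∇W = W⊗W/2 + 2κh. -/

namespace Kundt

/-- The Lie derivative of a one-form along a vector field, on an open subset of a vector space. -/
def lieForm {E : Type*} [NormedAddCommGroup E] [NormedSpace ℝ E] (W : E → E →L[ℝ] ℝ) (ξ : E → E)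
    (z : E) : E →L[ℝ] ℝ :=
  fderiv ℝ W z (ξ z) + (W z).comp (fderiv ℝ ξ z)

/-- The vector field `ξ` is smooth and satisfies the Killing equation at `z`. -/
structure LocalMetric.IsKillingAt {E : Type*} [NormedAddCommGroup E] [NormedSpace ℝ E]
    (G : LocalMetric E) (ξ : E → E) (z : E) : Prop where
  smooth : ContDiffAt ℝ ∞ ξ z
  killing : ∀ a b, fderiv ℝ G.h z (ξ z) a b + G.h z (fderiv ℝ ξ z a) b
    + G.h z a (fderiv ℝ ξ z b) = 0

namespace LocalMetric

section

variable {E : Type*} [NormedAddCommGroup E] [NormedSpace ℝ E]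
  {G : LocalMetric E} {y : E} {κ : ℝ} {W : E → E →L[ℝ] ℝ} {ψ χ : E → ℝ}

theorem apply_sharp_comm (hy : y ∈ G.Ω) (α β : E →L[ℝ] ℝ) :
    α (G.sharp y β) = β (G.sharp y α) := by
  rw [← G.sharp_spec y hy α, G.symm y hy, G.sharp_spec y hy]

theorem sharp_h (hy : y ∈ G.Ω) (a : E) : G.sharp y (G.h y a) = a :=
  G.ext_h hy fun c => G.sharp_spec y hy _ c

variable (G) in
/-- The one-form `ψ dχ - χ dψ`. -/
def pairForm (ψ χ : E → ℝ) (z : E) : E →L[ℝ] ℝ := ψ z • fderiv ℝ χ z - χ z • fderiv ℝ ψ z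

variable (G) in
/-- The vector field `ψ ∇χ - χ ∇ψ`. -/
def pairField (ψ χ : E → ℝ) (z : E) : E := G.sharp z (pairForm ψ χ z)

theorem smooth_pairForm (hψ : ContDiffAt ℝ ∞ ψ y) (hχ : ContDiffAt ℝ ∞ χ y) :
    ContDiffAt ℝ ∞ (pairForm ψ χ) y :=
  (hψ.smul hχ.fderiv_infty).sub (hχ.smul hψ.fderiv_infty)

/-- The two Hessian terms are multiples of the metric and cancel. What is left is antisymmetric in
`c` and `b`, which makes the dual vector field Killing. -/
theorem nabla_pairForm (hψ : G.HessEq κ ψ y) (hχ : G.HessEq κ χ y) (c b : E) :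
    G.nabla (pairForm ψ χ) y c b
      = fderiv ℝ ψ y c * fderiv ℝ χ y b - fderiv ℝ χ y c * fderiv ℝ ψ y b := by
  have h1 := (hψ.smooth.diff.hasFDerivAt.smul hχ.smooth.fderiv_infty.diff.hasFDerivAt).sub
    (hχ.smooth.diff.hasFDerivAt.smul hψ.smooth.fderiv_infty.diff.hasFDerivAt)
  have h2 : fderiv ℝ (pairForm ψ χ) y = _ := h1.fderiv
  have h3 := hψ.hess c b
  have h4 := hχ.hess c b
  simp only [nabla] at h3 h4 ⊢
  rw [h2]
  simp only [pairForm, add_apply, sub_apply, smul_apply, ContinuousLinearMap.smulRight_apply,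
    smul_eq_mul]
  linear_combination ψ y * h4 - χ y * h3

theorem smooth_pairField (hy : y ∈ G.Ω) (hψ : ContDiffAt ℝ ∞ ψ y) (hχ : ContDiffAt ℝ ∞ χ y) :
    ContDiffAt ℝ ∞ (G.pairField ψ χ) y :=
  G.smooth_sharp_apply hy (smooth_pairForm hψ hχ)

theorem h_fderiv_pairField (hy : y ∈ G.Ω) (hψ : G.HessEq κ ψ y) (hχ : G.HessEq κ χ y) (c b : E) :
    G.h y (fderiv ℝ (G.pairField ψ χ) y c + G.Γ y c (G.pairField ψ χ y)) b
      = fderiv ℝ ψ y c * fderiv ℝ χ y b - fderiv ℝ χ y c * fderiv ℝ ψ y b := by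
  rw [← nabla_pairForm hψ hχ]
  exact G.h_nabla_dual hy (smooth_pairForm hψ.smooth hχ.smooth).diff
    (smooth_pairField hy hψ.smooth hχ.smooth).diff (G.eventually_sharp_spec hy _) c b

theorem isKillingAt_pairField (hy : y ∈ G.Ω) (hψ : G.HessEq κ ψ y) (hχ : G.HessEq κ χ y) :
    G.IsKillingAt (G.pairField ψ χ) y := by
  refine ⟨smooth_pairField hy hψ.smooth hχ.smooth, fun a b => ?_⟩
  have h1 := h_fderiv_pairField hy hψ hχ a b
  have h2 := h_fderiv_pairField hy hψ hχ b a
  simp only [map_add, add_apply] at h1 h2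
  rw [G.compat y hy, G.symm y hy a, G.symm y hy a, G.Γ_symm y hy _ a, G.Γ_symm y hy _ b]
  linear_combination h1 + h2

/-- Write $\mathcal L_\xi\mathbf W=\nabla_\xi\mathbf W+\mathbf W(\nabla\xi)$; the vanishing defect
gives the first term, `h_fderiv_pairField` the second. At a point the result depends only on the
values and differentials of `ψ` and `χ`, which can be prescribed. -/
theorem lieForm_pairField (hy : y ∈ G.Ω) (hS : ∀ a b, G.defect κ W y a b = 0)
    (hψ : G.HessEq κ ψ y) (hχ : G.HessEq κ χ y) (c : E) :
    lieForm W (G.pairField ψ χ) y c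
      = 1 / 2 * (pairForm ψ χ y (G.sharp y (W y)) * W y c) + 2 * κ * pairForm ψ χ y c
        + fderiv ℝ ψ y c * fderiv ℝ χ y (G.sharp y (W y))
        - fderiv ℝ χ y c * fderiv ℝ ψ y (G.sharp y (W y)) := by
  have h1 := h_fderiv_pairField hy hψ hχ c (G.sharp y (W y))
  rw [G.symm y hy, G.sharp_spec y hy, map_add] at h1
  have h2 := hS (G.pairField ψ χ y) c
  have h3 : G.h y (G.pairField ψ χ y) c = pairForm ψ χ y c := G.sharp_spec y hy _ c
  have h4 : W y (G.pairField ψ χ y) = pairForm ψ χ y (G.sharp y (W y)) :=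
    apply_sharp_comm hy _ _
  simp only [defect, nabla, h3, h4] at h2
  rw [G.Γ_symm y hy] at h2
  simp only [lieForm, add_apply, ContinuousLinearMap.comp_apply]
  linear_combination h1 + h2

theorem normSq_ne_zero (hy : y ∈ G.Ω) (h : W y ≠ 0) : G.normSq W y ≠ 0 := by
  rw [normSq, ← G.sharp_spec y hy]
  refine (G.pos y hy _ fun h0 => h ?_).ne'
  ext c
  rw [← G.sharp_spec y hy (W y) c, h0]
  simp

/-- This is a linear homogeneous equation for $\|\mathbf W\|^2+4\kappa$, so a zero of that function
propagates to a neighbourhood. -/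
theorem fderiv_normSq_of_defect (hy : y ∈ G.Ω) (hW : ContDiffAt ℝ ∞ W y)
    (hS : ∀ a b, G.defect κ W y a b = 0) :
    HasFDerivAt (G.normSq W) ((G.normSq W y + 4 * κ) • W y) y := by
  obtain ⟨N, hN, hN'⟩ := G.hasFDerivAt_normSq hy hW
  have : N = (G.normSq W y + 4 * κ) • W y := by
    ext a
    have h1 := hS a (G.sharp y (W y))
    rw [defect, G.symm y hy, G.sharp_spec y hy] at h1
    simp only [hN', smul_apply, smul_eq_mul, normSq]
    linear_combination 2 * h1
  rwa [← this]

/-- A Killing field preserving `W` annihilates `W` where `‖W‖² + 4 κ ≠ 0`. -/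
theorem apply_eq_zero_of_lieForm_eq_zero (hy : y ∈ G.Ω) (hS : ∀ a b, G.defect κ W y a b = 0)
    (hN : G.normSq W y + 4 * κ ≠ 0) {ξ : E → E} (hξ : G.IsKillingAt ξ y)
    (hL : lieForm W ξ y = 0) : W y (ξ y) = 0 := by
  have h1 := hξ.killing (G.sharp y (W y)) (G.sharp y (W y))
  have h2 := DFunLike.congr_fun hL (G.sharp y (W y))
  have h3 := hS (ξ y) (G.sharp y (W y))
  rw [G.compat y hy, G.symm y hy (G.Γ _ _ _), G.symm y hy (fderiv ℝ ξ _ _),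
    G.sharp_spec y hy, G.sharp_spec y hy] at h1
  rw [defect, G.symm y hy, G.sharp_spec y hy] at h3
  simp only [lieForm, add_apply, ContinuousLinearMap.comp_apply, zero_apply, nabla] at h2 h3
  -- The left side is the derivative of $\|\mathbf W\|^2$ along `ξ`, which is zero because `ξ`
  -- preserves both the metric and `W`.
  have : (G.normSq W y + 4 * κ) * W y (ξ y) = 0 := by
    rw [normSq]
    linear_combination 2 * h2 - 2 * h3 - h1
  exact (mul_eq_zero.1 this).resolve_left hN

/-- Each such field is annihilated by `W`, so if they span, `W` vanishes at `y` and `κ ≠ 0`. There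
$\mathcal L_\xi\mathbf W$ reduces to $\nabla_\xi\mathbf W=2\kappa\,\mathbf h(\xi,\cdot)$, and every
field vanishes at `y`. In positive dimension this excludes left-invariance. -/
theorem subsingleton_of_lieForm_eq_zero (hy : y ∈ G.Ω) (hS : ∀ a b, G.defect κ W y a b = 0)
    (hN : G.normSq W y + 4 * κ ≠ 0) {ι : Type*} (ξ : ι → E → E)
    (hξ : ∀ i, G.IsKillingAt (ξ i) y) (hL : ∀ i, lieForm W (ξ i) y = 0)
    (hspan : Submodule.span ℝ (Set.range fun i => ξ i y) = ⊤) : Subsingleton E := by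
  have hWy : W y = 0 := by
    have h1 : Submodule.span ℝ (Set.range fun i => ξ i y) ≤ LinearMap.ker (W y).toLinearMap := by
      rw [Submodule.span_le]
      rintro _ ⟨i, rfl⟩
      exact apply_eq_zero_of_lieForm_eq_zero hy hS hN (hξ i) (hL i)
    rw [hspan] at h1
    ext a
    exact h1 (Submodule.mem_top (x := a))
  have hκ : κ ≠ 0 := by
    rintro rfl
    simp [normSq, hWy] at hN
  have h0 : ∀ i, ξ i y = 0 := by
    intro i
    by_contra hne
    have h1 := G.pos y hy _ hne
    have h2 := hS (ξ i y) (ξ i y)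
    have h3 := DFunLike.congr_fun (hL i) (ξ i y)
    simp only [lieForm, hWy, defect, nabla, add_apply, ContinuousLinearMap.comp_apply, zero_apply]
      at h2 h3
    have h4 : κ * G.h y (ξ i y) (ξ i y) = 0 := by linear_combination (h3 - h2) / 2
    exact (mul_ne_zero hκ h1.ne') h4
  have h5 : (⊤ : Submodule ℝ E) = ⊥ := by
    rw [← hspan, Submodule.span_eq_bot]
    rintro _ ⟨i, rfl⟩
    exact h0 i
  exact (Submodule.subsingleton_iff ℝ).1 (subsingleton_of_bot_eq_top h5.symm)

-- Uniqueness for a linear homogeneous system: the derivative of `θ` is bounded by a continuous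
-- function times `‖θ‖`.
set_option synthInstance.maxHeartbeats 200000 in
theorem eventually_eq_zero_of_fderiv_apply {θ : E → E →L[ℝ] ℝ} (hy : y ∈ G.Ω)
    (hW : ContinuousAt W y) (hθ : ∀ᶠ z in 𝓝 y, DifferentiableAt ℝ θ z) {r t : ℝ}
    (h : ∀ᶠ z in 𝓝 y, ∀ a b, G.nabla θ z a b = r * (θ z a * W z b) + t * (θ z b * W z a))
    (h0 : θ y = 0) : ∀ᶠ z in 𝓝 y, θ z = 0 := by
  have hΓ : ContinuousAt (fun z => ‖G.Γ z‖) y :=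
    ContinuousAt.norm (E := E →L[ℝ] E →L[ℝ] E) (G.smooth_Γ y hy).continuousAt
  refine eventually_eq_zero_of_norm_fderiv_le
    (g := fun z => (|r| + |t|) * ‖W z‖ + ‖G.Γ z‖) ?_ ?_ h0
  · exact (continuousAt_const.mul hW.norm).add hΓ
  · filter_upwards [hθ, h] with z h1 h2
    refine ⟨h1, ContinuousLinearMap.opNorm_le_bound₂ _ (by positivity) fun a b => ?_⟩
    have h3 : fderiv ℝ θ z a b
        = r * (θ z a * W z b) + t * (θ z b * W z a) + θ z (G.Γ z a b) := by
      rw [← h2 a b, nabla]; ring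
    have ha : ‖θ z a * W z b‖ ≤ ‖W z‖ * ‖θ z‖ * ‖a‖ * ‖b‖ := by
      rw [norm_mul]
      calc ‖θ z a‖ * ‖W z b‖ ≤ (‖θ z‖ * ‖a‖) * (‖W z‖ * ‖b‖) := by
            gcongr <;> exact ContinuousLinearMap.le_opNorm _ _
        _ = _ := by ring
    have hb : ‖θ z b * W z a‖ ≤ ‖W z‖ * ‖θ z‖ * ‖a‖ * ‖b‖ := by
      rw [norm_mul]
      calc ‖θ z b‖ * ‖W z a‖ ≤ (‖θ z‖ * ‖b‖) * (‖W z‖ * ‖a‖) := by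
            gcongr <;> exact ContinuousLinearMap.le_opNorm _ _
        _ = _ := by ring
    have hc : ‖θ z (G.Γ z a b)‖ ≤ ‖θ z‖ * (‖G.Γ z‖ * ‖a‖ * ‖b‖) :=
      (ContinuousLinearMap.le_opNorm _ _).trans
        (by gcongr; exact ContinuousLinearMap.le_opNorm₂ _ _ _)
    rw [h3]
    calc ‖r * (θ z a * W z b) + t * (θ z b * W z a) + θ z (G.Γ z a b)‖
        ≤ ‖r * (θ z a * W z b)‖ + ‖t * (θ z b * W z a)‖ + ‖θ z (G.Γ z a b)‖ := norm_add₃_le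
      _ ≤ |r| * (‖W z‖ * ‖θ z‖ * ‖a‖ * ‖b‖) + |t| * (‖W z‖ * ‖θ z‖ * ‖a‖ * ‖b‖)
          + ‖θ z‖ * (‖G.Γ z‖ * ‖a‖ * ‖b‖) := by
        rw [norm_mul r, norm_mul t, Real.norm_eq_abs r, Real.norm_eq_abs t]
        gcongr
      _ = _ := by ring

/-- If all symmetries through `y` have `dρ = 0` at `y`, they preserve `W`. -/
theorem exists_killing_of_fderiv_eq_zero {H : E → ℝ} (hy : y ∈ G.Ω) (hW : ContinuousAt W y)
    {Y v : E → E} {ρ : E → ℝ} (hs : ∀ᶠ z in 𝓝 y, KundtSymmetry G W H Y v ρ z)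
    (hρ : fderiv ℝ ρ y = 0) : ∀ᶠ z in 𝓝 y, G.IsKillingAt Y z ∧ lieForm W Y z = 0 := by
  have h1 : ∀ᶠ z in 𝓝 y, fderiv ℝ ρ z = 0 := by
    refine eventually_eq_zero_of_fderiv_apply (r := 1 / 2) (t := 1 / 2) hy hW
      (hs.mono fun z hz => hz.smooth_ρ.fderiv_infty.diff) ?_ hρ
    filter_upwards [KundtSymmetry.eventually_nabla_fderiv hy hs] with z hz a b
    rw [hz]
    ring
  filter_upwards [hs, h1] with z h2 h3
  refine ⟨⟨h2.smooth_Y, h2.killing⟩, ?_⟩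
  ext c
  have := h2.lieW c
  rw [h3] at this
  simpa [lieForm] using this

end

section

variable {E : Type*} [NormedAddCommGroup E] [NormedSpace ℝ E] [FiniteDimensional ℝ E]
  {G : LocalMetric E} {y : E} {κ : ℝ} {W : E → E →L[ℝ] ℝ} {H : E → ℝ}

/-- If `∇W = W ⊗ W / 2 + 2 κ h` and `‖W‖² + 4 κ ≠ 0`, the Lie derivatives of `W` along Killing
fields span the cotangent space. -/
theorem eq_top_of_lieForm_mem (hκ : G.HasCurvature κ) (hy : y ∈ G.Ω)
    (hS : ∀ a b, G.defect κ W y a b = 0) (hN : G.normSq W y + 4 * κ ≠ 0)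
    (S : Submodule ℝ (E →L[ℝ] ℝ))
    (hmem : ∀ ξ : E → E, (∀ᶠ z in 𝓝 y, G.IsKillingAt ξ z) → lieForm W ξ y ∈ S) : S = ⊤ := by
  have key : ∀ ψ χ : E → ℝ, (∀ᶠ z in 𝓝 y, G.HessEq κ ψ z) → (∀ᶠ z in 𝓝 y, G.HessEq κ χ z) →
      lieForm W (G.pairField ψ χ) y ∈ S := by
    intro ψ χ hψ hχ
    apply hmem
    filter_upwards [hψ, hχ, G.eventually_mem hy] with z h1 h2 h3
    exact isKillingAt_pairField h3 h1 h2
  -- The field from `ψ₁` and a function with value `0` and differential `α` is dual to `α` at `y`: a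
  -- transvection. Pairing it with `χ₁` yields a nonzero multiple of `W`.
  obtain ⟨ψ₁, h1, h1', hψ₁⟩ := G.exists_hessEq hκ hy 1 0
  obtain ⟨χ₁, h2, h2', hχ₁⟩ := G.exists_hessEq hκ hy 0 (W y)
  rw [eq_top_iff]
  rintro α -
  by_cases hWy : W y = 0
  · have hκ0 : 2 * κ ≠ 0 := by
      intro h
      apply hN
      rw [normSq, hWy, zero_apply]
      linear_combination 2 * h
    obtain ⟨χ, h3, h3', hχ⟩ := G.exists_hessEq hκ hy 0 α
    have h4 := key ψ₁ χ hψ₁ hχ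
    have h5 : lieForm W (G.pairField ψ₁ χ) y = (2 * κ) • α := by
      ext c
      rw [lieForm_pairField hy hS hψ₁.self_of_nhds hχ.self_of_nhds]
      simp [pairForm, h1, h1', h3, h3', hWy]
    rw [h5] at h4
    exact (S.smul_mem_iff hκ0).1 h4
  · have hWS : W y ∈ S := by
      have h4 := key ψ₁ χ₁ hψ₁ hχ₁
      have h5 : lieForm W (G.pairField ψ₁ χ₁) y = ((G.normSq W y + 4 * κ) / 2) • W y := by
        ext c
        rw [lieForm_pairField hy hS hψ₁.self_of_nhds hχ₁.self_of_nhds]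
        simp only [pairForm, h1, h1', h2, h2', normSq, one_smul, smul_zero, sub_zero, zero_apply,
          smul_apply, smul_eq_mul]
        ring
      rw [h5] at h4
      exact (S.smul_mem_iff (div_ne_zero hN two_ne_zero)).1 h4
    -- Both functions now vanish at `y`, so the field is a rotation about `y`; it moves `W` to a
    -- multiple of `α` modulo `W`.
    obtain ⟨ψ, h3, h3', hψ⟩ := G.exists_hessEq hκ hy 0 α
    have h4 := key ψ χ₁ hψ hχ₁
    have h5 : lieForm W (G.pairField ψ χ₁) y
        = G.normSq W y • α - α (G.sharp y (W y)) • W y := by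
      ext c
      rw [lieForm_pairField hy hS hψ.self_of_nhds hχ₁.self_of_nhds]
      simp only [pairForm, h3, h3', h2, h2', normSq, zero_smul, sub_zero, zero_apply,
        smul_apply, smul_eq_mul, sub_apply]
      ring
    rw [h5, S.sub_mem_iff_left (S.smul_mem _ hWS)] at h4
    exact (S.smul_mem_iff (normSq_ne_zero hy hWy)).1 h4

/-- If `∇W = W ⊗ W / 2 + 2 κ h` and `‖W‖² + 4 κ = 0` at a point, then `W` is preserved by Killing
fields in all directions. -/
theorem exists_killing_of_normSq_eq (hκ : G.HasCurvature κ) (hy : y ∈ G.Ω)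
    (hW : ∀ z ∈ G.Ω, ContDiffAt ℝ ∞ W z) (hS : ∀ᶠ z in 𝓝 y, ∀ a b, G.defect κ W z a b = 0)
    (hN : G.normSq W y + 4 * κ = 0) (a : E) :
    ∃ ξ : E → E, ξ y = a ∧ ∀ᶠ z in 𝓝 y, G.IsKillingAt ξ z ∧ lieForm W ξ z = 0 := by
  have hNz : ∀ᶠ z in 𝓝 y, G.normSq W z + 4 * κ = 0 := by
    refine eventually_eq_zero_of_norm_fderiv_le (g := fun z => ‖W z‖)
      (hW y hy).continuousAt.norm ?_ hN
    filter_upwards [hS, G.eventually_mem hy] with z h1 h2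
    have h3 := (fderiv_normSq_of_defect h2 (hW z h2) h1).add_const (4 * κ)
    refine ⟨h3.differentiableAt, ?_⟩
    rw [h3.fderiv, norm_smul, mul_comm]
  -- The initial data make $\theta=d\psi+\frac12\psi\mathbf W$ vanish at `y`. Since
  -- $\nabla_b\theta(c)=\frac12\theta(b)\mathbf W(c)$, it vanishes nearby.
  obtain ⟨ψ, h1, h1', hψ⟩ := G.exists_hessEq hκ hy 1 (-(1 / 2 : ℝ) • W y)
  obtain ⟨χ, h2, h2', hχ⟩ := G.exists_hessEq hκ hy 0 (G.h y a)
  have hθ : ∀ᶠ z in 𝓝 y, fderiv ℝ ψ z + (1 / 2 * ψ z) • W z = 0 := by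
    refine eventually_eq_zero_of_fderiv_apply (r := 1 / 2) (t := 0)
      (θ := fun z => fderiv ℝ ψ z + (1 / 2 * ψ z) • W z) hy (hW y hy).continuousAt ?_ ?_ ?_
    · filter_upwards [hψ, G.eventually_mem hy] with z h3 h4
      exact h3.smooth.fderiv_infty.diff.add ((h3.smooth.diff.const_mul _).smul (hW z h4).diff)
    · filter_upwards [hψ, G.eventually_mem hy, hS] with z h3 h4 h5 b c
      have h6 := h3.smooth.fderiv_infty.diff.hasFDerivAt.add
        ((h3.smooth.diff.hasFDerivAt.const_mul (1 / 2)).smul (hW z h4).diff.hasFDerivAt)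
      have h7 : fderiv ℝ (fun z => fderiv ℝ ψ z + (1 / 2 * ψ z) • W z) z = _ := h6.fderiv
      have h8 := h3.hess b c
      have h9 := h5 b c
      simp only [defect, nabla] at h8 h9 ⊢
      rw [h7]
      simp only [add_apply, smul_apply, ContinuousLinearMap.smulRight_apply, smul_eq_mul]
      linear_combination h8 + 1 / 2 * ψ z * h9
    · simp only [h1, h1']
      ext c
      simp
  refine ⟨G.pairField ψ χ, ?_, ?_⟩
  · rw [pairField, pairForm, h1, h2, h2', one_smul, zero_smul, sub_zero, sharp_h hy]
  · filter_upwards [hψ, hχ, hθ, hNz, hS, G.eventually_mem hy] with z h3 h4 h5 h6 h7 h8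
    refine ⟨isKillingAt_pairField h8 h3 h4, ?_⟩
    ext c
    have h9 : ∀ c, fderiv ℝ ψ z c = -(1 / 2 * ψ z * W z c) := fun c => by
      have := DFunLike.congr_fun h5 c
      simp only [add_apply, smul_apply, smul_eq_mul, zero_apply] at this
      linear_combination this
    -- With $d\psi=-\frac12\psi\mathbf W$ the Lie derivative is a one-form multiplied by $\|\mathbf
    -- W\|^2+4\kappa$.
    rw [lieForm_pairField h8 h7 h3 h4]
    simp only [pairForm, sub_apply, smul_apply, smul_eq_mul, h9, zero_apply]
    rw [normSq] at h6
    linear_combination (1 / 4 * χ z * ψ z * W z c + 1 / 2 * ψ z * fderiv ℝ χ z c) * h6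

/-- Near a point, either `W` is preserved by Killing fields in all directions, or
`∇W = W ⊗ W / 2 + 2 κ' h` with `‖W‖² + 4 κ' ≠ 0`. -/
theorem dichotomy (hκ : G.HasCurvature κ)
    (hW : ∀ z ∈ G.Ω, ContDiffAt ℝ ∞ W z) (hH : ∀ z ∈ G.Ω, ContDiffAt ℝ ∞ H z)
    (hsym : HasSymmetries G W H)
    (hflat : 2 ≤ finrank ℝ E → κ = 0 → ∀ z ∈ G.Ω, H z = G.normSq W z / 8) (hy : y ∈ G.Ω) :
    (∀ a : E, ∃ ξ : E → E, ξ y = a ∧ ∀ᶠ z in 𝓝 y, G.IsKillingAt ξ z ∧ lieForm W ξ z = 0) ∨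
    ∃ κ' : ℝ, G.HasCurvature κ' ∧
      ∀ᶠ z in 𝓝 y, (∀ a b, G.defect κ' W z a b = 0) ∧ G.normSq W z + 4 * κ' ≠ 0 := by
  by_cases hex : ∃ Y v ρ, (∀ᶠ z in 𝓝 y, KundtSymmetry G W H Y v ρ z) ∧ fderiv ℝ ρ y ≠ 0
  · obtain ⟨Y, v, ρ, hs, hρ⟩ := hex
    obtain ⟨κ', hκ', hS⟩ := exists_eventually_defect_eq_zero hκ hW hH hsym hflat hy hs hρ
    by_cases hN : G.normSq W y + 4 * κ' = 0
    · exact Or.inl (exists_killing_of_normSq_eq hκ' hy hW hS hN)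
    · refine Or.inr ⟨κ', hκ', hS.and ?_⟩
      have hc : ContinuousAt (fun z => G.normSq W z + 4 * κ') y :=
        (fderiv_normSq_of_defect hy (hW y hy) hS.self_of_nhds).continuousAt.add
          continuousAt_const
      exact hc.eventually_ne hN
  · push Not at hex
    refine Or.inl fun a => ?_
    obtain ⟨Y, v, ρ, ha, hs⟩ := hsym y hy a
    exact ⟨Y, ha, exists_killing_of_fderiv_eq_zero hy (hW y hy).continuousAt hs
      (hex Y v ρ hs)⟩

end

end LocalMetric

end Kundt

/-! ### Transport of vector fields, brackets and tensors between a manifold and coordinates. -/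

namespace Kundt

/-- A local parametrization of a manifold by an open subset of its model vector space. -/
structure LocalParam {E : Type*} [NormedAddCommGroup E] [NormedSpace ℝ E]
    {H : Type*} [TopologicalSpace H] (I : ModelWithCorners ℝ E H)
    (M : Type*) [TopologicalSpace M] [ChartedSpace H M] where
  /-- the parametrization -/
  f : E → M
  /-- the coordinates -/
  g : M → E
  /-- the domain of the parametrization -/
  U : Set E
  /-- the domain of the coordinates -/
  V : Set M
  isOpen_U : IsOpen U
  isOpen_V : IsOpen V
  maps_f : ∀ y ∈ U, f y ∈ V
  maps_g : ∀ x ∈ V, g x ∈ U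
  left_inv : ∀ y ∈ U, g (f y) = y
  right_inv : ∀ x ∈ V, f (g x) = x
  smooth_f : ∀ y ∈ U, ContMDiffAt 𝓘(ℝ, E) I ∞ f y
  smooth_g : ∀ x ∈ V, ContMDiffAt I 𝓘(ℝ, E) ∞ g x

theorem mlieBracket_vectorSpace {E : Type*} [NormedAddCommGroup E] [NormedSpace ℝ E]
    (X Y : Π y : E, TangentSpace 𝓘(ℝ, E) y) (y : E) :
    mlieBracket 𝓘(ℝ, E) X Y y = lieBracket ℝ X Y y := by
  rw [← mlieBracketWithin_univ, mlieBracketWithin_eq_lieBracketWithin]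
  exact congrFun (lieBracketWithin_univ (𝕜 := ℝ) (V := X) (W := Y)) y

namespace LocalParam

variable {E : Type*} [NormedAddCommGroup E] [NormedSpace ℝ E]
  {H : Type*} [TopologicalSpace H] {I : ModelWithCorners ℝ E H}
  {M : Type*} [TopologicalSpace M] [ChartedSpace H M]
  (P : LocalParam I M) {y : E}

/-- The differential of the parametrization. -/
def d (y : E) : E →L[ℝ] TangentSpace I (P.f y) := mfderiv 𝓘(ℝ, E) I P.f y

/-- The differential of the coordinates. -/
def dinv (x : M) : TangentSpace I x →L[ℝ] E := mfderiv I 𝓘(ℝ, E) P.g x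

theorem mdiff_f (hy : y ∈ P.U) : MDifferentiableAt 𝓘(ℝ, E) I P.f y :=
  (P.smooth_f y hy).mdifferentiableAt (by simp)

theorem mdiff_g {x : M} (hx : x ∈ P.V) : MDifferentiableAt I 𝓘(ℝ, E) P.g x :=
  (P.smooth_g x hx).mdifferentiableAt (by simp)

theorem eventually_mem_U (hy : y ∈ P.U) : ∀ᶠ z in 𝓝 y, z ∈ P.U := P.isOpen_U.mem_nhds hy

theorem eventually_mem_V {x : M} (hx : x ∈ P.V) : ∀ᶠ z in 𝓝 x, z ∈ P.V := P.isOpen_V.mem_nhds hx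

theorem tendsto_f (hy : y ∈ P.U) : Tendsto P.f (𝓝 y) (𝓝 (P.f y)) :=
  (P.smooth_f y hy).continuousAt

theorem tendsto_g (hy : y ∈ P.U) : Tendsto P.g (𝓝 (P.f y)) (𝓝 y) := by
  have := (P.smooth_g _ (P.maps_f y hy)).continuousAt
  rwa [ContinuousAt, P.left_inv y hy] at this

theorem dinv_comp_d (hy : y ∈ P.U) :
    (P.dinv (P.f y)).comp (P.d y) = ContinuousLinearMap.id ℝ E := by
  have h1 := mfderiv_comp y (P.mdiff_g (P.maps_f y hy)) (P.mdiff_f hy)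
  have h2 : P.g ∘ P.f =ᶠ[𝓝 y] id := (P.eventually_mem_U hy).mono fun z hz => P.left_inv z hz
  rw [h2.mfderiv_eq, mfderiv_id] at h1
  exact h1.symm

theorem d_comp_dinv (hy : y ∈ P.U) :
    (P.d y).comp (P.dinv (P.f y)) = ContinuousLinearMap.id ℝ (TangentSpace I (P.f y)) := by
  have h0 := P.left_inv y hy
  have hf : MDifferentiableAt 𝓘(ℝ, E) I P.f (P.g (P.f y)) := by rw [h0]; exact P.mdiff_f hy
  have h1 := mfderiv_comp (P.f y) hf (P.mdiff_g (P.maps_f y hy))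
  have h2 : P.f ∘ P.g =ᶠ[𝓝 (P.f y)] id :=
    (P.eventually_mem_V (P.maps_f y hy)).mono fun z hz => P.right_inv z hz
  rw [h2.mfderiv_eq, mfderiv_id] at h1
  have h3 : (mfderiv 𝓘(ℝ, E) I P.f (P.g (P.f y)) : E →L[ℝ] E) = (mfderiv 𝓘(ℝ, E) I P.f y :) := by
    rw [h0]
  exact ((congrArg (fun L : E →L[ℝ] E => L.comp (P.dinv (P.f y) : E →L[ℝ] E)) h3).symm.trans
    h1.symm)

@[simp] theorem dinv_d (hy : y ∈ P.U) (a : E) : P.dinv (P.f y) (P.d y a) = a :=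
  DFunLike.congr_fun (P.dinv_comp_d hy) a

@[simp] theorem d_dinv (hy : y ∈ P.U) (a : TangentSpace I (P.f y)) :
    P.d y (P.dinv (P.f y) a) = a :=
  DFunLike.congr_fun (P.d_comp_dinv hy) a

/-- The expression of a vector field in coordinates. -/
def pull (X : Π x : M, TangentSpace I x) (y : E) : E := mpullback 𝓘(ℝ, E) I P.f X y

/-- The vector field with a given coordinate expression. -/
def push (u : E → E) : Π x : M, TangentSpace I x := mpullback I 𝓘(ℝ, E) P.g u

theorem inverse_d (hy : y ∈ P.U) : (P.d y).inverse = P.dinv (P.f y) :=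
  ContinuousLinearMap.inverse_eq (P.d_comp_dinv hy) (P.dinv_comp_d hy)

theorem inverse_dinv (hy : y ∈ P.U) : (P.dinv (P.f y)).inverse = P.d y :=
  ContinuousLinearMap.inverse_eq (P.dinv_comp_d hy) (P.d_comp_dinv hy)

theorem pull_apply (hy : y ∈ P.U) (X : Π x : M, TangentSpace I x) :
    P.pull X y = P.dinv (P.f y) (X (P.f y)) := by
  rw [← P.inverse_d hy]
  rfl

theorem push_apply (hy : y ∈ P.U) (u : E → E) : P.push u (P.f y) = P.d y (u y) := by
  rw [← P.inverse_dinv hy]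
  have : P.push u (P.f y) = (P.dinv (P.f y)).inverse (u (P.g (P.f y))) := rfl
  rw [this, P.left_inv y hy]

theorem d_pull (hy : y ∈ P.U) (X : Π x : M, TangentSpace I x) :
    P.d y (P.pull X y) = X (P.f y) := by
  rw [P.pull_apply hy, P.d_dinv hy]

theorem pull_push (hy : y ∈ P.U) (u : E → E) : P.pull (P.push u) y = u y := by
  rw [P.pull_apply hy, P.push_apply hy, P.dinv_d hy]

theorem eventually_pull_push (hy : y ∈ P.U) (u : E → E) : P.pull (P.push u) =ᶠ[𝓝 y] u :=
  (P.eventually_mem_U hy).mono fun _ hz => P.pull_push hz u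

/-- The derivative of a function in coordinates. -/
theorem mvfderiv_d (hy : y ∈ P.U) (F : M → ℝ) (a : E) :
    mvfderiv I F (P.f y) (P.d y a) = fderiv ℝ (fun z => F (P.f z)) y a := by
  by_cases hF : MDifferentiableAt I 𝓘(ℝ, ℝ) F (P.f y)
  · have h1 := mfderiv_comp y hF (P.mdiff_f hy)
    rw [mfderiv_eq_fderiv] at h1
    exact (DFunLike.congr_fun h1 a).symm
  · have hF' : ¬ DifferentiableAt ℝ (fun z => F (P.f z)) y := by
      intro h
      apply hF
      have h1 : MDifferentiableAt 𝓘(ℝ, E) 𝓘(ℝ, ℝ) (fun z => F (P.f z)) (P.g (P.f y)) := by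
        rw [P.left_inv y hy]
        exact h.mdifferentiableAt
      have h2 := h1.comp (P.f y) (P.mdiff_g (P.maps_f y hy))
      refine h2.congr_of_eventuallyEq ?_
      filter_upwards [P.eventually_mem_V (P.maps_f y hy)] with x hx
      simp [P.right_inv x hx]
    rw [fderiv_zero_of_not_differentiableAt hF']
    have : mvfderiv I F (P.f y) = (mfderiv I 𝓘(ℝ, ℝ) F (P.f y) :) := rfl
    rw [this, mfderiv_zero_of_not_mdifferentiableAt hF]
    rfl

theorem isInvertible_d (hy : y ∈ P.U) : (mfderiv 𝓘(ℝ, E) I P.f y).IsInvertible :=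
  ContinuousLinearMap.IsInvertible.of_inverse (P.d_comp_dinv hy) (P.dinv_comp_d hy)

theorem isInvertible_dinv (hy : y ∈ P.U) : (mfderiv I 𝓘(ℝ, E) P.g (P.f y)).IsInvertible :=
  ContinuousLinearMap.IsInvertible.of_inverse (P.dinv_comp_d hy) (P.d_comp_dinv hy)

theorem eventually_push_pull (hy : y ∈ P.U) (X : Π x : M, TangentSpace I x) :
    ∀ᶠ x in 𝓝 (P.f y), P.push (P.pull X) x = X x := by
  filter_upwards [P.eventually_mem_V (P.maps_f y hy)] with x hx
  have h1 := P.push_apply (P.maps_g x hx) (P.pull X)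
  rw [P.d_pull (P.maps_g x hx)] at h1
  rwa [P.right_inv x hx] at h1

/-- The coordinate expression of a covariant 2-tensor. -/
def pullForm (g : Π x : M, TangentSpace I x → TangentSpace I x → ℝ) (z a b : E) : ℝ :=
  g (P.f z) (P.d z a) (P.d z b)

/-- The coordinate expression of a one-form. -/
def pullOneForm (α : Π x : M, TangentSpace I x →L[ℝ] ℝ) (z : E) : E →L[ℝ] ℝ :=
  (α (P.f z)).comp (P.d z)

theorem eventually_nhds_f {p : M → Prop} (hy : y ∈ P.U) :
    (∀ᶠ x in 𝓝 (P.f y), p x) ↔ ∀ᶠ z in 𝓝 y, p (P.f z) := by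
  refine ⟨fun h => (P.tendsto_f hy).eventually h, fun h => ?_⟩
  filter_upwards [(P.tendsto_g hy).eventually h, P.eventually_mem_V (P.maps_f y hy)] with x h1 h2
  rwa [P.right_inv x h2] at h1

variable [CompleteSpace E] [IsManifold I ∞ M]

theorem contDiffAt_pull (hy : y ∈ P.U) {X : Π x : M, TangentSpace I x}
    (hX : SmoothVFAt I X (P.f y)) : ContDiffAt ℝ ∞ (P.pull X) y := by
  apply contMDiffAt_vectorSpace_iff_contDiffAt.1
  exact ContMDiffAt.mpullback_vectorField_preimage (n := ∞) hX (P.smooth_f y hy)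
    (P.isInvertible_d hy) (by simp)

theorem smoothVFAt_push (hy : y ∈ P.U) {u : E → E} (hu : ContDiffAt ℝ ∞ u y) :
    SmoothVFAt I (P.push u) (P.f y) := by
  rw [← P.left_inv y hy] at hu
  exact ContMDiffAt.mpullback_vectorField_preimage (n := ∞)
    (contMDiffAt_vectorSpace_iff_contDiffAt.2 hu) (P.smooth_g _ (P.maps_f y hy))
    (P.isInvertible_dinv hy) (by simp)

theorem pull_mlieBracket (hy : y ∈ P.U) {X Y : Π x : M, TangentSpace I x}
    (hX : SmoothVFAt I X (P.f y)) (hY : SmoothVFAt I Y (P.f y)) :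
    P.dinv (P.f y) (mlieBracket I X Y (P.f y))
      = fderiv ℝ (P.pull Y) y (P.pull X y) - fderiv ℝ (P.pull X) y (P.pull Y y) := by
  have h3 : (3 : WithTop ℕ∞) ≤ ∞ := (mod_cast le_top : ((3 : ℕ∞) : WithTop ℕ∞) ≤ ∞)
  have h2 : (2 : WithTop ℕ∞) ≤ ∞ := (mod_cast le_top : ((2 : ℕ∞) : WithTop ℕ∞) ≤ ∞)
  have : IsManifold I (minSmoothness ℝ 3) M := IsManifold.of_le (n := ∞)
    (by rwa [minSmoothness_of_isRCLikeNormedField])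
  have h1 := mpullback_mlieBracket (n := ∞) (hX.mdifferentiableAt (by simp))
    (hY.mdifferentiableAt (by simp)) (P.smooth_f y hy)
    (by rwa [minSmoothness_of_isRCLikeNormedField])
  rw [← P.pull_apply hy]
  exact h1.trans (mlieBracket_vectorSpace _ _ _)

theorem mlieBracket_f (hy : y ∈ P.U) {X Y : Π x : M, TangentSpace I x}
    (hX : SmoothVFAt I X (P.f y)) (hY : SmoothVFAt I Y (P.f y)) :
    mlieBracket I X Y (P.f y)
      = P.d y (fderiv ℝ (P.pull Y) y (P.pull X y) - fderiv ℝ (P.pull X) y (P.pull Y y)) := by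
  rw [← P.pull_mlieBracket hy hX hY, P.d_dinv hy]

theorem smoothVFAt_iff (hy : y ∈ P.U) {X : Π x : M, TangentSpace I x} :
    SmoothVFAt I X (P.f y) ↔ ContDiffAt ℝ ∞ (P.pull X) y := by
  refine ⟨P.contDiffAt_pull hy, fun h => ?_⟩
  have h1 := P.smoothVFAt_push hy h
  refine ContMDiffAt.congr_of_eventuallyEq h1 ?_
  filter_upwards [P.eventually_push_pull hy X] with x hx
  rw [hx]

/-- `push` and `pull` are inverse to each other on germs, preserve smoothness and respect brackets,
so testing on vector fields of the manifold and on vector-valued functions is the same. -/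
theorem isKillingNear_iff (hy : y ∈ P.U)
    {g : Π x : M, TangentSpace I x → TangentSpace I x → ℝ} {ξ : Π x : M, TangentSpace I x} :
    IsKillingNear I g ξ (P.f y) ↔ ∀ᶠ z in 𝓝 y, ContDiffAt ℝ ∞ (P.pull ξ) z ∧
      ∀ u v : E → E, ContDiffAt ℝ ∞ u z → ContDiffAt ℝ ∞ v z →
        fderiv ℝ (fun w => P.pullForm g w (u w) (v w)) z (P.pull ξ z)
          - P.pullForm g z (fderiv ℝ u z (P.pull ξ z) - fderiv ℝ (P.pull ξ) z (u z)) (v z)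
          - P.pullForm g z (u z) (fderiv ℝ v z (P.pull ξ z) - fderiv ℝ (P.pull ξ) z (v z)) = 0 := by
  rw [IsKillingNear, P.eventually_nhds_f hy]
  refine eventually_congr ?_
  filter_upwards [P.eventually_mem_U hy] with z hz
  rw [P.smoothVFAt_iff hz]
  refine and_congr_right fun hξ => ?_
  have key : ∀ X Y : Π x : M, TangentSpace I x, SmoothVFAt I X (P.f z) → SmoothVFAt I Y (P.f z) →
      mvfderiv I (fun y => g y (X y) (Y y)) (P.f z) (ξ (P.f z))
        - g (P.f z) (mlieBracket I ξ X (P.f z)) (Y (P.f z))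
        - g (P.f z) (X (P.f z)) (mlieBracket I ξ Y (P.f z)) =
      fderiv ℝ (fun w => P.pullForm g w (P.pull X w) (P.pull Y w)) z (P.pull ξ z)
          - P.pullForm g z (fderiv ℝ (P.pull X) z (P.pull ξ z)
            - fderiv ℝ (P.pull ξ) z (P.pull X z)) (P.pull Y z)
          - P.pullForm g z (P.pull X z) (fderiv ℝ (P.pull Y) z (P.pull ξ z)
            - fderiv ℝ (P.pull ξ) z (P.pull Y z)) := by
    intro X Y hX hY
    have hξ' := (P.smoothVFAt_iff hz).2 hξ
    have h1 : (fun w => P.pullForm g w (P.pull X w) (P.pull Y w))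
        =ᶠ[𝓝 z] fun w => g (P.f w) (X (P.f w)) (Y (P.f w)) := by
      filter_upwards [P.eventually_mem_U hz] with w hw
      rw [pullForm, P.d_pull hw, P.d_pull hw]
    rw [P.mlieBracket_f hz hξ' hX, P.mlieBracket_f hz hξ' hY, h1.fderiv_eq,
      ← P.mvfderiv_d hz (fun y => g y (X y) (Y y)), P.d_pull hz, pullForm, pullForm, P.d_pull hz,
      P.d_pull hz]
  constructor
  · intro h u v hu hv
    have h1 := h (P.push u) (P.push v) (P.smoothVFAt_push hz hu) (P.smoothVFAt_push hz hv)
    rw [key _ _ (P.smoothVFAt_push hz hu) (P.smoothVFAt_push hz hv)] at h1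
    have eu := P.eventually_pull_push hz u
    have ev := P.eventually_pull_push hz v
    have e3 : (fun w => P.pullForm g w (P.pull (P.push u) w) (P.pull (P.push v) w))
        =ᶠ[𝓝 z] fun w => P.pullForm g w (u w) (v w) := by
      filter_upwards [eu, ev] with w h1 h2
      rw [h1, h2]
    rwa [e3.fderiv_eq, eu.fderiv_eq, ev.fderiv_eq, eu.self_of_nhds, ev.self_of_nhds] at h1
  · intro h X Y hX hY
    rw [key X Y hX hY]
    exact h _ _ (P.contDiffAt_pull hz hX) (P.contDiffAt_pull hz hY)

theorem isLieDerivNear_iff (hy : y ∈ P.U) {ξ : Π x : M, TangentSpace I x}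
    {α β : Π x : M, TangentSpace I x →L[ℝ] ℝ} (hξ : ∀ᶠ z in 𝓝 y, ContDiffAt ℝ ∞ (P.pull ξ) z)
    (hα : ∀ᶠ z in 𝓝 y, DifferentiableAt ℝ (P.pullOneForm α) z) :
    IsLieDerivNear I ξ α β (P.f y) ↔
      ∀ᶠ z in 𝓝 y, P.pullOneForm β z = lieForm (P.pullOneForm α) (P.pull ξ) z := by
  rw [IsLieDerivNear, P.eventually_nhds_f hy]
  refine eventually_congr ?_
  filter_upwards [P.eventually_mem_U hy, hξ, hα] with z hz hξ hα
  have key : ∀ X : Π x : M, TangentSpace I x, SmoothVFAt I X (P.f z) →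
      mvfderiv I (fun y => α y (X y)) (P.f z) (ξ (P.f z))
        - α (P.f z) (mlieBracket I ξ X (P.f z)) =
      lieForm (P.pullOneForm α) (P.pull ξ) z (P.pull X z) := by
    intro X hX
    have hξ' := (P.smoothVFAt_iff hz).2 hξ
    have h1 : (fun w => α (P.f w) (X (P.f w))) =ᶠ[𝓝 z]
        fun w => P.pullOneForm α w (P.pull X w) := by
      filter_upwards [P.eventually_mem_U hz] with w hw
      rw [pullOneForm, ContinuousLinearMap.comp_apply, P.d_pull hw]
    have h2 := hasFDerivAt_apply_apply hα (P.contDiffAt_pull hz hX).diff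
    have h3 : ∀ a, α (P.f z) (P.d z a) = P.pullOneForm α z a := fun a => rfl
    rw [P.mlieBracket_f hz hξ' hX, ← P.d_pull hz ξ, P.mvfderiv_d hz (fun y => α y (X y)),
      h1.fderiv_eq, h2.fderiv, h3]
    simp [lieForm]
    ring
  constructor
  · intro h
    ext a
    have ha : ContDiffAt ℝ ∞ (fun _ : E => a) z := contDiffAt_const
    have h1 := h _ (P.smoothVFAt_push hz ha)
    rw [key _ (P.smoothVFAt_push hz ha), P.push_apply hz, P.pull_push hz] at h1
    exact h1
  · intro h X hX
    rw [key X hX, ← h, pullOneForm, ContinuousLinearMap.comp_apply, P.d_pull hz]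

end LocalParam

end Kundt

/-! ### Christoffel symbols and inverse of a smooth positive definite form. -/

namespace Kundt

section Koszul

variable {E : Type*} [NormedAddCommGroup E] [NormedSpace ℝ E]

/-- The form `c ↦ (∂_a h (b, c) + ∂_b h (a, c) - ∂_c h (a, b)) / 2`. -/
def koszulForm (T : E →L[ℝ] E →L[ℝ] E →L[ℝ] ℝ) (a b : E) : E →L[ℝ] ℝ :=
  (1 / 2 : ℝ) • (T a b + T b a - (T.flip a).flip b)

theorem koszulForm_apply (T : E →L[ℝ] E →L[ℝ] E →L[ℝ] ℝ) (a b c : E) :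
    koszulForm T a b c = 1 / 2 * (T a b c + T b a c - T c a b) := by
  simp [koszulForm]

theorem koszulForm_add_left (T : E →L[ℝ] E →L[ℝ] E →L[ℝ] ℝ) (a a' b : E) :
    koszulForm T (a + a') b = koszulForm T a b + koszulForm T a' b := by
  ext c
  rw [add_apply, koszulForm_apply, koszulForm_apply, koszulForm_apply, T.map_add, (T b).map_add,
    (T c).map_add, add_apply, add_apply, add_apply, add_apply]
  ring

theorem koszulForm_add_right (T : E →L[ℝ] E →L[ℝ] E →L[ℝ] ℝ) (a b b' : E) :
    koszulForm T a (b + b') = koszulForm T a b + koszulForm T a b' := by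
  ext c
  rw [add_apply, koszulForm_apply, koszulForm_apply, koszulForm_apply, T.map_add, (T a).map_add,
    (T c a).map_add, add_apply, add_apply, add_apply]
  ring

theorem koszulForm_smul_left (T : E →L[ℝ] E →L[ℝ] E →L[ℝ] ℝ) (r : ℝ) (a b : E) :
    koszulForm T (r • a) b = r • koszulForm T a b := by
  ext c
  rw [smul_apply, koszulForm_apply, koszulForm_apply, T.map_smul, (T b).map_smul, (T c).map_smul,
    smul_apply, smul_apply, smul_apply, smul_apply]
  simp only [smul_eq_mul]
  ring

theorem koszulForm_smul_right (T : E →L[ℝ] E →L[ℝ] E →L[ℝ] ℝ) (r : ℝ) (a b : E) :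
    koszulForm T a (r • b) = r • koszulForm T a b := by
  ext c
  rw [smul_apply, koszulForm_apply, koszulForm_apply, T.map_smul, (T a).map_smul, (T c a).map_smul,
    smul_apply, smul_apply, smul_apply]
  simp only [smul_eq_mul]
  ring

variable {Ω : Set E} {h : E → E →L[ℝ] E →L[ℝ] ℝ}

theorem fderiv_metric_symm (hΩ : IsOpen Ω) (hsm : ∀ y ∈ Ω, ContDiffAt ℝ ∞ h y)
    (hsymm : ∀ y ∈ Ω, ∀ a b, h y a b = h y b a) {y : E} (hy : y ∈ Ω) (a b c : E) :
    fderiv ℝ h y a b c = fderiv ℝ h y a c b := by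
  have h1 := hasFDerivAt_bilin_const (hsm y hy).diff b c
  have h2 := hasFDerivAt_bilin_const (hsm y hy).diff c b
  have h3 := h1.unique (h2.congr_of_eventuallyEq
    (by filter_upwards [hΩ.mem_nhds hy] with z hz using hsymm z hz b c))
  exact DFunLike.congr_fun h3 a

end Koszul

section OfMetric

variable {E F : Type*} [NormedAddCommGroup E] [NormedSpace ℝ E] [FiniteDimensional ℝ E]
  [NormedAddCommGroup F] [NormedSpace ℝ F]

theorem finrank_dual_clm : finrank ℝ (E →L[ℝ] ℝ) = finrank ℝ E := by
  rw [← Subspace.dual_finrank_eq (K := ℝ) (V := E)]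
  exact (LinearMap.toContinuousLinearMap (𝕜 := ℝ) (E := E) (F' := ℝ)).finrank_eq.symm

theorem contDiffAt_of_apply {Ω : Set E} (hΩ : IsOpen Ω) {A : E → E →L[ℝ] F}
    (h : ∀ z ∈ Ω, ∀ a, ContDiffAt ℝ ∞ (fun w => A w a) z) {y : E} (hy : y ∈ Ω) :
    ContDiffAt ℝ ∞ A y := by
  refine ContDiffOn.contDiffAt (s := Ω) ?_ (hΩ.mem_nhds hy)
  rw [contDiffOn_clm_apply]
  exact fun a x hx => (h x hx a).contDiffWithinAt

variable {Ω : Set E} {h : E → E →L[ℝ] E →L[ℝ] ℝ}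

/-- Positivity gives injectivity, and equality of dimensions surjectivity. Hence
`ContinuousLinearMap.inverse` is a true inverse here and not the default value zero. -/
theorem exists_equiv_of_pos {B : E →L[ℝ] E →L[ℝ] ℝ} (hB : ∀ a, a ≠ 0 → 0 < B a a) :
    ∃ e : E ≃L[ℝ] (E →L[ℝ] ℝ), (e : E →L[ℝ] E →L[ℝ] ℝ) = B := by
  have hinj : Function.Injective B.toLinearMap := by
    rw [← LinearMap.ker_eq_bot, LinearMap.ker_eq_bot']
    intro a ha
    by_contra hne
    have h1 := hB a hne
    have h2 : B a = 0 := ha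
    rw [h2] at h1
    exact lt_irrefl _ h1
  have hsurj := (LinearMap.injective_iff_surjective_of_finrank_eq_finrank
    (finrank_dual_clm (E := E)).symm).1 hinj
  refine ⟨(LinearEquiv.ofBijective B.toLinearMap ⟨hinj, hsurj⟩).toContinuousLinearEquiv, ?_⟩
  ext a b
  rfl

set_option synthInstance.maxHeartbeats 200000 in
/-- The Christoffel symbols of a metric. -/
def christoffel (h : E → E →L[ℝ] E →L[ℝ] ℝ) (y : E) : E →L[ℝ] E →L[ℝ] E :=
  finiteDimensionalCLM
    { toFun := fun a => finiteDimensionalCLM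
        { toFun := fun b => (h y).inverse (koszulForm (fderiv ℝ h y) a b)
          map_add' := fun b c => by rw [koszulForm_add_right, map_add]
          map_smul' := fun r b => by rw [koszulForm_smul_right, map_smul, RingHom.id_apply] }
      map_add' := fun a c => by
        ext b
        change (h y).inverse (koszulForm (fderiv ℝ h y) (a + c) b)
          = (h y).inverse (koszulForm (fderiv ℝ h y) a b)
            + (h y).inverse (koszulForm (fderiv ℝ h y) c b)
        rw [koszulForm_add_left, map_add]
      map_smul' := fun r a => by
        ext b
        change (h y).inverse (koszulForm (fderiv ℝ h y) (r • a) b)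
          = r • (h y).inverse (koszulForm (fderiv ℝ h y) a b)
        rw [koszulForm_smul_left, map_smul] }

set_option synthInstance.maxHeartbeats 200000 in
theorem christoffel_apply (y a b : E) :
    christoffel h y a b = (h y).inverse (koszulForm (fderiv ℝ h y) a b) := rfl

theorem apply_inverse_of_pos {B : E →L[ℝ] E →L[ℝ] ℝ} (hB : ∀ a, a ≠ 0 → 0 < B a a)
    (α : E →L[ℝ] ℝ) : B (B.inverse α) = α := by
  obtain ⟨e, rfl⟩ := exists_equiv_of_pos hB
  rw [ContinuousLinearMap.inverse_equiv]
  exact e.apply_symm_apply α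

theorem contDiffAt_inverse_of_pos {y : E} (hy : ∀ a, a ≠ 0 → 0 < h y a a)
    (hsm : ContDiffAt ℝ ∞ h y) : ContDiffAt ℝ ∞ (fun z => (h z).inverse) y := by
  have : CompleteSpace E := FiniteDimensional.complete ℝ E
  obtain ⟨e, he⟩ := exists_equiv_of_pos hy
  have h1 := contDiffAt_map_inverse (𝕜 := ℝ) (n := ∞) e
  rw [he] at h1
  exact h1.comp y hsm

set_option synthInstance.maxHeartbeats 200000 in
theorem contDiffAt_christoffel (hΩ : IsOpen Ω) (hsm : ∀ y ∈ Ω, ContDiffAt ℝ ∞ h y)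
    (hpos : ∀ y ∈ Ω, ∀ a, a ≠ 0 → 0 < h y a a) {y : E} (hy : y ∈ Ω) :
    ContDiffAt ℝ ∞ (christoffel h) y := by
  refine contDiffAt_of_apply hΩ (fun z hz a => ?_) hy
  refine contDiffAt_of_apply hΩ (fun z hz b => ?_) hz
  simp only [christoffel_apply]
  refine (contDiffAt_inverse_of_pos (hpos z hz) (hsm z hz)).clm_apply ?_
  refine contDiffAt_of_apply hΩ (fun z hz c => ?_) hz
  simp only [koszulForm_apply]
  have hT := (hsm z hz).fderiv_infty
  have h1 : ∀ a b c : E, ContDiffAt ℝ ∞ (fun w => fderiv ℝ h w a b c) z := fun a b c =>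
    ((hT.clm_apply contDiffAt_const).clm_apply contDiffAt_const).clm_apply contDiffAt_const
  exact contDiffAt_const.mul (((h1 a b c).add (h1 b a c)).sub (h1 c a b))

set_option synthInstance.maxHeartbeats 200000 in
/-- The Christoffel symbols and the inverse of a smooth metric. -/
def LocalMetric.ofMetric (Ω : Set E) (h : E → E →L[ℝ] E →L[ℝ] ℝ) (hΩ : IsOpen Ω)
    (hsm : ∀ y ∈ Ω, ContDiffAt ℝ ∞ h y) (hsymm : ∀ y ∈ Ω, ∀ a b, h y a b = h y b a)
    (hpos : ∀ y ∈ Ω, ∀ a, a ≠ 0 → 0 < h y a a) : LocalMetric E where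
  Ω := Ω
  h := h
  Γ := christoffel h
  sharp y := (h y).inverse
  isOpen := hΩ
  smooth_h := hsm
  smooth_Γ _ hy := contDiffAt_christoffel hΩ hsm hpos hy
  smooth_sharp y hy := contDiffAt_inverse_of_pos (hpos y hy) (hsm y hy)
  symm := hsymm
  pos := hpos
  Γ_symm y hy a b := by
    have h1 := fderiv_metric_symm hΩ hsm hsymm hy
    rw [christoffel_apply, christoffel_apply]
    congr 1
    ext c
    rw [koszulForm_apply, koszulForm_apply, h1 c a b]
    ring
  compat y hy a b c := by
    have h1 := fderiv_metric_symm hΩ hsm hsymm hy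
    rw [christoffel_apply, christoffel_apply, hsymm y hy b, apply_inverse_of_pos (hpos y hy),
      apply_inverse_of_pos (hpos y hy), koszulForm_apply, koszulForm_apply, h1 a b c, h1 b a c,
      h1 c a b]
    ring
  sharp_spec y hy α b := by rw [apply_inverse_of_pos (hpos y hy)]
end OfMetric

end Kundt

/-! ### The data of a triple in a chart, and the Levi-Civita connection in terms of Christoffel
symbols. -/

namespace Kundt

/-- The parametrization given by the chart at a point of a manifold without boundary. -/
def chartParam {E : Type*} [NormedAddCommGroup E] [NormedSpace ℝ E]
    {H : Type*} [TopologicalSpace H] (I : ModelWithCorners ℝ E H) [I.Boundaryless]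
    {M : Type*} [TopologicalSpace M] [ChartedSpace H M] [IsManifold I ∞ M] (p : M) :
    LocalParam I M where
  f := (extChartAt I p).symm
  g := extChartAt I p
  U := (extChartAt I p).target
  V := (extChartAt I p).source
  isOpen_U := isOpen_extChartAt_target p
  isOpen_V := isOpen_extChartAt_source p
  maps_f _ hy := (extChartAt I p).map_target hy
  maps_g _ hx := (extChartAt I p).map_source hx
  left_inv _ hy := (extChartAt I p).right_inv hy
  right_inv _ hx := (extChartAt I p).left_inv hx
  smooth_f y hy :=
    (contMDiffOn_extChartAt_symm p).contMDiffAt ((isOpen_extChartAt_target p).mem_nhds hy)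
  smooth_g x hx := contMDiffAt_extChartAt' (by rwa [extChartAt_source] at hx)

namespace LocalParam

variable {E : Type*} [NormedAddCommGroup E] [NormedSpace ℝ E]
  {H : Type*} [TopologicalSpace H] {I : ModelWithCorners ℝ E H}
  {M : Type*} [TopologicalSpace M] [ChartedSpace H M] (P : LocalParam I M) {y : E}

theorem contDiffAt_comp_f {F : M → ℝ} (hy : y ∈ P.U)
    (hF : ContMDiffAt I 𝓘(ℝ, ℝ) ∞ F (P.f y)) : ContDiffAt ℝ ∞ (fun z => F (P.f z)) y :=
  (hF.comp y (P.smooth_f y hy)).contDiffAt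

theorem d_ne_zero (hy : y ∈ P.U) {a : E} (ha : a ≠ 0) : P.d y a ≠ 0 := by
  intro h0
  have h1 := P.dinv_d hy a
  rw [h0, map_zero] at h1
  exact ha h1.symm

end LocalParam

variable {n : ℕ} {M : Type*} [TopologicalSpace M] [ChartedSpace (EuclideanSpace ℝ (Fin n)) M]
  [IsManifold (𝓡 n) ∞ M]

theorem smooth_inner_apply
    (h : ContMDiffRiemannianMetric (𝓡 n) ∞ (EuclideanSpace ℝ (Fin n))
      (fun x : M => TangentSpace (𝓡 n) x)) {X Y : Π x : M, TangentSpace (𝓡 n) x} {x : M}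
    (hX : SmoothVFAt (𝓡 n) X x) (hY : SmoothVFAt (𝓡 n) Y x) :
    ContMDiffAt (𝓡 n) 𝓘(ℝ, ℝ) ∞ (fun x => h.inner x (X x) (Y x)) x := by
  have : ContMDiffAt (𝓡 n) ((𝓡 n).prod 𝓘(ℝ)) ∞
      (fun m ↦ TotalSpace.mk' ℝ (E := Bundle.Trivial M ℝ) m (h.inner m (X m) (Y m))) x := by
    apply ContMDiffAt.clm_bundle_apply₂ (F₁ := EuclideanSpace ℝ (Fin n))
      (F₂ := EuclideanSpace ℝ (Fin n))
    · exact h.contMDiff.contMDiffAt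
    · exact hX
    · exact hY
  simp only [contMDiffAt_totalSpace] at this
  exact this.2

theorem Triple.smooth_W_apply (T : Triple n M) {X : Π x : M, TangentSpace (𝓡 n) x} {x : M}
    (hX : SmoothVFAt (𝓡 n) X x) :
    ContMDiffAt (𝓡 n) 𝓘(ℝ, ℝ) ∞ (fun x => T.W x (X x)) x := by
  have : ContMDiffAt (𝓡 n) ((𝓡 n).prod 𝓘(ℝ)) ∞
      (fun m ↦ TotalSpace.mk' ℝ (E := Bundle.Trivial M ℝ) m (T.W m (X m))) x := by
    apply ContMDiffAt.clm_bundle_apply (F₁ := EuclideanSpace ℝ (Fin n))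
    · exact T.smooth_W.contMDiffAt
    · exact hX
  simp only [contMDiffAt_totalSpace] at this
  exact this.2

namespace LocalParam

variable (P : LocalParam (𝓡 n) M) {y : EuclideanSpace ℝ (Fin n)}

variable (h : ContMDiffRiemannianMetric (𝓡 n) ∞ (EuclideanSpace ℝ (Fin n))
      (fun x : M => TangentSpace (𝓡 n) x))

/-- The components of a Riemannian metric in coordinates. -/
def metricCLM (y : EuclideanSpace ℝ (Fin n)) :
    EuclideanSpace ℝ (Fin n) →L[ℝ] EuclideanSpace ℝ (Fin n) →L[ℝ] ℝ :=
  let B : EuclideanSpace ℝ (Fin n) →L[ℝ] EuclideanSpace ℝ (Fin n) →L[ℝ] ℝ := h.inner (P.f y)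
  let L : EuclideanSpace ℝ (Fin n) →L[ℝ] EuclideanSpace ℝ (Fin n) := P.d y
  B.bilinearComp L L

theorem metricCLM_apply (y a b : EuclideanSpace ℝ (Fin n)) :
    P.metricCLM h y a b = h.inner (P.f y) (P.d y a) (P.d y b) := rfl

theorem contDiffAt_metricCLM (hy : y ∈ P.U) : ContDiffAt ℝ ∞ (P.metricCLM h) y := by
  refine contDiffAt_of_apply P.isOpen_U (fun z hz a => ?_) hy
  refine contDiffAt_of_apply P.isOpen_U (fun z hz b => ?_) hz
  have ha := P.smoothVFAt_push hz (contDiffAt_const (c := a))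
  have hb := P.smoothVFAt_push hz (contDiffAt_const (c := b))
  refine (P.contDiffAt_comp_f hz (smooth_inner_apply h ha hb)).congr_of_eventuallyEq ?_
  filter_upwards [P.eventually_mem_U hz] with w hw
  rw [metricCLM_apply, P.push_apply hw, P.push_apply hw]

theorem contDiffAt_pullOneForm (T : Triple n M) (hy : y ∈ P.U) :
    ContDiffAt ℝ ∞ (P.pullOneForm T.W) y := by
  refine contDiffAt_of_apply P.isOpen_U (fun z hz a => ?_) hy
  have ha := P.smoothVFAt_push hz (contDiffAt_const (c := a))
  refine (P.contDiffAt_comp_f hz (T.smooth_W_apply ha)).congr_of_eventuallyEq ?_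
  filter_upwards [P.eventually_mem_U hz] with w hw
  rw [P.push_apply hw]
  rfl

theorem metricCLM_symm (y a b : EuclideanSpace ℝ (Fin n)) :
    P.metricCLM h y a b = P.metricCLM h y b a := by
  rw [metricCLM_apply, metricCLM_apply, h.symm]

theorem metricCLM_pos (hy : y ∈ P.U) {a : EuclideanSpace ℝ (Fin n)} (ha : a ≠ 0) :
    0 < P.metricCLM h y a a := by
  rw [metricCLM_apply]
  exact h.pos _ _ (P.d_ne_zero hy ha)

/-- A Riemannian metric in coordinates. -/
def localMetric : LocalMetric (EuclideanSpace ℝ (Fin n)) :=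
  LocalMetric.ofMetric P.U (P.metricCLM h) P.isOpen_U (fun _ hy => P.contDiffAt_metricCLM h hy)
    (fun y _ => P.metricCLM_symm h y) (fun _ hy _ ha => P.metricCLM_pos h hy ha)

theorem localMetric_h (y a b : EuclideanSpace ℝ (Fin n)) :
    (P.localMetric h).h y a b = h.inner (P.f y) (P.d y a) (P.d y b) := rfl

variable {h}

theorem killing_iff {ξ : Π x : M, TangentSpace (𝓡 n) x} (hy : y ∈ P.U) :
    IsKillingNear (𝓡 n) (fun x a b => h.inner x a b) ξ (P.f y)
      ↔ ∀ᶠ z in 𝓝 y, (P.localMetric h).IsKillingAt (P.pull ξ) z := by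
  rw [P.isKillingNear_iff hy]
  refine eventually_congr ?_
  filter_upwards [P.eventually_mem_U hy] with z hz
  have key : ∀ u v : EuclideanSpace ℝ (Fin n) → EuclideanSpace ℝ (Fin n), ContDiffAt ℝ ∞ u z →
      ContDiffAt ℝ ∞ v z → fderiv ℝ (fun w => P.pullForm (fun x a b => h.inner x a b) w (u w) (v w))
        z (P.pull ξ z)
        - P.pullForm (fun x a b => h.inner x a b) z
          (fderiv ℝ u z (P.pull ξ z) - fderiv ℝ (P.pull ξ) z (u z)) (v z)
        - P.pullForm (fun x a b => h.inner x a b) z (u z)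
          (fderiv ℝ v z (P.pull ξ z) - fderiv ℝ (P.pull ξ) z (v z))
      = fderiv ℝ (P.localMetric h).h z (P.pull ξ z) (u z) (v z)
        + (P.localMetric h).h z (fderiv ℝ (P.pull ξ) z (u z)) (v z)
        + (P.localMetric h).h z (u z) (fderiv ℝ (P.pull ξ) z (v z)) := by
    intro u v hu hv
    have h1 := hasFDerivAt_bilin (B := (P.localMetric h).h)
      ((P.localMetric h).smooth_h z hz).diff hu.diff hv.diff
    have h2 : fderiv ℝ (fun w => P.pullForm (fun x a b => h.inner x a b) w (u w) (v w)) z = _ :=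
      h1.fderiv
    have h3 : ∀ a b, P.pullForm (fun x a b => h.inner x a b) z a b = (P.localMetric h).h z a b :=
      fun _ _ => rfl
    rw [h2, h3, h3, map_sub, map_sub]
    simp only [add_apply, sub_apply, ContinuousLinearMap.flip_apply,
      ContinuousLinearMap.comp_apply]
    ring
  constructor
  · rintro ⟨h1, h2⟩
    refine ⟨h1, fun a b => ?_⟩
    rw [← h2 (fun _ => a) (fun _ => b) contDiffAt_const contDiffAt_const]
    exact (key (fun _ => a) (fun _ => b) contDiffAt_const contDiffAt_const).symm
  · rintro ⟨h1, h2⟩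
    refine ⟨h1, fun u v hu hv => ?_⟩
    rw [key u v hu hv, h2]

section Curvature

variable {cov : CovariantDerivative (𝓡 n) (EuclideanSpace ℝ (Fin n))
      (fun x : M => TangentSpace (𝓡 n) x)}

theorem fderiv_inner_of_isLeviCivita (hcov : IsLeviCivita h cov) (hy : y ∈ P.U)
    {X Y : Π x : M, TangentSpace (𝓡 n) x} (hX : SmoothVFAt (𝓡 n) X (P.f y))
    (hY : SmoothVFAt (𝓡 n) Y (P.f y)) (a : EuclideanSpace ℝ (Fin n)) :
    fderiv ℝ (P.localMetric h).h y a (P.pull X y) (P.pull Y y)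
      + (P.localMetric h).h y (fderiv ℝ (P.pull X) y a) (P.pull Y y)
      + (P.localMetric h).h y (P.pull X y) (fderiv ℝ (P.pull Y) y a)
    = (P.localMetric h).h y (P.dinv (P.f y) (cov X (P.f y) (P.d y a))) (P.pull Y y)
      + (P.localMetric h).h y (P.pull X y) (P.dinv (P.f y) (cov Y (P.f y) (P.d y a))) := by
  have ha := P.smoothVFAt_push hy (contDiffAt_const (c := a))
  have h1 := (hcov (P.f y) (P.push fun _ => a) X Y ha hX hY).2
  rw [P.push_apply hy, P.mvfderiv_d hy (fun y => h.inner y (X y) (Y y))] at h1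
  have h2 : (fun z => h.inner (P.f z) (X (P.f z)) (Y (P.f z))) =ᶠ[𝓝 y]
      fun z => (P.localMetric h).h z (P.pull X z) (P.pull Y z) := by
    filter_upwards [P.eventually_mem_U hy] with z hz
    rw [localMetric_h, P.d_pull hz, P.d_pull hz]
  have h3 := hasFDerivAt_bilin (B := (P.localMetric h).h)
      ((P.localMetric h).smooth_h y hy).diff (P.contDiffAt_pull hy hX).diff
      (P.contDiffAt_pull hy hY).diff
  rw [h2.fderiv_eq, h3.fderiv] at h1
  simp only [add_apply, ContinuousLinearMap.flip_apply, ContinuousLinearMap.comp_apply] at h1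
  rw [h1]
  simp only [localMetric_h]
  rw [P.d_pull hy, P.d_pull hy, P.d_dinv hy, P.d_dinv hy]

theorem dinv_cov_push_const (hcov : IsLeviCivita h cov) (hy : y ∈ P.U)
    (a b : EuclideanSpace ℝ (Fin n)) :
    P.dinv (P.f y) (cov (P.push fun _ => b) (P.f y) (P.d y a)) = (P.localMetric h).Γ y a b := by
  have hc := fun c => P.smoothVFAt_push hy (contDiffAt_const (c := c))
  have hpull : ∀ c : EuclideanSpace ℝ (Fin n), P.pull (P.push fun _ => c) y = c := fun c =>
    P.pull_push hy _
  have hd : ∀ c : EuclideanSpace ℝ (Fin n), fderiv ℝ (P.pull (P.push fun _ => c)) y = 0 := by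
    intro c
    rw [(P.eventually_pull_push hy _).fderiv_eq, fderiv_fun_const]
    rfl
  have hsymm : ∀ a b, P.dinv (P.f y) (cov (P.push fun _ => b) (P.f y) (P.d y a))
      = P.dinv (P.f y) (cov (P.push fun _ => a) (P.f y) (P.d y b)) := by
    intro a b
    have h1 := (hcov (P.f y) _ _ _ (hc a) (hc b) (hc a)).1
    rw [P.mlieBracket_f hy (hc a) (hc b), hd, hd, zero_apply, zero_apply, sub_zero, map_zero,
      sub_eq_zero, P.push_apply hy, P.push_apply hy] at h1
    rw [h1]
  have hmet := fun a b c => P.fderiv_inner_of_isLeviCivita hcov hy (hc b) (hc c) a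
  simp only [hpull, hd, zero_apply, map_zero, add_zero] at hmet
  have hcompat := (P.localMetric h).compat y hy
  have hs := (P.localMetric h).symm y hy
  -- The difference of two torsion-free metric connections is symmetric in the first two slots and
  -- antisymmetric in the last two, hence zero.
  set t : EuclideanSpace ℝ (Fin n) → EuclideanSpace ℝ (Fin n) → EuclideanSpace ℝ (Fin n) → ℝ :=
    fun a b c => (P.localMetric h).h y
      (P.dinv (P.f y) (cov (P.push fun _ => b) (P.f y) (P.d y a))) c
      - (P.localMetric h).h y ((P.localMetric h).Γ y a b) c with ht
  have t1 : ∀ a b c, t a b c = t b a c := by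
    intro a b c
    simp only [ht]
    rw [hsymm a b, (P.localMetric h).Γ_symm y hy a b]
  have t2 : ∀ a b c, t a b c + t a c b = 0 := by
    intro a b c
    have e1 := hmet a b c
    have e2 := hcompat a b c
    rw [hs b] at e1 e2
    simp only [ht]
    linarith
  refine (P.localMetric h).ext_h hy fun c => ?_
  have e : t a b c = 0 := by
    linarith [t2 a b c, t1 a c b, t2 c a b, t1 c b a, t2 b c a, t1 b a c]
  exact sub_eq_zero.1 e

/-- Metric compatibility of `X` with constant fields, whose derivatives are already known,
determines the derivative of `X`. -/
theorem dinv_cov (hcov : IsLeviCivita h cov) (hy : y ∈ P.U)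
    {X : Π x : M, TangentSpace (𝓡 n) x} (hX : SmoothVFAt (𝓡 n) X (P.f y))
    (a : EuclideanSpace ℝ (Fin n)) :
    P.dinv (P.f y) (cov X (P.f y) (P.d y a))
      = fderiv ℝ (P.pull X) y a + (P.localMetric h).Γ y a (P.pull X y) := by
  refine (P.localMetric h).ext_h hy fun c => ?_
  have h1 := P.fderiv_inner_of_isLeviCivita hcov hy hX
    (P.smoothVFAt_push hy (contDiffAt_const (c := c))) a
  rw [P.dinv_cov_push_const hcov hy, P.pull_push hy, (P.localMetric h).compat y hy,
    (P.eventually_pull_push hy _).fderiv_eq, fderiv_fun_const] at h1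
  simp only [Pi.zero_apply, zero_apply, map_zero, add_zero] at h1
  rw [map_add, add_apply]
  linarith

/-- Evaluate the Riemann tensor on coordinate fields, whose brackets vanish. -/
theorem hasCurvature {κ : ℝ} (hκ : HasConstantCurvature h κ) :
    (P.localMetric h).HasCurvature κ := by
  obtain ⟨cov, hcov, hR⟩ := hκ
  intro y hy a b c
  have hc := fun z (hz : z ∈ P.U) c => P.smoothVFAt_push hz (contDiffAt_const (c := c))
  have hpull : ∀ a b : EuclideanSpace ℝ (Fin n),
      P.pull (fun x => cov (P.push fun _ => b) x (P.push (fun _ => a) x))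
        =ᶠ[𝓝 y] fun z => (P.localMetric h).Γ z a b := by
    intro a b
    filter_upwards [P.eventually_mem_U hy] with z hz
    rw [P.pull_apply hz, P.push_apply hz, P.dinv_cov_push_const hcov hz]
  have hΓ := (P.localMetric h).smooth_Γ y hy
  have hsm : ∀ a b : EuclideanSpace ℝ (Fin n),
      SmoothVFAt (𝓡 n) (fun x => cov (P.push fun _ => b) x (P.push (fun _ => a) x)) (P.f y) := by
    intro a b
    rw [P.smoothVFAt_iff hy]
    exact ((hΓ.clm_apply contDiffAt_const).clm_apply contDiffAt_const).congr_of_eventuallyEq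
      (hpull a b)
  have key : ∀ a b c : EuclideanSpace ℝ (Fin n), P.dinv (P.f y)
      (cov (fun x => cov (P.push fun _ => c) x (P.push (fun _ => b) x)) (P.f y) (P.d y a))
      = fderiv ℝ (P.localMetric h).Γ y a b c
        + (P.localMetric h).Γ y a ((P.localMetric h).Γ y b c) := by
    intro a b c
    rw [P.dinv_cov hcov hy (hsm b c), (hpull b c).fderiv_eq, (hpull b c).self_of_nhds,
      (hasFDerivAt_bilin_const hΓ.diff b c).fderiv]
    rfl
  have h1 := congrArg (P.dinv (P.f y)) (hR (P.f y) (P.push fun _ => a) (P.push fun _ => b)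
    (P.push fun _ => c) (hc y hy a) (hc y hy b) (hc y hy c))
  have hd : ∀ c : EuclideanSpace ℝ (Fin n), fderiv ℝ (P.pull (P.push fun _ => c)) y = 0 := by
    intro c
    rw [(P.eventually_pull_push hy _).fderiv_eq, fderiv_fun_const]
    rfl
  rw [P.mlieBracket_f hy (hc y hy a) (hc y hy b), hd, hd, zero_apply, zero_apply, sub_zero,
    map_zero, map_zero, sub_zero, map_sub, P.push_apply hy, P.push_apply hy, P.push_apply hy,
    key, key, map_smul, map_sub, map_smul, map_smul, P.dinv_d hy, P.dinv_d hy] at h1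
  rw [localMetric_h, localMetric_h, ← h1]
  abel

end Curvature

end LocalParam

end Kundt

/-! ### Derivatives along u, v and the transverse directions of equations quadratic in v. -/

namespace Kundt

section Directional

variable {E F : Type*} [NormedAddCommGroup E] [NormedSpace ℝ E]
  [NormedAddCommGroup F] [NormedSpace ℝ F]

/-- The derivative of `f` in the constant direction `a`. -/
def dir (a : E) (f : E → F) (z : E) : F := fderiv ℝ f z a

theorem contDiffAt_dir {f : E → F} {z : E} (hf : ContDiffAt ℝ ∞ f z) (a : E) :
    ContDiffAt ℝ ∞ (dir a f) z :=
  hf.fderiv_infty.clm_apply contDiffAt_const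

theorem dir_comm {f : E → F} {z : E} (hf : ContDiffAt ℝ ∞ f z) (a b : E) :
    dir a (dir b f) z = dir b (dir a f) z := by
  have h : ∀ a b, dir a (dir b f) z = fderiv ℝ (fderiv ℝ f) z a b := by
    intro a b
    have h1 : fderiv ℝ (dir b f) z = _ := (hasFDerivAt_apply_const hf.fderiv_infty.diff b).fderiv
    rw [dir, h1, ContinuousLinearMap.flip_apply]
  rw [h, h, fderiv_fderiv_symm hf]

theorem dir_clm {f : E → F} {z : E} (hf : ContDiffAt ℝ ∞ f z) {F' : Type*} [NormedAddCommGroup F']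
    [NormedSpace ℝ F'] (L : F →L[ℝ] F') (a : E) : dir a (fun w => L (f w)) z = L (dir a f z) := by
  have h1 : fderiv ℝ (fun w => L (f w)) z = _ := (L.hasFDerivAt.comp z hf.diff.hasFDerivAt).fderiv
  rw [dir, h1]
  rfl

theorem dir_eq_zero {f : E → F} {z : E} (hf : ∀ᶠ w in 𝓝 z, f w = 0) (a : E) : dir a f z = 0 := by
  have h1 : f =ᶠ[𝓝 z] fun _ => 0 := hf
  rw [dir, h1.fderiv_eq, fderiv_fun_const]
  rfl

end Directional

theorem tendsto_lineU {E : Type*} [TopologicalSpace E] (z : ℝ × ℝ × E) : Tendsto (fun t => (t, z.2)) (𝓝 z.1) (𝓝 z) :=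
  (Continuous.prodMk_left z.2).tendsto' _ _ rfl

theorem tendsto_lineV {E : Type*} [TopologicalSpace E] (z : ℝ × ℝ × E) : Tendsto (fun t => (z.1, t, z.2.2)) (𝓝 z.2.1) (𝓝 z) :=
  Continuous.tendsto' (by fun_prop) _ _ rfl

theorem tendsto_slice {E : Type*} [TopologicalSpace E] (y : E) :
    Tendsto (fun y : E => ((0, 0, y) : ℝ × ℝ × E)) (𝓝 y) (𝓝 (0, 0, y)) :=
  Continuous.tendsto' (by fun_prop) _ _ rfl

section Plane

variable {E F : Type*} [NormedAddCommGroup E] [NormedSpace ℝ E]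
  [NormedAddCommGroup F] [NormedSpace ℝ F]

variable (E) in
/-- The coordinate direction `∂_u`. -/
def dirU : ℝ × ℝ × E := (1, 0, 0)

variable (E) in
/-- The coordinate direction `∂_v`. -/
def dirV : ℝ × ℝ × E := (0, 1, 0)

/-- A direction tangent to the transverse space. -/
def dirE (c : E) : ℝ × ℝ × E := (0, 0, c)

theorem hasDerivAt_lineU {f : ℝ × ℝ × E → F} {z : ℝ × ℝ × E} (hf : ContDiffAt ℝ ∞ f z) :
    HasDerivAt (fun t => f (t, z.2)) (dir (dirU E) f z) z.1 :=
  HasFDerivAt.comp_hasDerivAt (f := fun t => (t, z.2)) (x := z.1) hf.diff.hasFDerivAt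
    ((hasDerivAt_id _).prodMk (hasDerivAt_const _ _))

theorem hasDerivAt_lineV {f : ℝ × ℝ × E → F} {z : ℝ × ℝ × E} (hf : ContDiffAt ℝ ∞ f z) :
    HasDerivAt (fun t => f (z.1, t, z.2.2)) (dir (dirV E) f z) z.2.1 :=
  HasFDerivAt.comp_hasDerivAt (f := fun t => (z.1, t, z.2.2)) (x := z.2.1)
    hf.diff.hasFDerivAt
    ((hasDerivAt_const _ _).prodMk ((hasDerivAt_id _).prodMk (hasDerivAt_const _ _)))

theorem contDiffAt_slice {f : ℝ × ℝ × E → F} {y : E} (hf : ContDiffAt ℝ ∞ f (0, 0, y)) :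
    ContDiffAt ℝ ∞ (fun y => f (0, 0, y)) y :=
  hf.comp y (contDiffAt_const.prodMk (contDiffAt_const.prodMk contDiffAt_id))

theorem fderiv_slice {f : ℝ × ℝ × E → F} {y : E} (hf : ContDiffAt ℝ ∞ f (0, 0, y)) (c : E) :
    fderiv ℝ (fun y => f (0, 0, y)) y c = dir (dirE c) f (0, 0, y) := by
  have h1 := (hasFDerivAt_const (𝕜 := ℝ) (0 : ℝ) y).prodMk
    ((hasFDerivAt_const (𝕜 := ℝ) (0 : ℝ) y).prodMk (hasFDerivAt_id (𝕜 := ℝ) y))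
  have h2 : fderiv ℝ (fun y => f (0, 0, y)) y = _ :=
    (HasFDerivAt.comp (g := f) y hf.diff.hasFDerivAt h1).fderiv
  rw [h2]
  rfl

/-- A polynomial of degree two in a variable `v`, whose coefficients are linear in three vectors. -/
structure LinearQuadratic (E : Type*) [NormedAddCommGroup E] [NormedSpace ℝ E] where
  /-- the coefficients of `1` -/
  A₁ : E →L[ℝ] ℝ
  /-- the coefficients of `1` -/
  A₂ : E →L[ℝ] ℝ
  /-- the coefficients of `1` -/
  A₃ : E →L[ℝ] ℝ
  /-- the coefficients of `v` -/
  B₁ : E →L[ℝ] ℝ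
  /-- the coefficients of `v` -/
  B₂ : E →L[ℝ] ℝ
  /-- the coefficients of `v` -/
  B₃ : E →L[ℝ] ℝ
  /-- the coefficients of `v ^ 2` -/
  C₁ : E →L[ℝ] ℝ
  /-- the coefficients of `v ^ 2` -/
  C₂ : E →L[ℝ] ℝ
  /-- the coefficients of `v ^ 2` -/
  C₃ : E →L[ℝ] ℝ

namespace LinearQuadratic

/-- The constant term. -/
def a (q : LinearQuadratic E) (x₁ x₂ x₃ : E) : ℝ := q.A₁ x₁ + q.A₂ x₂ + q.A₃ x₃

/-- The coefficient of `v`. -/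
def b (q : LinearQuadratic E) (x₁ x₂ x₃ : E) : ℝ := q.B₁ x₁ + q.B₂ x₂ + q.B₃ x₃

/-- The coefficient of `v ^ 2`. -/
def c (q : LinearQuadratic E) (x₁ x₂ x₃ : E) : ℝ := q.C₁ x₁ + q.C₂ x₂ + q.C₃ x₃

/-- The value of the polynomial. -/
def eval (q : LinearQuadratic E) (v : ℝ) (x₁ x₂ x₃ : E) : ℝ :=
  q.a x₁ x₂ x₃ + v * q.b x₁ x₂ x₃ + v ^ 2 * q.c x₁ x₂ x₃

theorem hasDerivAt_sum {x₁ x₂ x₃ : ℝ → E} {y₁ y₂ y₃ : E} {t : ℝ} (A₁ A₂ A₃ : E →L[ℝ] ℝ)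
    (h₁ : HasDerivAt x₁ y₁ t) (h₂ : HasDerivAt x₂ y₂ t) (h₃ : HasDerivAt x₃ y₃ t) :
    HasDerivAt (fun t => A₁ (x₁ t) + A₂ (x₂ t) + A₃ (x₃ t)) (A₁ y₁ + A₂ y₂ + A₃ y₃) t :=
  ((A₁.hasFDerivAt.comp_hasDerivAt t h₁).add (A₂.hasFDerivAt.comp_hasDerivAt t h₂)).add
    (A₃.hasFDerivAt.comp_hasDerivAt t h₃)

variable {q : E → LinearQuadratic (ℝ × ℝ × E)} {ω₁ ω₂ ω₃ : ℝ × ℝ × E → ℝ × ℝ × E}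
  {z : ℝ × ℝ × E}

/-- The coefficients do not depend on `u`, so the derivative falls on the vectors alone. This is the
invariance of the Kundt metric under translation of `u`. -/
theorem eval_dirU (h₁ : ContDiffAt ℝ ∞ ω₁ z) (h₂ : ContDiffAt ℝ ∞ ω₂ z) (h₃ : ContDiffAt ℝ ∞ ω₃ z)
    (h : ∀ᶠ w in 𝓝 z, (q w.2.2).eval w.2.1 (ω₁ w) (ω₂ w) (ω₃ w) = 0) :
    (q z.2.2).eval z.2.1 (dir (dirU E) ω₁ z) (dir (dirU E) ω₂ z) (dir (dirU E) ω₃ z) = 0 := by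
  have e := fun A₁ A₂ A₃ => hasDerivAt_sum A₁ A₂ A₃ (hasDerivAt_lineU h₁) (hasDerivAt_lineU h₂)
    (hasDerivAt_lineU h₃)
  have h4 := ((e (q z.2.2).A₁ (q z.2.2).A₂ (q z.2.2).A₃).add
    ((e (q z.2.2).B₁ (q z.2.2).B₂ (q z.2.2).B₃).const_mul z.2.1)).add
    ((e (q z.2.2).C₁ (q z.2.2).C₂ (q z.2.2).C₃).const_mul (z.2.1 ^ 2))
  exact h4.unique ((hasDerivAt_const z.1 (0 : ℝ)).congr_of_eventuallyEq
    ((tendsto_lineU z).eventually h))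

theorem eval_dirV (h₁ : ContDiffAt ℝ ∞ ω₁ z) (h₂ : ContDiffAt ℝ ∞ ω₂ z) (h₃ : ContDiffAt ℝ ∞ ω₃ z)
    (h : ∀ᶠ w in 𝓝 z, (q w.2.2).eval w.2.1 (ω₁ w) (ω₂ w) (ω₃ w) = 0) :
    (q z.2.2).a (dir (dirV E) ω₁ z) (dir (dirV E) ω₂ z) (dir (dirV E) ω₃ z)
      + (q z.2.2).b (ω₁ z) (ω₂ z) (ω₃ z)
      + z.2.1 * ((q z.2.2).b (dir (dirV E) ω₁ z) (dir (dirV E) ω₂ z) (dir (dirV E) ω₃ z)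
        + 2 * (q z.2.2).c (ω₁ z) (ω₂ z) (ω₃ z))
      + z.2.1 ^ 2 * (q z.2.2).c (dir (dirV E) ω₁ z) (dir (dirV E) ω₂ z) (dir (dirV E) ω₃ z)
      = 0 := by
  have e := fun A₁ A₂ A₃ => hasDerivAt_sum A₁ A₂ A₃ (hasDerivAt_lineV h₁) (hasDerivAt_lineV h₂)
    (hasDerivAt_lineV h₃)
  have h4 := ((e (q z.2.2).A₁ (q z.2.2).A₂ (q z.2.2).A₃).add
    ((hasDerivAt_id z.2.1).mul (e (q z.2.2).B₁ (q z.2.2).B₂ (q z.2.2).B₃))).add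
    (((hasDerivAt_id z.2.1).pow 2).mul (e (q z.2.2).C₁ (q z.2.2).C₂ (q z.2.2).C₃))
  have h5 := h4.unique ((hasDerivAt_const z.2.1 (0 : ℝ)).congr_of_eventuallyEq
    ((tendsto_lineV z).eventually h))
  simp only [Pi.pow_apply, id_eq] at h5
  simp only [a, b, c]
  rw [← h5]
  push_cast
  ring

/-- At `v = 0` the second derivative isolates the coefficient of `v ^ 2`, where `H` enters, along
with derivatives of the lower terms. -/
theorem eval_dirV_dirV {y : E} (h₁ : ∀ᶠ w in 𝓝 (0, 0, y), ContDiffAt ℝ ∞ ω₁ w)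
    (h₂ : ∀ᶠ w in 𝓝 (0, 0, y), ContDiffAt ℝ ∞ ω₂ w)
    (h₃ : ∀ᶠ w in 𝓝 (0, 0, y), ContDiffAt ℝ ∞ ω₃ w)
    (h : ∀ᶠ w in 𝓝 (0, 0, y), (q w.2.2).eval w.2.1 (ω₁ w) (ω₂ w) (ω₃ w) = 0) :
    (q y).a (dir (dirV E) (dir (dirV E) ω₁) (0, 0, y)) (dir (dirV E) (dir (dirV E) ω₂) (0, 0, y))
        (dir (dirV E) (dir (dirV E) ω₃) (0, 0, y))
      + 2 * (q y).b (dir (dirV E) ω₁ (0, 0, y)) (dir (dirV E) ω₂ (0, 0, y))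
        (dir (dirV E) ω₃ (0, 0, y))
      + 2 * (q y).c (ω₁ (0, 0, y)) (ω₂ (0, 0, y)) (ω₃ (0, 0, y)) = 0 := by
  have h0 := (h₁.and (h₂.and (h₃.and h.eventually_nhds))).mono fun w k =>
    eval_dirV k.1 k.2.1 k.2.2.1 k.2.2.2
  have k₁ := h₁.self_of_nhds
  have k₂ := h₂.self_of_nhds
  have k₃ := h₃.self_of_nhds
  have e := fun A₁ A₂ A₃ => hasDerivAt_sum A₁ A₂ A₃ (hasDerivAt_lineV k₁) (hasDerivAt_lineV k₂)
    (hasDerivAt_lineV k₃)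
  have e' := fun A₁ A₂ A₃ => hasDerivAt_sum A₁ A₂ A₃
    (hasDerivAt_lineV (contDiffAt_dir k₁ (dirV E)))
    (hasDerivAt_lineV (contDiffAt_dir k₂ (dirV E)))
    (hasDerivAt_lineV (contDiffAt_dir k₃ (dirV E)))
  have h4 := (((e' (q y).A₁ (q y).A₂ (q y).A₃).add (e (q y).B₁ (q y).B₂ (q y).B₃)).add
    ((hasDerivAt_id (0 : ℝ)).mul ((e' (q y).B₁ (q y).B₂ (q y).B₃).add
      ((e (q y).C₁ (q y).C₂ (q y).C₃).const_mul 2)))).add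
    (((hasDerivAt_id (0 : ℝ)).pow 2).mul (e' (q y).C₁ (q y).C₂ (q y).C₃))
  have h5 := h4.unique ((hasDerivAt_const (0 : ℝ) (0 : ℝ)).congr_of_eventuallyEq
    ((tendsto_lineV (0, 0, y)).eventually h0))
  simp only [Pi.pow_apply, Pi.add_apply, id_eq] at h5
  simp only [a, b, c]
  linear_combination h5

end LinearQuadratic

end Plane

end Kundt

/-! ### The Killing equations of the Kundt metric and their trace on the slice u = v = 0. -/

namespace Kundt

theorem dir_dir_comm {E F : Type*} [NormedAddCommGroup E] [NormedSpace ℝ E]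
    [NormedAddCommGroup F] [NormedSpace ℝ F] {f : E → F} {z : E}
    (hf : ∀ᶠ w in 𝓝 z, ContDiffAt ℝ ∞ f w) (a b : E) :
    dir a (dir a (dir b f)) z = dir b (dir a (dir a f)) z := by
  have h1 : dir a (dir b f) =ᶠ[𝓝 z] dir b (dir a f) := hf.mono fun w hw => dir_comm hw a b
  rw [← dir_comm (contDiffAt_dir hf.self_of_nhds a) a b]
  exact congrArg (fun L : E →L[ℝ] F => L a) h1.fderiv_eq

section KundtForm

variable {E : Type*} [NormedAddCommGroup E] [NormedSpace ℝ E] (G : LocalMetric E)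
  (W : E → E →L[ℝ] ℝ) (H : E → ℝ)

/-- The metric `2 du (dv + v² H du + v W) + h` in coordinates. -/
def kundtForm (z a b : ℝ × ℝ × E) : ℝ :=
  a.1 * (b.2.1 + z.2.1 ^ 2 * H z.2.2 * b.1 + z.2.1 * W z.2.2 b.2.2)
    + b.1 * (a.2.1 + z.2.1 ^ 2 * H z.2.2 * a.1 + z.2.1 * W z.2.2 a.2.2)
    + G.h z.2.2 a.2.2 b.2.2

variable (E) in
/-- The component along `∂_u`. -/
def projU : ℝ × ℝ × E →L[ℝ] ℝ := ContinuousLinearMap.fst ℝ ℝ (ℝ × E)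

variable (E) in
/-- The component along `∂_v`. -/
def projV : ℝ × ℝ × E →L[ℝ] ℝ :=
  (ContinuousLinearMap.fst ℝ ℝ E).comp (ContinuousLinearMap.snd ℝ ℝ (ℝ × E))

variable (E) in
/-- The transverse component. -/
def projE : ℝ × ℝ × E →L[ℝ] E :=
  (ContinuousLinearMap.snd ℝ ℝ E).comp (ContinuousLinearMap.snd ℝ ℝ (ℝ × E))

@[simp] theorem projU_apply (x : ℝ × ℝ × E) : projU E x = x.1 := rfl

@[simp] theorem projV_apply (x : ℝ × ℝ × E) : projV E x = x.2.1 := rfl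

@[simp] theorem projE_apply (x : ℝ × ℝ × E) : projE E x = x.2.2 := rfl

variable {G W H}

theorem fderiv_kundtForm {z : ℝ × ℝ × E} (hz : z.2.2 ∈ G.Ω) (hW : ContDiffAt ℝ ∞ W z.2.2)
    (hH : ContDiffAt ℝ ∞ H z.2.2) (a b x : ℝ × ℝ × E) :
    fderiv ℝ (fun w => kundtForm G W H w a b) z x
      = a.1 * ((2 * z.2.1 * x.2.1 * H z.2.2 + z.2.1 ^ 2 * fderiv ℝ H z.2.2 x.2.2) * b.1
          + (x.2.1 * W z.2.2 b.2.2 + z.2.1 * fderiv ℝ W z.2.2 x.2.2 b.2.2))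
        + b.1 * ((2 * z.2.1 * x.2.1 * H z.2.2 + z.2.1 ^ 2 * fderiv ℝ H z.2.2 x.2.2) * a.1
          + (x.2.1 * W z.2.2 a.2.2 + z.2.1 * fderiv ℝ W z.2.2 x.2.2 a.2.2))
        + fderiv ℝ G.h z.2.2 x.2.2 a.2.2 b.2.2 := by
  have e1 : HasFDerivAt (fun w : ℝ × ℝ × E => w.2.1) (projV E) z := (projV E).hasFDerivAt
  have e2 : HasFDerivAt (fun w : ℝ × ℝ × E => w.2.2) (projE E) z := (projE E).hasFDerivAt
  have e3 : HasFDerivAt (fun w : ℝ × ℝ × E => H w.2.2) ((fderiv ℝ H z.2.2).comp (projE E)) z :=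
    HasFDerivAt.comp (g := H) z hH.diff.hasFDerivAt e2
  have e4 : ∀ c, HasFDerivAt (fun w : ℝ × ℝ × E => W w.2.2 c)
      (((fderiv ℝ W z.2.2).flip c).comp (projE E)) z := fun c =>
    HasFDerivAt.comp (g := fun y => W y c) z (hasFDerivAt_apply_const hW.diff c) e2
  have e5 : HasFDerivAt (fun w : ℝ × ℝ × E => G.h w.2.2 a.2.2 b.2.2)
      ((((fderiv ℝ G.h z.2.2).flip a.2.2).flip b.2.2).comp (projE E)) z :=
    HasFDerivAt.comp (g := fun y => G.h y a.2.2 b.2.2) z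
      (hasFDerivAt_bilin_const (G.smooth_h _ hz).diff _ _) e2
  have e6 := fun c d : ℝ × ℝ × E => ((((e1.pow 2).mul e3).mul_const d.1).const_add d.2.1).add
    (e1.mul (e4 d.2.2))
  have e7 := (((e6 b b).const_mul a.1).add ((e6 a a).const_mul b.1)).add e5
  have e8 : fderiv ℝ (fun w => kundtForm G W H w a b) z = _ := e7.fderiv
  rw [e8]
  simp
  ring

/-- The component of the Killing equation along `∂_v ∂_v`. -/
def coefVV (_ : E) : LinearQuadratic (ℝ × ℝ × E) where
  A₁ := projU E
  A₂ := 0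
  A₃ := 0
  B₁ := 0
  B₂ := 0
  B₃ := 0
  C₁ := 0
  C₂ := 0
  C₃ := 0

variable (G) in
/-- The component of the Killing equation along `∂_v` and a transverse vector. -/
def coefVE (c y : E) : LinearQuadratic (ℝ × ℝ × E) where
  A₁ := ((G.h y).flip c).comp (projE E)
  A₂ := projU E
  A₃ := 0
  B₁ := 0
  B₂ := 0
  B₃ := 0
  C₁ := 0
  C₂ := 0
  C₃ := 0

variable (W) in
/-- The component of the Killing equation along `∂_u ∂_v`. -/
def coefUV (y : E) : LinearQuadratic (ℝ × ℝ × E) where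
  A₁ := projU E
  A₂ := projV E
  A₃ := 0
  B₁ := 0
  B₂ := (W y).comp (projE E)
  B₃ := 0
  C₁ := 0
  C₂ := 0
  C₃ := 0

variable (W H) in
/-- The component of the Killing equation along `∂_u ∂_u`. -/
def coefUU (y : E) : LinearQuadratic (ℝ × ℝ × E) where
  A₁ := 0
  A₂ := projV E
  A₃ := 0
  B₁ := (2 * H y) • projV E
  B₂ := (W y).comp (projE E)
  B₃ := 0
  C₁ := (fderiv ℝ H y).comp (projE E)
  C₂ := (2 * H y) • projU E
  C₃ := 0

variable (G W H) in
/-- The component of the Killing equation along `∂_u` and a transverse vector. -/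
def coefUE (c y : E) : LinearQuadratic (ℝ × ℝ × E) where
  A₁ := (W y c) • projV E
  A₂ := ((G.h y).flip c).comp (projE E)
  A₃ := projV E
  B₁ := ((fderiv ℝ W y).flip c).comp (projE E)
  B₂ := (W y c) • projU E
  B₃ := (W y).comp (projE E)
  C₁ := 0
  C₂ := 0
  C₃ := (2 * H y) • projU E

variable (G W) in
/-- The component of the Killing equation along two transverse vectors. -/
def coefEE (b c y : E) : LinearQuadratic (ℝ × ℝ × E) where
  A₁ := (((fderiv ℝ G.h y).flip b).flip c).comp (projE E)
  A₂ := ((G.h y).flip c).comp (projE E)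
  A₃ := (G.h y b).comp (projE E)
  B₁ := 0
  B₂ := (W y c) • projU E
  B₃ := (W y b) • projU E
  C₁ := 0
  C₂ := 0
  C₃ := 0

variable (G W H) in
/-- The vector field `ξ` satisfies the Killing equations of the Kundt metric at `z`. -/
structure KundtKilling (ξ : ℝ × ℝ × E → ℝ × ℝ × E) (z : ℝ × ℝ × E) : Prop where
  smooth : ContDiffAt ℝ ∞ ξ z
  vv : (coefVV z.2.2).eval z.2.1 (dir (dirV E) ξ z) (dir (dirV E) ξ z) (dir (dirV E) ξ z) = 0
  ve : ∀ c, (coefVE G c z.2.2).eval z.2.1 (dir (dirV E) ξ z) (dir (dirE c) ξ z)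
    (dir (dirV E) ξ z) = 0
  uv : (coefUV W z.2.2).eval z.2.1 (dir (dirU E) ξ z) (dir (dirV E) ξ z) (dir (dirV E) ξ z) = 0
  uu : (coefUU W H z.2.2).eval z.2.1 (ξ z) (dir (dirU E) ξ z) (ξ z) = 0
  ue : ∀ c, (coefUE G W H c z.2.2).eval z.2.1 (ξ z) (dir (dirU E) ξ z) (dir (dirE c) ξ z) = 0
  ee : ∀ b c, (coefEE G W b c z.2.2).eval z.2.1 (ξ z) (dir (dirE b) ξ z) (dir (dirE c) ξ z) = 0

namespace KundtKilling

open LinearQuadratic in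
theorem of_kundtForm {ξ : ℝ × ℝ × E → ℝ × ℝ × E} {z : ℝ × ℝ × E} (hz : z.2.2 ∈ G.Ω)
    (hW : ContDiffAt ℝ ∞ W z.2.2) (hH : ContDiffAt ℝ ∞ H z.2.2) (hξ : ContDiffAt ℝ ∞ ξ z)
    (h : ∀ a b : ℝ × ℝ × E, fderiv ℝ (fun w => kundtForm G W H w a b) z (ξ z)
      + kundtForm G W H z (fderiv ℝ ξ z a) b + kundtForm G W H z a (fderiv ℝ ξ z b) = 0) :
    KundtKilling G W H ξ z := by
  simp only [fderiv_kundtForm hz hW hH] at h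
  -- This says that the `∂_u`-component of `ξ` is independent of `v`; it removes the `v`-dependent
  -- terms containing that derivative from `ve` and `uv`.
  have hvv := h (dirV E) (dirV E)
  simp [kundtForm, dirV] at hvv
  refine ⟨hξ, ?_, fun c => ?_, ?_, ?_, fun c => ?_, fun b c => ?_⟩
  · simp [eval, LinearQuadratic.a, LinearQuadratic.b, LinearQuadratic.c, coefVV, dir, dirV]
    linarith
  · have h1 := h (dirV E) (dirE c)
    simp [kundtForm, dirV, dirE] at h1
    simp [eval, LinearQuadratic.a, LinearQuadratic.b, LinearQuadratic.c, coefVE, dir, dirV, dirE]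
    linear_combination h1 - z.2.1 * W z.2.2 c * hvv
  · have h1 := h (dirU E) (dirV E)
    simp [kundtForm, dirV, dirU] at h1
    simp [eval, LinearQuadratic.a, LinearQuadratic.b, LinearQuadratic.c, coefUV, dir, dirV, dirU]
    linear_combination h1 - 2 * z.2.1 ^ 2 * H z.2.2 * hvv
  · have h1 := h (dirU E) (dirU E)
    simp [kundtForm, dirU] at h1
    simp [eval, LinearQuadratic.a, LinearQuadratic.b, LinearQuadratic.c, coefUU, dir, dirU]
    linear_combination 1 / 2 * h1
  · have h1 := h (dirU E) (dirE c)
    simp [kundtForm, dirU, dirE] at h1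
    simp [eval, LinearQuadratic.a, LinearQuadratic.b, LinearQuadratic.c, coefUE, dir, dirU, dirE]
    linear_combination h1
  · have h1 := h (dirE b) (dirE c)
    simp [kundtForm, dirE] at h1
    simp [eval, LinearQuadratic.a, LinearQuadratic.b, LinearQuadratic.c, coefEE, dir, dirE]
    linear_combination h1

variable {ξ : ℝ × ℝ × E → ℝ × ℝ × E} {z : ℝ × ℝ × E} {y : E}

/-- The derivative of a Killing field along the Killing field `∂_u` is a Killing field. -/
theorem killing_dirU (h : ∀ᶠ w in 𝓝 z, KundtKilling G W H ξ w) :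
    KundtKilling G W H (dir (dirU E) ξ) z := by
  have hs := h.self_of_nhds.smooth
  have hd := contDiffAt_dir hs
  have hc := fun a => dir_comm hs (dirU E) a
  refine ⟨hd _, ?_, fun c => ?_, ?_, ?_, fun c => ?_, fun b c => ?_⟩
  · have := LinearQuadratic.eval_dirU (q := fun y => coefVV y) (hd _) (hd _) (hd _)
      (h.mono fun w hw => hw.vv)
    simpa only [hc (dirV E)] using this
  · have := LinearQuadratic.eval_dirU (q := fun y => coefVE G c y) (hd _) (hd _) (hd _)
      (h.mono fun w hw => hw.ve c)
    simpa only [hc (dirV E), hc (dirE c)] using this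
  · have := LinearQuadratic.eval_dirU (q := fun y => coefUV W y) (hd _) (hd _) (hd _)
      (h.mono fun w hw => hw.uv)
    simpa only [hc (dirV E)] using this
  · exact LinearQuadratic.eval_dirU (q := fun y => coefUU W H y) hs (hd _) hs
      (h.mono fun w hw => hw.uu)
  · have := LinearQuadratic.eval_dirU (q := fun y => coefUE G W H c y) hs (hd _) (hd _)
      (h.mono fun w hw => hw.ue c)
    simpa only [hc (dirE c)] using this
  · have := LinearQuadratic.eval_dirU (q := fun y => coefEE G W b c y) hs (hd _) (hd _)
      (h.mono fun w hw => hw.ee b c)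
    simpa only [hc (dirE c), hc (dirE b)] using this

theorem dirV_fst (h : KundtKilling G W H ξ z) : (dir (dirV E) ξ z).1 = 0 := by
  simpa [LinearQuadratic.eval, LinearQuadratic.a, LinearQuadratic.b, LinearQuadratic.c, coefVV]
    using h.vv

theorem dir_dirV_fst (h : ∀ᶠ w in 𝓝 z, KundtKilling G W H ξ w) (a : ℝ × ℝ × E) :
    (dir a (dir (dirV E) ξ) z).1 = 0 := by
  have h1 := dir_clm (contDiffAt_dir h.self_of_nhds.smooth (dirV E)) (projU E) a
  have h2 : ∀ᶠ w in 𝓝 z, projU E (dir (dirV E) ξ w) = 0 := h.mono fun w hw => hw.dirV_fst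
  rw [dir_eq_zero h2] at h1
  exact h1.symm

theorem h_dirV (h : KundtKilling G W H ξ z) (c : E) :
    G.h z.2.2 (dir (dirV E) ξ z).2.2 c = -(dir (dirE c) ξ z).1 := by
  have h1 := h.ve c
  simp [LinearQuadratic.eval, LinearQuadratic.a, LinearQuadratic.b, LinearQuadratic.c, coefVE]
    at h1
  linarith

theorem dirV_snd (h : KundtKilling G W H ξ z) :
    (dir (dirU E) ξ z).1 + (dir (dirV E) ξ z).2.1 + z.2.1 * W z.2.2 (dir (dirV E) ξ z).2.2
      = 0 := by
  have h1 := h.uv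
  simp [LinearQuadratic.eval, LinearQuadratic.a, LinearQuadratic.b, LinearQuadratic.c, coefUV]
    at h1
  linarith

/-- The transverse part is affine in `v`: by `ve` its `v`-derivative is minus the gradient of the
`∂_u`-component, which does not depend on `v`. -/
theorem dirV_dirV_trans (hz : z.2.2 ∈ G.Ω) (h : ∀ᶠ w in 𝓝 z, KundtKilling G W H ξ w) :
    (dir (dirV E) (dir (dirV E) ξ) z).2.2 = 0 := by
  have hs := h.self_of_nhds.smooth
  have hd := contDiffAt_dir hs
  refine G.ext_h hz fun c => ?_
  have h1 := LinearQuadratic.eval_dirV (q := fun y => coefVE G c y) (hd _) (hd _) (hd _)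
      (h.mono fun w hw => hw.ve c)
  rw [dir_comm hs (dirV E) (dirE c)] at h1
  simp [LinearQuadratic.a, LinearQuadratic.b, LinearQuadratic.c, coefVE, dir_dirV_fst h] at h1
  rw [h1, map_zero, zero_apply]

/-- The `v`-derivative of `uv`, in which the `∂_u`-component and the second derivative of the
transverse part drop out. -/
theorem dirV_dirV_snd (hz : z.2.2 ∈ G.Ω) (h : ∀ᶠ w in 𝓝 z, KundtKilling G W H ξ w) :
    (dir (dirV E) (dir (dirV E) ξ) z).2.1 + W z.2.2 (dir (dirV E) ξ z).2.2 = 0 := by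
  have hs := h.self_of_nhds.smooth
  have hd := contDiffAt_dir hs
  have h1 := LinearQuadratic.eval_dirV (q := fun y => coefUV W y) (hd _) (hd _) (hd _)
      (h.mono fun w hw => hw.uv)
  rw [dir_comm hs (dirV E) (dirU E)] at h1
  simp [LinearQuadratic.a, LinearQuadratic.b, LinearQuadratic.c, coefUV, dir_dirV_fst h,
    dirV_dirV_trans hz h] at h1
  exact h1

theorem dir_dirV_dirV_trans (hz : z.2.2 ∈ G.Ω) (h : ∀ᶠ w in 𝓝 z, KundtKilling G W H ξ w)
    (a : ℝ × ℝ × E) : (dir a (dir (dirV E) (dir (dirV E) ξ)) z).2.2 = 0 := by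
  have h1 := dir_clm (contDiffAt_dir (contDiffAt_dir h.self_of_nhds.smooth (dirV E)) (dirV E))
    (projE E) a
  have h2 : ∀ᶠ w in 𝓝 z, projE E (dir (dirV E) (dir (dirV E) ξ) w) = 0 := by
    filter_upwards [h.eventually_nhds,
      (projE E).continuous.continuousAt.eventually (G.eventually_mem hz)] with w hw hw'
    exact dirV_dirV_trans hw' hw
  rw [dir_eq_zero h2] at h1
  exact h1.symm

theorem dir_dirV_dirV_snd (hz : z.2.2 ∈ G.Ω) (hW : ContDiffAt ℝ ∞ W z.2.2)
    (h : ∀ᶠ w in 𝓝 z, KundtKilling G W H ξ w) (a : ℝ × ℝ × E) :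
    (dir a (dir (dirV E) (dir (dirV E) ξ)) z).2.1
      + fderiv ℝ W z.2.2 a.2.2 (dir (dirV E) ξ z).2.2
      + W z.2.2 (dir a (dir (dirV E) ξ) z).2.2 = 0 := by
  have hη := contDiffAt_dir h.self_of_nhds.smooth (dirV E)
  have hζ := contDiffAt_dir hη (dirV E)
  have h2 : ∀ᶠ w in 𝓝 z, projV E (dir (dirV E) (dir (dirV E) ξ) w)
      + W w.2.2 (projE E (dir (dirV E) ξ w)) = 0 := by
    filter_upwards [h.eventually_nhds,
      (projE E).continuous.continuousAt.eventually (G.eventually_mem hz)] with w hw hw'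
    exact dirV_dirV_snd hw' hw
  have e1 := (projV E).hasFDerivAt.comp z hζ.diff.hasFDerivAt
  have e2 := (projE E).hasFDerivAt.comp z hη.diff.hasFDerivAt
  have e3 : HasFDerivAt (fun w : ℝ × ℝ × E => W w.2.2) ((fderiv ℝ W z.2.2).comp (projE E)) z :=
    HasFDerivAt.comp (g := W) z hW.diff.hasFDerivAt (projE E).hasFDerivAt
  have e4 := fderiv_eq_zero_of_eventually_eq_zero h2 (e1.add (e3.clm_apply e2))
  have e5 := DFunLike.congr_fun e4 a
  simp at e5
  simp only [dir] at e5 ⊢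
  linear_combination e5

/-- The `u`-derivative and the `v`-derivative at `v = 0` are related along the slice. -/
theorem dirE_dirV_snd (h : ∀ᶠ w in 𝓝 (0, 0, y), KundtKilling G W H ξ w) (c : E) :
    (dir (dirE c) (dir (dirU E) ξ) (0, 0, y)).1
      + (dir (dirE c) (dir (dirV E) ξ) (0, 0, y)).2.1 = 0 := by
  have hs := h.self_of_nhds.smooth
  have e1 := fderiv_slice ((projU E).contDiff.contDiffAt.comp _
    (contDiffAt_dir hs (dirU E))) c
  have e2 := fderiv_slice ((projV E).contDiff.contDiffAt.comp _
    (contDiffAt_dir hs (dirV E))) c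
  have d1 := contDiffAt_slice ((projU E).contDiff.contDiffAt.comp _
    (contDiffAt_dir hs (dirU E)))
  have d2 := contDiffAt_slice ((projV E).contDiff.contDiffAt.comp _
    (contDiffAt_dir hs (dirV E)))
  have e3 := fderiv_eq_zero_of_eventually_eq_zero
    (by
      filter_upwards [(tendsto_slice y).eventually h] with x hx
      have := hx.dirV_snd
      simpa using this) (d1.diff.hasFDerivAt.add d2.diff.hasFDerivAt)
  have e4 := DFunLike.congr_fun e3 c
  rw [add_apply, e1, e2] at e4
  have e5 := dir_clm (contDiffAt_dir hs (dirU E)) (projU E) (dirE c)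
  have e6 := dir_clm (contDiffAt_dir hs (dirV E)) (projV E) (dirE c)
  have e7 : projU E (dir (dirE c) (dir (dirU E) ξ) (0, 0, y))
      + projV E (dir (dirE c) (dir (dirV E) ξ) (0, 0, y)) = 0 := by
    rw [← e5, ← e6]
    exact e4
  exact e7

theorem fderiv_slice_clm {F : Type*} [NormedAddCommGroup F] [NormedSpace ℝ F]
    {f : ℝ × ℝ × E → ℝ × ℝ × E} (hf : ContDiffAt ℝ ∞ f (0, 0, y)) (L : ℝ × ℝ × E →L[ℝ] F) (c : E) :
    fderiv ℝ (fun y => L (f (0, 0, y))) y c = L (dir (dirE c) f (0, 0, y)) := by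
  rw [← dir_clm hf L]
  exact fderiv_slice (f := fun w => L (f w)) (L.contDiff.contDiffAt.comp _ hf) c

theorem contDiffAt_slice_clm {F : Type*} [NormedAddCommGroup F] [NormedSpace ℝ F]
    {f : ℝ × ℝ × E → ℝ × ℝ × E} (hf : ContDiffAt ℝ ∞ f (0, 0, y)) (L : ℝ × ℝ × E →L[ℝ] F) :
    ContDiffAt ℝ ∞ (fun y => L (f (0, 0, y))) y :=
  contDiffAt_slice (L.contDiff.contDiffAt.comp _ hf)

/-- The Killing equations transverse to `∂_u`, `∂_v` to first order in `v`. -/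
theorem hess_slice (h : ∀ᶠ w in 𝓝 (0, 0, y), KundtKilling G W H ξ w) (b c : E) :
    fderiv ℝ G.h y (dir (dirV E) ξ (0, 0, y)).2.2 b c
      + G.h y (dir (dirE b) (dir (dirV E) ξ) (0, 0, y)).2.2 c
      + G.h y b (dir (dirE c) (dir (dirV E) ξ) (0, 0, y)).2.2
      + W y c * (dir (dirE b) ξ (0, 0, y)).1 + W y b * (dir (dirE c) ξ (0, 0, y)).1 = 0 := by
  have hs := h.self_of_nhds.smooth
  have hd := contDiffAt_dir hs
  have h1 := LinearQuadratic.eval_dirV (q := fun y => coefEE G W b c y) hs (hd _) (hd _)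
      (h.mono fun w hw => hw.ee b c)
  rw [dir_comm hs (dirV E) (dirE b), dir_comm hs (dirV E) (dirE c)] at h1
  simp [LinearQuadratic.a, LinearQuadratic.b, LinearQuadratic.c, coefEE] at h1
  linear_combination h1

/-- The Killing equations along `∂_u` and a transverse vector to second order in `v`. -/
theorem quad_slice (hy : y ∈ G.Ω) (hW : ContDiffAt ℝ ∞ W y)
    (h : ∀ᶠ w in 𝓝 (0, 0, y), KundtKilling G W H ξ w) (c : E) :
    -(W y (dir (dirV E) ξ (0, 0, y)).2.2 * W y c)
      + 2 * (fderiv ℝ W y (dir (dirV E) ξ (0, 0, y)).2.2 c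
        + W y (dir (dirE c) (dir (dirV E) ξ) (0, 0, y)).2.2)
      - (fderiv ℝ W y c (dir (dirV E) ξ (0, 0, y)).2.2
        + W y (dir (dirE c) (dir (dirV E) ξ) (0, 0, y)).2.2)
      + 4 * H y * (dir (dirE c) ξ (0, 0, y)).1 = 0 := by
  have hs' := h.mono fun w hw => hw.smooth
  have hs := h.self_of_nhds.smooth
  have hd := fun a => hs'.mono fun w hw => contDiffAt_dir hw a
  have h1 := LinearQuadratic.eval_dirV_dirV (q := fun y => coefUE G W H c y) hs' (hd _) (hd _)
      (h.mono fun w hw => hw.ue c)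
  have h2 := dirV_dirV_snd hy h
  have h3 := dir_dirV_dirV_trans hy h (dirU E)
  have h4 := dir_dirV_dirV_snd hy hW h (dirE c)
  rw [dir_dir_comm hs', dir_dir_comm hs', dir_comm hs (dirV E) (dirE c),
    dir_comm hs (dirV E) (dirU E)] at h1
  simp [LinearQuadratic.a, LinearQuadratic.b, LinearQuadratic.c, coefUE, h3, dir_dirV_fst h] at h1
  simp only [dirE] at h1 h4 ⊢
  linear_combination h1 - h4 - W y c * h2

/-- The Killing equation along `∂_u ∂_u` to second order in `v`. -/
theorem lieH_slice (hy : y ∈ G.Ω) (hW : ContDiffAt ℝ ∞ W y)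
    (h : ∀ᶠ w in 𝓝 (0, 0, y), KundtKilling G W H ξ w) :
    2 * fderiv ℝ H y (ξ (0, 0, y)).2.2
      + W y (dir (dirV E) (dir (dirU E) ξ) (0, 0, y)).2.2 = 0 := by
  have hs' := h.mono fun w hw => hw.smooth
  have hs := h.self_of_nhds.smooth
  have hd := fun a => hs'.mono fun w hw => contDiffAt_dir hw a
  have h1 := LinearQuadratic.eval_dirV_dirV (q := fun y => coefUU W H y) hs' (hd _) hs'
      (h.mono fun w hw => hw.uu)
  have h2 := h.self_of_nhds.dirV_snd
  have h4 := dir_dirV_dirV_snd hy hW h (dirU E)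
  rw [dir_dir_comm hs', dir_comm hs (dirV E) (dirU E)] at h1
  rw [dir_comm hs (dirV E) (dirU E)]
  simp [LinearQuadratic.a, LinearQuadratic.b, LinearQuadratic.c, coefUU] at h1
  simp [dirU] at h1 h2 h4 ⊢
  linear_combination h1 - h4 - 4 * H y * h2

/-- The Killing equations along `∂_u` and a transverse vector to first order in `v`. -/
theorem lieW_slice (h : ∀ᶠ w in 𝓝 (0, 0, y), KundtKilling G W H ξ w) (c : E) :
    fderiv ℝ W y (ξ (0, 0, y)).2.2 c + W y (dir (dirE c) ξ (0, 0, y)).2.2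
      = 2 * (dir (dirE c) (dir (dirU E) ξ) (0, 0, y)).1 := by
  have hs := h.self_of_nhds.smooth
  have hd := contDiffAt_dir hs
  have h1 := LinearQuadratic.eval_dirV (q := fun y => coefUE G W H c y) hs (hd _) (hd _)
      (h.mono fun w hw => hw.ue c)
  have h2 := h.self_of_nhds.dirV_snd
  have h3 := (killing_dirU h).h_dirV c
  have h4 := dirE_dirV_snd h c
  rw [dir_comm hs (dirV E) (dirE c)] at h1
  simp [LinearQuadratic.a, LinearQuadratic.b, LinearQuadratic.c, coefUE] at h1 h2 h3
  linear_combination h1 - h3 - h4 - W y c * h2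

set_option synthInstance.maxHeartbeats 200000 in
/-- A Killing field of the Kundt metric induces a symmetry of the transverse data. -/
theorem kundtSymmetry (hy : y ∈ G.Ω) (hW : ContDiffAt ℝ ∞ W y)
    (h : ∀ᶠ w in 𝓝 (0, 0, y), KundtKilling G W H ξ w) :
    KundtSymmetry G W H (fun x => projE E (ξ (0, 0, x)))
      (fun x => -projE E (dir (dirV E) (dir (dirU E) ξ) (0, 0, x)))
      (fun x => projU E (dir (dirU E) ξ (0, 0, x))) y := by
  -- The fields `grad`, `hess` and `quad` are equations of the Killing field `∂_u ξ`, whose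
  -- `∂_u`-component on the slice is `ρ`; `killing`, `lieW` and `lieH` come from `ξ` itself.
  have hτ : ∀ᶠ w in 𝓝 (0, 0, y), KundtKilling G W H (dir (dirU E) ξ) w :=
    h.eventually_nhds.mono fun w hw => killing_dirU hw
  have hs := h.self_of_nhds.smooth
  have hsτ := contDiffAt_dir hs (dirU E)
  have hsη := contDiffAt_dir hsτ (dirV E)
  have hv : ∀ c, fderiv ℝ (fun x => -projE E (dir (dirV E) (dir (dirU E) ξ) (0, 0, x))) y c
      = -projE E (dir (dirE c) (dir (dirV E) (dir (dirU E) ξ)) (0, 0, y)) := by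
    intro c
    rw [fderiv_fun_neg, neg_apply, fderiv_slice_clm hsη]
  refine ⟨contDiffAt_slice_clm hs _, (contDiffAt_slice_clm hsη _).neg, contDiffAt_slice_clm hsτ _,
    fun a b => ?_, fun c => ?_, fun c => ?_, fun b c => ?_, fun c => ?_, ?_⟩
  · have h1 := h.self_of_nhds.ee a b
    simp [LinearQuadratic.eval, LinearQuadratic.a, LinearQuadratic.b, LinearQuadratic.c, coefEE]
      at h1
    rw [fderiv_slice_clm hs, fderiv_slice_clm hs]
    exact h1
  · rw [fderiv_slice_clm hs, fderiv_slice_clm hsτ]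
    exact lieW_slice h c
  · have h1 := hτ.self_of_nhds.h_dirV c
    rw [fderiv_slice_clm hsτ, map_neg, neg_apply]
    simp only [projE_apply, projU_apply]
    linear_combination -h1
  · have h1 := hess_slice hτ b c
    rw [hv, hv, fderiv_slice_clm hsτ, fderiv_slice_clm hsτ]
    simp only [map_neg, neg_apply, projE_apply, projU_apply]
    linear_combination -h1
  · have h1 := quad_slice hy hW hτ c
    rw [hv, fderiv_slice_clm hsτ]
    simp only [map_neg, neg_apply, projE_apply, projU_apply]
    linear_combination h1
  · have h1 := lieH_slice hy hW h
    simp only [map_neg, projE_apply]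
    linear_combination 1 / 2 * h1

end KundtKilling

end KundtForm

end Kundt

/-! ### From local homogeneity of the Kundt metric to symmetries of the triple. -/

namespace Kundt

variable {n : ℕ} {M : Type*} [TopologicalSpace M] [ChartedSpace (EuclideanSpace ℝ (Fin n)) M]

namespace LocalParam

variable (P : LocalParam (𝓡 n) M)

/-- The parametrization of `ℝ × ℝ × M` induced by a parametrization of `M`. -/
def timesPlane : LocalParam (model n) (ℝ × ℝ × M) where
  f z := (z.1, z.2.1, P.f z.2.2)
  g x := (x.1, x.2.1, P.g x.2.2)
  U := {z | z.2.2 ∈ P.U}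
  V := {x | x.2.2 ∈ P.V}
  isOpen_U := P.isOpen_U.preimage (by fun_prop)
  isOpen_V := P.isOpen_V.preimage (by fun_prop)
  maps_f z hz := P.maps_f _ hz
  maps_g x hx := P.maps_g _ hx
  left_inv z hz := by
    have := P.left_inv _ hz
    simp [this]
  right_inv x hx := by
    have := P.right_inv _ hx
    simp [this]
  smooth_f z hz :=
    (contDiff_fst.contMDiff.contMDiffAt).prodMk
      (((contDiff_fst.comp contDiff_snd).contMDiff.contMDiffAt).prodMk
        (ContMDiffAt.comp (g := P.f) z (P.smooth_f _ hz)
          (contDiff_snd.comp contDiff_snd).contMDiff.contMDiffAt))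
  smooth_g x hx :=
    contMDiffAt_fst.prodMk_space
      ((contMDiffAt_fst.comp x contMDiffAt_snd).prodMk_space
        (ContMDiffAt.comp (g := P.g) x (P.smooth_g _ hx) (contMDiffAt_snd.comp x contMDiffAt_snd)))

variable {P}

theorem timesPlane_d {z : ℝ × ℝ × EuclideanSpace ℝ (Fin n)} (hz : z.2.2 ∈ P.U)
    (a : ℝ × ℝ × EuclideanSpace ℝ (Fin n)) :
    P.timesPlane.d z a = ((a.1, a.2.1, P.d z.2.2 a.2.2) : ℝ × ℝ × EuclideanSpace ℝ (Fin n)) := by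
  have hE : MDifferentiableAt 𝓘(ℝ, ℝ × ℝ × EuclideanSpace ℝ (Fin n)) 𝓘(ℝ, EuclideanSpace ℝ (Fin n))
      (fun z : ℝ × ℝ × EuclideanSpace ℝ (Fin n) => z.2.2) z :=
    (by fun_prop : DifferentiableAt ℝ (fun z : ℝ × ℝ × EuclideanSpace ℝ (Fin n) => z.2.2) z
      ).mdifferentiableAt
  have h1 : MDifferentiableAt 𝓘(ℝ, ℝ × ℝ × EuclideanSpace ℝ (Fin n)) 𝓘(ℝ, ℝ)
      (fun z : ℝ × ℝ × EuclideanSpace ℝ (Fin n) => z.1) z :=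
    (by fun_prop : DifferentiableAt ℝ (fun z : ℝ × ℝ × EuclideanSpace ℝ (Fin n) => z.1) z
      ).mdifferentiableAt
  have h2 : MDifferentiableAt 𝓘(ℝ, ℝ × ℝ × EuclideanSpace ℝ (Fin n)) 𝓘(ℝ, ℝ)
      (fun z : ℝ × ℝ × EuclideanSpace ℝ (Fin n) => z.2.1) z :=
    (by fun_prop : DifferentiableAt ℝ (fun z : ℝ × ℝ × EuclideanSpace ℝ (Fin n) => z.2.1) z
      ).mdifferentiableAt
  have h3 : MDifferentiableAt 𝓘(ℝ, ℝ × ℝ × EuclideanSpace ℝ (Fin n)) (𝓡 n)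
      (fun z : ℝ × ℝ × EuclideanSpace ℝ (Fin n) => P.f z.2.2) z :=
    MDifferentiableAt.comp (g := P.f) z (P.mdiff_f hz) hE
  have e2 := mfderiv_prodMk h2 h3
  have e1 := mfderiv_prodMk h1 (h2.prodMk h3)
  have e3 := mfderiv_comp (g := P.f) z (P.mdiff_f hz) hE
  have f1 : fderiv ℝ (fun z : ℝ × ℝ × EuclideanSpace ℝ (Fin n) => z.1) z = projU _ :=
    (projU (EuclideanSpace ℝ (Fin n))).fderiv
  have f2 : fderiv ℝ (fun z : ℝ × ℝ × EuclideanSpace ℝ (Fin n) => z.2.1) z = projV _ :=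
    (projV (EuclideanSpace ℝ (Fin n))).fderiv
  have f3 : fderiv ℝ (fun z : ℝ × ℝ × EuclideanSpace ℝ (Fin n) => z.2.2) z = projE _ :=
    (projE (EuclideanSpace ℝ (Fin n))).fderiv
  have g1 := mfderiv_eq_fderiv (𝕜 := ℝ) (f := fun z : ℝ × ℝ × EuclideanSpace ℝ (Fin n) => z.1) (x := z)
  have g2 := mfderiv_eq_fderiv (𝕜 := ℝ) (f := fun z : ℝ × ℝ × EuclideanSpace ℝ (Fin n) => z.2.1) (x := z)
  have g3 := mfderiv_eq_fderiv (𝕜 := ℝ) (f := fun z : ℝ × ℝ × EuclideanSpace ℝ (Fin n) => z.2.2) (x := z)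
  have k1 := DFunLike.congr_fun e1 a
  have k2 := DFunLike.congr_fun e2 a
  have k3 := DFunLike.congr_fun e3 a
  refine k1.trans (Prod.ext (DFunLike.congr_fun (g1.trans f1) a) ?_)
  refine k2.trans (Prod.ext (DFunLike.congr_fun (g2.trans f2) a) ?_)
  refine k3.trans ?_
  exact congrArg (P.d z.2.2) (DFunLike.congr_fun (g3.trans f3) a)

variable [IsManifold (𝓡 n) ∞ M]

theorem pullForm_metric (T : Triple n M) {z : ℝ × ℝ × EuclideanSpace ℝ (Fin n)}
    (hz : z.2.2 ∈ P.U) (a b : ℝ × ℝ × EuclideanSpace ℝ (Fin n)) :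
    P.timesPlane.pullForm T.metric z a b
      = kundtForm (P.localMetric T.h) (P.pullOneForm T.W) (fun y => T.H (P.f y)) z a b :=
  congrArg₂ (T.metric (P.timesPlane.f z)) (timesPlane_d hz a) (timesPlane_d hz b)

theorem kundtKilling_of_isKillingNear (T : Triple n M) {y : EuclideanSpace ℝ (Fin n)} (hy : y ∈ P.U)
    {ξ : Π x : ℝ × ℝ × M, TangentSpace (model n) x}
    (h : IsKillingNear (model n) T.metric ξ (P.timesPlane.f (0, 0, y))) :
    ∀ᶠ w in 𝓝 (0, 0, y), KundtKilling (P.localMetric T.h) (P.pullOneForm T.W)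
      (fun y => T.H (P.f y)) (P.timesPlane.pull ξ) w := by
  have hy' : ((0, 0, y) : ℝ × ℝ × EuclideanSpace ℝ (Fin n)) ∈ P.timesPlane.U := hy
  filter_upwards [(P.timesPlane.isKillingNear_iff hy').1 h, P.timesPlane.eventually_mem_U hy']
    with z h1 hz
  have hz' : z.2.2 ∈ P.U := hz
  refine KundtKilling.of_kundtForm hz' (P.contDiffAt_pullOneForm T hz')
    (P.contDiffAt_comp_f hz' T.smooth_H.contMDiffAt) h1.1 fun a b => ?_
  have h2 := h1.2 (fun _ => a) (fun _ => b) contDiffAt_const contDiffAt_const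
  have h3 : (fun w => P.timesPlane.pullForm T.metric w a b) =ᶠ[𝓝 z]
      fun w => kundtForm (P.localMetric T.h) (P.pullOneForm T.W) (fun y => T.H (P.f y)) w a b :=
    (P.timesPlane.eventually_mem_U hz).mono fun w hw => pullForm_metric T hw a b
  rw [h3.fderiv_eq, pullForm_metric T hz', pullForm_metric T hz'] at h2
  simp only [fderiv_fun_const, Pi.zero_apply, zero_apply, zero_sub] at h2
  simp only [kundtForm, Prod.fst_neg, Prod.snd_neg, map_neg, neg_apply] at h2 ⊢
  linear_combination h2

theorem hasSymmetries {T : Triple n M} (hT : T.LocallyHomogeneous) :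
    HasSymmetries (P.localMetric T.h) (P.pullOneForm T.W) (fun y => T.H (P.f y)) := by
  intro y hy a
  -- Only the directions tangent to the slice, at its points, are used from local homogeneity.
  obtain ⟨ξ, hξ, ha⟩ := hT (P.timesPlane.f (0, 0, y)) (P.timesPlane.d (0, 0, y) (0, 0, a))
  have hy' : ((0, 0, y) : ℝ × ℝ × EuclideanSpace ℝ (Fin n)) ∈ P.timesPlane.U := hy
  have h1 := kundtKilling_of_isKillingNear T hy hξ
  have h2 : P.timesPlane.pull ξ (0, 0, y) = (0, 0, a) := by
    rw [P.timesPlane.pull_apply hy', ha, P.timesPlane.dinv_d hy']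
  have h3 := ((tendsto_slice y).eventually h1.eventually_nhds).mp
    ((P.eventually_mem_U hy).mono fun z hz hk =>
      KundtKilling.kundtSymmetry (y := z) hz (P.contDiffAt_pullOneForm T hz) hk)
  exact ⟨_, _, _, congrArg (projE _) h2, h3⟩

end LocalParam

end Kundt

/-! ### Left-invariance at a point, the connectedness argument and the theorem. -/

namespace Kundt

theorem lieForm_congr {E : Type*} [NormedAddCommGroup E] [NormedSpace ℝ E] {W : E → E →L[ℝ] ℝ}
    {ξ η : E → E} {z : E} (h : ξ =ᶠ[𝓝 z] η) : lieForm W ξ z = lieForm W η z := by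
  rw [lieForm, lieForm, h.fderiv_eq, h.self_of_nhds]

theorem LocalMetric.IsKillingAt.congr {E : Type*} [NormedAddCommGroup E] [NormedSpace ℝ E]
    {G : LocalMetric E} {ξ η : E → E} {z : E} (hξ : G.IsKillingAt ξ z) (h : ξ =ᶠ[𝓝 z] η) :
    G.IsKillingAt η z := by
  refine ⟨hξ.smooth.congr_of_eventuallyEq h.symm, fun a b => ?_⟩
  rw [← h.fderiv_eq, ← h.self_of_nhds]
  exact hξ.killing a b

theorem LocalParam.pullOneForm_zero {E : Type*} [NormedAddCommGroup E] [NormedSpace ℝ E]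
    {H : Type*} [TopologicalSpace H] {I : ModelWithCorners ℝ E H}
    {M : Type*} [TopologicalSpace M] [ChartedSpace H M] (P : LocalParam I M) (z : E) :
    P.pullOneForm (fun _ => 0) z = 0 := by
  ext a
  rfl

variable {n : ℕ} {M : Type*} [TopologicalSpace M] [ChartedSpace (EuclideanSpace ℝ (Fin n)) M]
  [IsManifold (𝓡 n) ∞ M]

/-- The condition of left-invariance at a point. -/
def Triple.LeftInvariantAt (T : Triple n M) (p : M) : Prop :=
  ∃ ξ : Fin n → Π x : M, TangentSpace (𝓡 n) x,
    (∀ i, T.KillingNear (ξ i) p ∧ IsLieDerivNear (𝓡 n) (ξ i) T.W (fun _ => 0) p) ∧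
    LinearIndependent ℝ (fun i => ξ i p)

namespace LocalParam

variable {P : LocalParam (𝓡 n) M} {T : Triple n M} {y : EuclideanSpace ℝ (Fin n)}

theorem eventually_differentiableAt_pullOneForm (hy : y ∈ P.U) :
    ∀ᶠ z in 𝓝 y, DifferentiableAt ℝ (P.pullOneForm T.W) z :=
  (P.eventually_mem_U hy).mono fun _ hz => (P.contDiffAt_pullOneForm T hz).diff

theorem killingNear_push (hy : y ∈ P.U)
    {ξ : EuclideanSpace ℝ (Fin n) → EuclideanSpace ℝ (Fin n)}
    (hξ : ∀ᶠ z in 𝓝 y, (P.localMetric T.h).IsKillingAt ξ z) :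
    T.KillingNear (P.push ξ) (P.f y) := by
  refine (P.killing_iff hy).2 ?_
  filter_upwards [hξ, P.eventually_mem_U hy] with z h1 hz
  exact h1.congr (P.eventually_pull_push hz ξ).symm

theorem isLieDerivNear_push (hy : y ∈ P.U)
    {ξ : EuclideanSpace ℝ (Fin n) → EuclideanSpace ℝ (Fin n)}
    (hξ : ∀ᶠ z in 𝓝 y, ContDiffAt ℝ ∞ ξ z)
    {β : Π x : M, TangentSpace (𝓡 n) x →L[ℝ] ℝ}
    (hβ : ∀ᶠ z in 𝓝 y, P.pullOneForm β z = lieForm (P.pullOneForm T.W) ξ z) :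
    IsLieDerivNear (𝓡 n) (P.push ξ) T.W β (P.f y) := by
  refine (P.isLieDerivNear_iff hy ?_ (eventually_differentiableAt_pullOneForm hy)).2 ?_
  · filter_upwards [hξ, P.eventually_mem_U hy] with z h1 hz
    exact h1.congr_of_eventuallyEq (P.eventually_pull_push hz ξ)
  · filter_upwards [hβ, P.eventually_mem_U hy] with z h1 hz
    rw [h1, lieForm_congr (P.eventually_pull_push hz ξ)]

theorem leftInvariantAt_iff (hy : y ∈ P.U) :
    T.LeftInvariantAt (P.f y) ↔
      ∃ ξ : Fin n → EuclideanSpace ℝ (Fin n) → EuclideanSpace ℝ (Fin n),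
        (∀ i, ∀ᶠ z in 𝓝 y, (P.localMetric T.h).IsKillingAt (ξ i) z ∧
          lieForm (P.pullOneForm T.W) (ξ i) z = 0) ∧ LinearIndependent ℝ (fun i => ξ i y) := by
  constructor
  · rintro ⟨ξ, h1, h2⟩
    refine ⟨fun i => P.pull (ξ i), fun i => ?_, ?_⟩
    · have h3 := (P.killing_iff hy).1 (h1 i).1
      have h4 := (P.isLieDerivNear_iff hy (h3.mono fun z hz => hz.smooth)
        (eventually_differentiableAt_pullOneForm hy)).1 (h1 i).2
      filter_upwards [h3, h4] with z h3 h4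
      rw [← h4, pullOneForm_zero]
      exact ⟨h3, rfl⟩
    · refine LinearIndependent.of_comp (P.d y).toLinearMap ?_
      convert h2 using 2 with i
      exact P.d_pull hy (ξ i)
  · rintro ⟨ξ, h1, h2⟩
    refine ⟨fun i => P.push (ξ i), fun i => ⟨killingNear_push hy ((h1 i).mono fun z hz => hz.1),
      isLieDerivNear_push hy ((h1 i).mono fun z hz => hz.1.smooth) ?_⟩, ?_⟩
    · filter_upwards [h1 i] with z hz
      rw [hz.2, pullOneForm_zero]
    · refine LinearIndependent.of_comp (P.dinv (P.f y)).toLinearMap ?_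
      have e : (fun i => P.dinv (P.f y) (P.push (ξ i) (P.f y))) = fun i => ξ i y :=
        funext fun i => (congrArg (P.dinv (P.f y)) (P.push_apply hy (ξ i))).trans (P.dinv_d hy _)
      exact (congrArg (fun v : Fin n → EuclideanSpace ℝ (Fin n) => LinearIndependent ℝ v) e).mpr h2

/-- The same fields serve at nearby points, since linear independence of finitely many vectors is an
open condition. -/
theorem eventually_leftInvariantAt (hy : y ∈ P.U) (h : T.LeftInvariantAt (P.f y)) :
    ∀ᶠ z in 𝓝 y, T.LeftInvariantAt (P.f z) := by
  obtain ⟨ξ, h1, h2⟩ := (leftInvariantAt_iff hy).1 h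
  have h3 : ContinuousAt (fun z i => ξ i z) y :=
    continuousAt_pi.2 fun i => (h1 i).self_of_nhds.1.smooth.continuousAt
  filter_upwards [P.eventually_mem_U hy, eventually_all.2 fun i => (h1 i).eventually_nhds,
    h3.eventually h2.eventually] with z hz h4 h5
  exact (leftInvariantAt_iff hz).2 ⟨ξ, h4, h5⟩

theorem leftInvariantAt_of_forall (hy : y ∈ P.U)
    (h : ∀ a, ∃ ξ : EuclideanSpace ℝ (Fin n) → EuclideanSpace ℝ (Fin n), ξ y = a ∧
      ∀ᶠ z in 𝓝 y, (P.localMetric T.h).IsKillingAt ξ z ∧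
        lieForm (P.pullOneForm T.W) ξ z = 0) : T.LeftInvariantAt (P.f y) := by
  choose ξ h1 h2 using h
  let b := (EuclideanSpace.basisFun (Fin n) ℝ).toBasis
  refine (leftInvariantAt_iff hy).2 ⟨fun i => ξ (b i), fun i => h2 _, ?_⟩
  simp only [h1]
  exact b.linearIndependent

theorem not_leftInvariantAt {κ : ℝ} (hn : n ≠ 0) (hy : y ∈ P.U)
    (hS : ∀ a b, (P.localMetric T.h).defect κ (P.pullOneForm T.W) y a b = 0)
    (hN : (P.localMetric T.h).normSq (P.pullOneForm T.W) y + 4 * κ ≠ 0) :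
    ¬ T.LeftInvariantAt (P.f y) := by
  intro h
  obtain ⟨ξ, h1, h2⟩ := (leftInvariantAt_iff hy).1 h
  have h3 : Submodule.span ℝ (Set.range fun i => ξ i y) = ⊤ :=
    h2.span_eq_top_of_card_eq_finrank' (by simp)
  have h4 := (P.localMetric T.h).subsingleton_of_lieForm_eq_zero hy hS hN ξ
    (fun i => (h1 i).self_of_nhds.1) (fun i => (h1 i).self_of_nhds.2) h3
  have h5 := finrank_zero_of_subsingleton (R := ℝ) (M := EuclideanSpace ℝ (Fin n))
  rw [finrank_euclideanSpace_fin] at h5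
  exact hn h5

-- Pulls the fibre back to covectors in coordinates and applies `eq_top_of_lieForm_mem`: every
-- coordinate Lie derivative of `W` along a Killing field comes from an element of `T.lieIter (P.f
-- y) 1`.
set_option synthInstance.maxHeartbeats 200000 in
theorem fibre_one_eq_top {κ : ℝ} (hκ : (P.localMetric T.h).HasCurvature κ) (hy : y ∈ P.U)
    (hS : ∀ a b, (P.localMetric T.h).defect κ (P.pullOneForm T.W) y a b = 0)
    (hN : (P.localMetric T.h).normSq (P.pullOneForm T.W) y + 4 * κ ≠ 0) :
    T.fibre (P.f y) 1 = ⊤ := by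
  let D : EuclideanSpace ℝ (Fin n) →L[ℝ] EuclideanSpace ℝ (Fin n) := P.dinv (P.f y)
  let F : Submodule ℝ (EuclideanSpace ℝ (Fin n) →L[ℝ] ℝ) := T.fibre (P.f y) 1
  let Φ : (EuclideanSpace ℝ (Fin n) →L[ℝ] ℝ) →ₗ[ℝ] (EuclideanSpace ℝ (Fin n) →L[ℝ] ℝ) :=
    { toFun := fun γ => γ.comp D
      map_add' := fun γ δ => rfl
      map_smul' := fun c γ => rfl }
  have key : F.comap Φ = ⊤ := by
    refine (P.localMetric T.h).eq_top_of_lieForm_mem hκ hy hS hN _ fun ξ hξ => ?_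
    -- A one-form on all of `M` is required; its values off the chart do not matter, as the Lie
    -- derivative is tested only near the point.
    let β : Π x : M, TangentSpace (𝓡 n) x →L[ℝ] ℝ := fun x =>
      (lieForm (P.pullOneForm T.W) ξ (P.g x)).comp (P.dinv x)
    have hβ : ∀ᶠ z in 𝓝 y, P.pullOneForm β z = lieForm (P.pullOneForm T.W) ξ z := by
      filter_upwards [P.eventually_mem_U hy] with z hz
      ext a
      have h1 : P.pullOneForm β z a
        = lieForm (P.pullOneForm T.W) ξ (P.g (P.f z)) (P.dinv (P.f z) (P.d z a)) := rfl
      rw [h1, P.dinv_d hz, P.left_inv z hz]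
    have h1 : β (P.f y) = Φ (lieForm (P.pullOneForm T.W) ξ y) := by
      have h2 := P.left_inv y hy
      exact congrArg (fun x => (lieForm (P.pullOneForm T.W) ξ x).comp D) h2
    have h3 : β (P.f y) ∈ T.fibre (P.f y) 1 :=
      Submodule.subset_span ⟨β, ⟨T.W, rfl, P.push ξ, killingNear_push hy hξ,
        isLieDerivNear_push hy (hξ.mono fun z hz => hz.smooth) hβ⟩, rfl⟩
    rw [h1] at h3
    exact h3
  refine Submodule.eq_top_iff'.2 fun γ => ?_
  have h1 : (γ.comp (P.d y) : EuclideanSpace ℝ (Fin n) →L[ℝ] ℝ) ∈ F.comap Φ := by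
    rw [key]
    trivial
  have h2 : Φ (γ.comp (P.d y)) = γ := by
    ext a
    exact congrArg γ (P.d_dinv hy a)
  rw [Submodule.mem_comap, h2] at h1
  exact h1

theorem eq_normSq_div {c : ℝ} (hy : y ∈ P.U)
    (h : ∀ w : TangentSpace (𝓡 n) (P.f y), T.IsSharp (P.f y) w → T.H (P.f y) = T.W (P.f y) w / c) :
    T.H (P.f y) = (P.localMetric T.h).normSq (P.pullOneForm T.W) y / c := by
  refine h (P.d y ((P.localMetric T.h).sharp y (P.pullOneForm T.W y))) fun a => ?_
  have h1 := (P.localMetric T.h).sharp_spec y hy (P.pullOneForm T.W y) (P.dinv (P.f y) a)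
  rw [localMetric_h, P.d_dinv hy] at h1
  exact h1.trans (congrArg (T.W (P.f y)) (P.d_dinv hy a))

theorem leftInvariantAt_or (hT : T.LocallyHomogeneous) {κ : ℝ} (hκ : HasConstantCurvature T.h κ)
    (hflat : 2 ≤ n → κ = 0 →
      ∀ (x : M) (w : TangentSpace (𝓡 n) x), T.IsSharp x w → T.H x = T.W x w / 8) (hy : y ∈ P.U) :
    T.LeftInvariantAt (P.f y) ∨
      ∃ κ' : ℝ, (P.localMetric T.h).HasCurvature κ' ∧
        ∀ᶠ z in 𝓝 y, (∀ a b, (P.localMetric T.h).defect κ' (P.pullOneForm T.W) z a b = 0) ∧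
          (P.localMetric T.h).normSq (P.pullOneForm T.W) z + 4 * κ' ≠ 0 := by
  refine (LocalMetric.dichotomy (P.hasCurvature hκ) (fun z hz => P.contDiffAt_pullOneForm T hz)
    (fun z hz => P.contDiffAt_comp_f hz T.smooth_H.contMDiffAt) (hasSymmetries hT)
    (fun h2 h0 z hz => ?_) hy).imp_left (leftInvariantAt_of_forall hy)
  rw [finrank_euclideanSpace_fin] at h2
  exact eq_normSq_div hz (hflat h2 h0 _)

end LocalParam

theorem exists_chartParam (p : M) :
    ∃ (P : LocalParam (𝓡 n) M) (y : EuclideanSpace ℝ (Fin n)), y ∈ P.U ∧ P.f y = p := by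
  have hp : p ∈ (chartParam (𝓡 n) p).V := mem_extChartAt_source (I := 𝓡 n) p
  exact ⟨chartParam (𝓡 n) p, _, (chartParam (𝓡 n) p).maps_g p hp,
    (chartParam (𝓡 n) p).right_inv p hp⟩

open LocalParam in
theorem Triple.not_leftInvariantAt [ConnectedSpace M] {T : Triple n M}
    (hT : T.LocallyHomogeneous) {κ : ℝ} (hκ : HasConstantCurvature T.h κ)
    (hflat : 2 ≤ n → κ = 0 →
      ∀ (x : M) (w : TangentSpace (𝓡 n) x), T.IsSharp x w → T.H x = T.W x w / 8)
    (hn : n ≠ 0) (hW : ¬ T.LeftInvariant) (p : M) : ¬ T.LeftInvariantAt p := by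
  have hopen : IsOpen {q | T.LeftInvariantAt q} := by
    refine isOpen_iff_mem_nhds.2 fun q hq => ?_
    obtain ⟨P, y, hy, rfl⟩ := exists_chartParam (n := n) q
    exact (P.eventually_nhds_f hy).2 (eventually_leftInvariantAt hy hq)
  -- Off this set the second alternative of `leftInvariantAt_or` holds on a neighbourhood, and it
  -- excludes left-invariance at each point there.
  have hclosed : IsClosed {q | T.LeftInvariantAt q} := by
    refine ⟨isOpen_iff_mem_nhds.2 fun q hq => ?_⟩
    obtain ⟨P, y, hy, rfl⟩ := exists_chartParam (n := n) q
    obtain ⟨κ', -, h⟩ := (leftInvariantAt_or hT hκ hflat hy).resolve_left hq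
    refine (P.eventually_nhds_f hy).2 ?_
    filter_upwards [h, P.eventually_mem_U hy] with z h1 hz
    exact LocalParam.not_leftInvariantAt hn hz h1.1 h1.2
  rcases isClopen_iff.1 ⟨hclosed, hopen⟩ with h | h
  · exact fun hp => (Set.eq_empty_iff_forall_notMem.1 h) p hp
  · exact absurd (fun q => Set.eq_univ_iff_forall.1 h q) hW

theorem Triple.leftInvariant_of_eq_zero (T : Triple n M) (hn : n = 0) : T.LeftInvariant := by
  subst hn
  exact fun p => ⟨fun i => i.elim0, fun i => i.elim0, linearIndependent_empty_type⟩

end Kundt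

end

theorem mainTheorem9 {n : ℕ} {M : Type*} [TopologicalSpace M]
    [ChartedSpace (EuclideanSpace ℝ (Fin n)) M] [IsManifold (𝓡 n) ∞ M]
    [T2Space M] [SecondCountableTopology M] [ConnectedSpace M]
    (T : Kundt.Triple n M) (hT : T.LocallyHomogeneous)
    (κ : ℝ) (hκ : Kundt.HasConstantCurvature T.h κ)
    (hflat : 2 ≤ n → κ = 0 →
      ∀ (x : M) (w : TangentSpace (𝓡 n) x), T.IsSharp x w → T.H x = T.W x w / 8)
    (hW : ¬ T.LeftInvariant) (p : M) :
    Module.finrank ℝ (T.fibre p 1) = n ∧ Module.finrank ℝ (T.calI p) = n := by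
  -- In dimension zero the empty family of Killing fields makes `W` left-invariant.
  have hn : n ≠ 0 := fun h0 => hW (T.leftInvariant_of_eq_zero h0)
  have hp := Kundt.Triple.not_leftInvariantAt hT hκ hflat hn hW p
  have hF : T.fibre p 1 = ⊤ := by
    obtain ⟨P, y, hy, rfl⟩ := Kundt.exists_chartParam (n := n) p
    obtain ⟨κ', hκ', h⟩ := (Kundt.LocalParam.leftInvariantAt_or hT hκ hflat hy).resolve_left hp
    exact Kundt.LocalParam.fibre_one_eq_top hκ' hy h.self_of_nhds.1 h.self_of_nhds.2
  have hI : T.calI p = ⊤ := top_le_iff.1 (hF.symm.le.trans (le_iSup (fun k => T.fibre p (k + 1)) 0))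
  have hd : Module.finrank ℝ (TangentSpace (𝓡 n) p →L[ℝ] ℝ) = n :=
    (Kundt.finrank_dual_clm (E := EuclideanSpace ℝ (Fin n))).trans finrank_euclideanSpace_fin
  rw [hF, hI, finrank_top]
  exact ⟨hd, hd⟩
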